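/- **Setting.** A sensor has a battery of capacity $B=2$, empty at time $0$. Energy units arrive one at a time according to a Poisson process of rate $1$; a unit arriving at a full battery is lost; each update consumes one unit. Let $s_0=0$, let $s_n$ be the time of the $n$-th update, $x_n=s_n-s_{n-1}$, let $n(T)$ be the number of updates by time $T$, and let $r(T)=\tfrac12\sum_{i=1}^{n(T)}x_i^2+\tfrac12(T-s_{n(T)})^2$ be the area under the age curve on $[0,T]$. The long-term average age is $\limsup_{T\to\infty}\mathbb E[r(T)]/T$. A *renewal policy* is a tuple $(x_1,y_1,y_2,\bar y_2)$ of a constant $x_1\ge 0$ and measurable functions with $y_1(t)\ge t$, $y_2(t)\ge t$, $\bar y_2(t_1,t_2)\ge t_1+t_2$ for all $t,t_1,t_2\ge0$. After an instant at which the battery has been left empty (time $0$, or an update using the last unit), let $t_1$ be the time to the next arrival and $t_2$ the time between that arrival and the following one: if $t_2> y_1(t_1)-t_1$, the next update is sent after a delay $y_1(t_1)$ and leaves the battery empty; otherwise it is sent after a delay $\bar y_2(t_1,t_2)$ and leaves one unit. After an update that leaves one unit, let $t$ be the time to the next arrival: if $t>x_1$, the next update is sent after a delay $x_1$ and leaves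 the battery empty; otherwise it is sent after a delay $y_2(t)$ and leaves one unit. Only policies whose inter-update times have bounded second moments, $\sup_n\mathbb E[x_n^2]<\infty$, are considered. An *epoch* is the time between two consecutive instants at which the battery is left empty (the first one starts at time $0$); $L$ is the length of the first epoch and $R=\tfrac12\sum x_i^2$, over the updates in it, is the area under the age curve. Let $$p_2(\lambda)=\inf_{x_1,y_1,y_2,\bar y_2}\big(\mathbb E[R]-\lambda\,\mathbb E[L]\big)\in[-\infty,\infty).$$ **Theorem.** 1. For every such policy $\mathbb E[R]<\infty$, $0<\mathbb E[L]<\infty$, and the long-term average age equals $\mathbb E[R]/\mathbb E[L]$. 2. Let $\lambda\ge0$ with $e^{-\lambda}-\tfrac12\lambda^2>0$, and put $x_1(\lambda)=\log\dfrac{1}{e^{-\lambda}-\frac12\lambda^2}$. Then $x_1(\lambda)\ge 0$, the infimum $p_2(\lambda)$ is attained by the energy-dependent threshold policy $$x_1=x_1(\lambda),\qquad y_1(t)=\max(t,x_1(\lambda)),\qquad y_2(t)=\max(t,\lambda),\qquad \bar y_2(t_1,t_2)=\max(t_1+t_2,\lambda)$$ (with a full battery, update as soon as the age is at least $\lambda$;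 with one unit, as soon as it is at least $x_1(\lambda)$), whose inter-update times have bounded second moments, and $$p_2(\lambda)=\tfrac12\lambda^2+(\lambda+1)e^{-\lambda}+\lambda-\Big(e^{-\lambda}-\tfrac12\lambda^2+1\Big)\log\frac{1}{e^{-\lambda}-\frac12\lambda^2}.$$ If moreover $\lambda>0$, then $x_1(\lambda)>\lambda$, and every minimizing policy coincides with this one: $x_1=x_1(\lambda)$, $y_1(t)=\max(t,x_1(\lambda))$ for a.e. $t>0$, $y_2(t)=\max(t,\lambda)$ for a.e. $0<t<x_1(\lambda)$, and $\bar y_2(t_1,t_2)=\max(t_1+t_2,\lambda)$ for a.e. $t_1,t_2>0$ with $t_1+t_2<x_1(\lambda)$ (other values are used with probability $0$). 3. If $\lambda\ge0$ and $e^{-\lambda}-\tfrac12\lambda^2\le0$, then $p_2(\lambda)=-\infty$. 4. There is exactly one real $\lambda^*$ with $p_2(\lambda^*)=0$. It satisfies $\lambda^*>0$, $e^{-\lambda^*}-\frac12(\lambda^*)^2>0$, is a zero of the closed form in 2, and $|\lambda^*-0.72|<0.005$, $|x_1(\lambda^*)-1.48|<0.005$. It is the optimal long-term average age: every renewal policy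 (with bounded second moments) has long-term average age at least $\lambda^*$, the threshold policy of 2 with $\lambda=\lambda^*$ attains $\lambda^*$, and every policy attaining $\lambda^*$ coincides with that threshold policy in the sense of 2. -/

import Mathlib

open MeasureTheory ProbabilityTheory Filter Topology
open scoped NNReal ENNReal

namespace AgeOfInformation

/-- The `k`-th energy arrival time (counted from `k = 0`), for the inter-arrival times `τ`. -/
noncomputable def arrivalTime {Ω : Type*} (τ : ℕ → Ω → ℝ) (k : ℕ) (ω : Ω) : ℝ :=
  ∑ i ∈ Finset.range (k + 1), τ i ω

/-- The number of energy arrivals up to and including time `s`. -/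
noncomputable def numArrivals {Ω : Type*} (τ : ℕ → Ω → ℝ) (s : ℝ) (ω : Ω) : ℕ :=
  Set.ncard {k : ℕ | arrivalTime τ k ω ≤ s}

/-- The time from `s` to the first energy arrival after `s`. -/
noncomputable def firstWait {Ω : Type*} (τ : ℕ → Ω → ℝ) (s : ℝ) (ω : Ω) : ℝ :=
  arrivalTime τ (numArrivals τ s ω) ω - s

/-- The time from the first to the second energy arrival after `s`. -/
noncomputable def secondWait {Ω : Type*} (τ : ℕ → Ω → ℝ) (s : ℝ) (ω : Ω) : ℝ :=
  τ (numArrivals τ s ω + 1) ω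

/-- A renewal status-update policy for a battery of two energy units.  All values are
inter-update delays (equivalently, the age at which the next update is submitted).
* `x₁`: delay after an update that leaves one unit, if no unit arrives before `x₁`.
* `y₂ t`: delay after an update that leaves one unit, if the next unit (filling the battery)
  arrives at age `t ≤ x₁`.
* `y₁ t`: delay after an update that leaves the battery empty, if the first unit arrives at age
  `t` and no second unit arrives by age `y₁ t`.
* `y₂bar t₁ t₂`: delay after an update that leaves the battery empty, if the first unit arrives
  at age `t₁` and the second one `t₂` later, with `t₂ ≤ y₁ t₁ - t₁`.

The inequalities are the energy causality constraints. -/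
structure RenewalPolicy where
  x₁ : ℝ
  y₁ : ℝ → ℝ
  y₂ : ℝ → ℝ
  y₂bar : ℝ → ℝ → ℝ
  measurable_y₁ : Measurable y₁
  measurable_y₂ : Measurable y₂
  measurable_y₂bar : Measurable (Function.uncurry y₂bar)
  x₁_nonneg : 0 ≤ x₁
  le_y₁ : ∀ t, 0 ≤ t → t ≤ y₁ t
  le_y₂ : ∀ t, 0 ≤ t → t ≤ y₂ t
  le_y₂bar : ∀ t₁ t₂, 0 ≤ t₁ → 0 ≤ t₂ → t₁ + t₂ ≤ y₂bar t₁ t₂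

namespace RenewalPolicy

variable {Ω : Type*}

/-- The delay until the next update, when the last update left `k` units in the battery, the
first energy arrival after it comes `t₁` time units later and the following one another `t₂`
time units later. -/
noncomputable def delay (π : RenewalPolicy) (k : Fin 2) (t₁ t₂ : ℝ) : ℝ :=
  if k = 0 then
    if t₂ ≤ π.y₁ t₁ - t₁ then π.y₂bar t₁ t₂ else π.y₁ t₁
  else
    if t₁ ≤ π.x₁ then π.y₂ t₁ else π.x₁

/-- The number of units left in the battery by the next update, in the situation of `delay`.
The update is sent from a full battery (leaving one unit) or from one unit (leaving none);
arrivals at a full battery are lost. -/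
noncomputable def remaining (π : RenewalPolicy) (k : Fin 2) (t₁ t₂ : ℝ) : Fin 2 :=
  if k = 0 then
    if t₂ ≤ π.y₁ t₁ - t₁ then 1 else 0
  else
    if t₁ ≤ π.x₁ then 1 else 0

/-- The time of the `n`-th update and the energy left in the battery right after it, when the
energy inter-arrival times are `τ`; for `n = 0`, time `0` with an empty battery. -/
noncomputable def state (π : RenewalPolicy) (τ : ℕ → Ω → ℝ) : ℕ → Ω → ℝ × Fin 2
  | 0, _ => (0, 0)
  | n + 1, ω =>
    let s := (π.state τ n ω).1
    let k := (π.state τ n ω).2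
    (s + π.delay k (firstWait τ s ω) (secondWait τ s ω),
      π.remaining k (firstWait τ s ω) (secondWait τ s ω))

/-- The time of the `n`-th update (`0` for `n = 0`). -/
noncomputable def updateTime (π : RenewalPolicy) (τ : ℕ → Ω → ℝ) (n : ℕ) (ω : Ω) : ℝ :=
  (π.state τ n ω).1

/-- The energy left in the battery right after the `n`-th update. -/
noncomputable def energy (π : RenewalPolicy) (τ : ℕ → Ω → ℝ) (n : ℕ) (ω : Ω) : Fin 2 :=
  (π.state τ n ω).2

/-- The time between the `n`-th and the `(n+1)`-st update. -/
noncomputable def interUpdate (π : RenewalPolicy) (τ : ℕ → Ω → ℝ) (n : ℕ) (ω : Ω) : ℝ :=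
  π.updateTime τ (n + 1) ω - π.updateTime τ n ω

/-- The number of updates sent by time `T`. -/
noncomputable def numUpdates (π : RenewalPolicy) (τ : ℕ → Ω → ℝ) (T : ℝ) (ω : Ω) : ℕ :=
  Set.ncard {n : ℕ | 1 ≤ n ∧ π.updateTime τ n ω ≤ T}

/-- The area under the age curve on `[0, T]`. -/
noncomputable def ageArea (π : RenewalPolicy) (τ : ℕ → Ω → ℝ) (T : ℝ) (ω : Ω) : ℝ :=
  (1 / 2) * ∑ i ∈ Finset.range (π.numUpdates τ T ω), π.interUpdate τ i ω ^ 2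
    + (1 / 2) * (T - π.updateTime τ (π.numUpdates τ T ω) ω) ^ 2

/-- The `(n+1)`-st update belongs to the first epoch: the battery has not been left empty by
any of the updates `1, …, n`. -/
def InEpoch (π : RenewalPolicy) (τ : ℕ → Ω → ℝ) (n : ℕ) (ω : Ω) : Prop :=
  ∀ k, 1 ≤ k → k ≤ n → π.energy τ k ω = 1

open Classical in
/-- The area `R` under the age curve in an epoch, the time between two consecutive updates that
leave the battery empty. -/
noncomputable def epochArea (π : RenewalPolicy) (τ : ℕ → Ω → ℝ) (ω : Ω) : ℝ≥0∞ :=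
  ∑' n, if π.InEpoch τ n ω then ENNReal.ofReal ((1 / 2) * π.interUpdate τ n ω ^ 2) else 0

open Classical in
/-- The length `L` of an epoch. -/
noncomputable def epochLength (π : RenewalPolicy) (τ : ℕ → Ω → ℝ) (ω : Ω) : ℝ≥0∞ :=
  ∑' n, if π.InEpoch τ n ω then ENNReal.ofReal (π.interUpdate τ n ω) else 0

variable [MeasurableSpace Ω]

/-- The expected area `𝔼[R]`. -/
noncomputable def meanArea (π : RenewalPolicy) (P : Measure Ω) (τ : ℕ → Ω → ℝ) : ℝ≥0∞ :=
  ∫⁻ ω, π.epochArea τ ω ∂P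

/-- The expected length `𝔼[L]`. -/
noncomputable def meanLength (π : RenewalPolicy) (P : Measure Ω) (τ : ℕ → Ω → ℝ) : ℝ≥0∞ :=
  ∫⁻ ω, π.epochLength τ ω ∂P

/-- The long-term average age `limsup_{T → ∞} 𝔼[r(T)] / T`. -/
noncomputable def averageAge (π : RenewalPolicy) (P : Measure Ω) (τ : ℕ → Ω → ℝ) : ℝ≥0∞ :=
  limsup (fun T : ℝ => (∫⁻ ω, ENNReal.ofReal (π.ageArea τ T ω) ∂P) / ENNReal.ofReal T) atTop

/-- The inter-update times have a bounded second moment. -/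
def UniformlyBounded (π : RenewalPolicy) (P : Measure Ω) (τ : ℕ → Ω → ℝ) : Prop :=
  ∃ C : ℝ≥0, ∀ n, ∫⁻ ω, ENNReal.ofReal (π.interUpdate τ n ω ^ 2) ∂P ≤ C

/-- The parametrized objective `𝔼[R] - l 𝔼[L]`. -/
noncomputable def objective (π : RenewalPolicy) (P : Measure Ω) (τ : ℕ → Ω → ℝ)
    (l : ℝ) : ℝ :=
  (π.meanArea P τ).toReal - l * (π.meanLength P τ).toReal

/-- The energy-dependent threshold policy: with a full battery update as soon as the age is at
least `l`, with one unit as soon as the age is at least `x`. -/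
noncomputable def threshold (l x : ℝ) (hx : 0 ≤ x) : RenewalPolicy where
  x₁ := x
  y₁ t := max t x
  y₂ t := max t l
  y₂bar t₁ t₂ := max (t₁ + t₂) l
  measurable_y₁ := by fun_prop
  measurable_y₂ := by fun_prop
  measurable_y₂bar := by
    simp only [Function.uncurry_def]
    fun_prop
  x₁_nonneg := hx
  le_y₁ t _ := le_max_left t x
  le_y₂ t _ := le_max_left t l
  le_y₂bar t₁ t₂ _ _ := le_max_left (t₁ + t₂) l

/-- The policy is the threshold policy with thresholds `l` and `x`, up to null sets of arrival
times and up to the values of `y₂`, `y₂bar` at arrival times for which they are never used: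
`y₂ t` is used for `t ≤ x` only, and `y₂bar t₁ t₂` for `t₁ + t₂ ≤ y₁ t₁ = max t₁ x` only. -/
def IsThreshold (π : RenewalPolicy) (l x : ℝ) : Prop :=
  π.x₁ = x ∧
  (∀ᵐ t : ℝ, 0 < t → π.y₁ t = max t x) ∧
  (∀ᵐ t : ℝ, 0 < t → t < x → π.y₂ t = max t l) ∧
  (∀ᵐ t : ℝ × ℝ, 0 < t.1 → 0 < t.2 → t.1 + t.2 < x → π.y₂bar t.1 t.2 = max (t.1 + t.2) l)

end RenewalPolicy

/-- The optimal value `p₂(l)` of the parametrized problem: the infimum of `𝔼[R] - l 𝔼[L]` over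
all (uniformly bounded) renewal policies. -/
noncomputable def p₂ {Ω : Type*} [MeasurableSpace Ω] (P : Measure Ω) (τ : ℕ → Ω → ℝ)
    (l : ℝ) : EReal :=
  ⨅ (π : RenewalPolicy) (_ : π.UniformlyBounded P τ), ((π.objective P τ l : ℝ) : EReal)

/-- `e^{-l} - l² / 2`. -/
noncomputable def expGap (l : ℝ) : ℝ := Real.exp (-l) - (1 / 2) * l ^ 2

/-- The threshold for one energy unit, `log (1 / (e^{-l} - l² / 2))`. -/
noncomputable def lowThreshold (l : ℝ) : ℝ := Real.log (1 / expGap l)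

/-- The closed form of `p₂(l)`. -/
noncomputable def p₂Formula (l : ℝ) : ℝ :=
  (1 / 2) * l ^ 2 + (l + 1) * Real.exp (-l) + l
    - (Real.exp (-l) - (1 / 2) * l ^ 2 + 1) * Real.log (1 / (Real.exp (-l) - (1 / 2) * l ^ 2))

end AgeOfInformation

namespace AgeOfInformation

/-! Because the exponential law has no memory, the arrivals after each update form a fresh Poisson
process, independent of the past (`lintegral_step`, `FreshAt.succ`). The updates are therefore a
Markov renewal process with two states, the number of units left. Let q be `refill`, let p = e^{-x₁}
be `drain`, and let m₀, m₁ be the means of some function of the delay from the two states. An epoch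
makes one step from the empty state and then, with probability q, a geometric number of steps of
mean 1/p from the other, so its mean total is m₀ + (q/p) m₁ (`lintegral_epoch`).

Long-term average: let V₀(T), V₁(T) be the expected numbers of visits by time T. Counting entries
into the empty state gives V₁ p = V₀ q up to an error of at most 1 (`visits_balance`). So T and
𝔼[r(T)] both equal V₀(T) times the corresponding epoch mean, up to a bounded term and the
contribution of the interval that covers T. Truncating that contribution bounds it by M + ε V₀(T),
and V₀(T) = O(T). Division gives the limit 𝔼[R]/𝔼[L] (`averageAge_eq_epochMean_div`).

Optimization: a delay y costs y²/2 - λy, and the objective is m₀ + q e^{x₁} m₁ for the means of this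
cost. With a full battery the best delay is clearly max(t, λ). With one unit, let v be the value of
a next arrival beyond its immediate cost. The expected cost, as a function of the threshold y, has
derivative proportional to e^{-y} `marginal λ v y` (`waitCost_eq`). For v = λ - x with λ ≤ x this
derivative changes sign only at x, so the same x is the best choice for x₁ and for every y₁(t).
Consistency, namely that v is also the least value of e^{x₁} m₁, amounts to e^{-x} = e^{-λ} - λ²/2
(`excess_lowThreshold`). The objective then equals the closed form plus nonnegative gaps due to ȳ₂,
y₁, y₂ and x₁ (`objective_eq_add`). This yields the value, a minimizer and its uniqueness. If e^{-λ}
- λ²/2 ≤ 0, letting x₁ tend to infinity drives the objective to -∞.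

Finally, an average age of at least λ means 𝔼[R] - λ 𝔼[L] ≥ 0, and the left side is strictly
decreasing in λ since 𝔼[L] > 0. Hence a zero of p₂ is unique and is the optimal age; Taylor bounds
and the intermediate value theorem locate it. -/

instance : IsProbabilityMeasure (expMeasure 1) := isProbabilityMeasure_expMeasure one_pos

/-! ### The exponential law -/

lemma expMeasure_one_eq :
    expMeasure 1 = (volume.restrict (Set.Ioi (0 : ℝ))).withDensity
      (fun t => ENNReal.ofReal (Real.exp (-t))) := by
  rw [← withDensity_indicator measurableSet_Ioi]
  refine withDensity_congr_ae ?_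
  -- The two densities differ at 0, where `exponentialPDF` is positive.
  have h0 : ∀ᵐ t : ℝ, t ≠ 0 := by simp [ae_iff]
  filter_upwards [h0] with t ht
  show exponentialPDF 1 t = _
  rw [exponentialPDF_eq]
  rcases lt_or_gt_of_ne ht with h | h
  · simp [not_le.2 h, h.le]
  · simp [h, h.le]

lemma lintegral_expMeasure (f : ℝ → ℝ≥0∞) (hf : Measurable f) :
    ∫⁻ t, f t ∂(expMeasure 1) =
      ∫⁻ t in Set.Ioi (0 : ℝ), ENNReal.ofReal (Real.exp (-t)) * f t := by
  rw [expMeasure_one_eq, lintegral_withDensity_eq_lintegral_mul _ (by fun_prop) hf]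
  rfl

lemma ae_pos_expMeasure : ∀ᵐ t ∂(expMeasure 1), 0 < t := by
  rw [expMeasure_one_eq]
  exact (withDensity_absolutelyContinuous _ _).ae_le (ae_restrict_mem measurableSet_Ioi)

lemma ae_of_ae_expMeasure {p : ℝ → Prop} (h : ∀ᵐ t ∂(expMeasure 1), p t) :
    ∀ᵐ t : ℝ, 0 < t → p t := by
  rw [expMeasure_one_eq, ae_withDensity_iff (by fun_prop),
    ae_restrict_iff' measurableSet_Ioi] at h
  filter_upwards [h] with t ht h0
  exact ht h0 (by simp [Real.exp_pos])

lemma integral_expMeasure (f : ℝ → ℝ) :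
    ∫ t, f t ∂(expMeasure 1) = ∫ t in Set.Ioi (0 : ℝ), Real.exp (-t) * f t := by
  rw [expMeasure_one_eq, integral_withDensity_eq_integral_toReal_smul (by fun_prop) (by simp)]
  simp [ENNReal.toReal_ofReal (Real.exp_pos _).le]

/-- Lack of memory: e^{-(t+c)} = e^{-c} e^{-t}, so after a translation by c the overshoot has the
original law. -/
lemma lintegral_expMeasure_memoryless {c : ℝ} (hc : 0 ≤ c) (f : ℝ → ℝ≥0∞) (hf : Measurable f) :
    ∫⁻ t in Set.Ioi c, f (t - c) ∂(expMeasure 1) =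
      ENNReal.ofReal (Real.exp (-c)) * ∫⁻ t, f t ∂(expMeasure 1) := by
  rw [← lintegral_indicator measurableSet_Ioi, lintegral_expMeasure _
    ((by fun_prop : Measurable fun t => f (t - c)).indicator measurableSet_Ioi),
    lintegral_expMeasure f hf, ← lintegral_indicator measurableSet_Ioi,
    ← lintegral_indicator measurableSet_Ioi,
    ← lintegral_const_mul _ (by measurability),
    ← lintegral_add_right_eq_self _ c]
  refine lintegral_congr fun t => ?_
  by_cases ht : 0 < t
  · have : 0 < t + c := by linarith
    simp only [Set.indicator, Set.mem_Ioi, this, ht, if_true, lt_add_iff_pos_left,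
      add_sub_cancel_right]
    rw [← mul_assoc, ← ENNReal.ofReal_mul (Real.exp_pos _).le, ← Real.exp_add, neg_add, add_comm]
  · simp [Set.indicator, ht]

lemma expMeasure_Ioi {c : ℝ} (hc : 0 ≤ c) :
    expMeasure 1 (Set.Ioi c) = ENNReal.ofReal (Real.exp (-c)) := by
  simpa using lintegral_expMeasure_memoryless hc (fun _ => 1) measurable_const

/-- Here the factor e^{-c} stays an integral over the event of a wait beyond c, so that the two
branches of a decision at age c can be put together again. -/
lemma lintegral_expMeasure_memoryless' {c : ℝ} (hc : 0 ≤ c) (f : ℝ → ℝ≥0∞) (hf : Measurable f) :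
    ∫⁻ t in Set.Ioi c, f (t - c) ∂(expMeasure 1) =
      ∫⁻ _ in Set.Ioi c, ∫⁻ t, f t ∂(expMeasure 1) ∂(expMeasure 1) := by
  rw [lintegral_expMeasure_memoryless hc f hf, setLIntegral_const, expMeasure_Ioi hc, mul_comm]

/-! ### Sequences of inter-arrival times -/

/-- The sequence with first term `x` and further terms `b`. -/
def seqCons (x : ℝ) (b : ℕ → ℝ) : ℕ → ℝ
  | 0 => x
  | n + 1 => b n

/-- The `i`-th coordinate of a sequence, as a random variable. -/
def coord (i : ℕ) (a : ℕ → ℝ) : ℝ := a i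

/-- The law of a sequence of independent standard exponential variables. -/
noncomputable def seqLaw : Measure (ℕ → ℝ) := Measure.infinitePi fun _ => expMeasure 1

instance : IsProbabilityMeasure seqLaw := by unfold seqLaw; infer_instance

@[simp] lemma seqCons_zero (x : ℝ) (b : ℕ → ℝ) : seqCons x b 0 = x := rfl

@[simp] lemma seqCons_succ (x : ℝ) (b : ℕ → ℝ) (n : ℕ) : seqCons x b (n + 1) = b n := rfl

@[fun_prop] lemma measurable_coord (i : ℕ) : Measurable (coord i) := measurable_pi_apply i

lemma measurable_seqCons : Measurable fun p : ℝ × (ℕ → ℝ) => seqCons p.1 p.2 := by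
  refine measurable_pi_iff.2 fun n => ?_
  cases n with
  | zero => exact measurable_fst
  | succ n => exact (measurable_pi_apply n).comp measurable_snd

@[fun_prop] lemma measurable_seqCons_comp {α : Type*} [MeasurableSpace α] {f : α → ℝ} {g : α → ℕ → ℝ}
    (hf : Measurable f) (hg : Measurable g) : Measurable fun x => seqCons (f x) (g x) :=
  measurable_seqCons.comp (hf.prodMk hg)

/-- A product measure is determined by finite-dimensional boxes, and a box on an initial segment
splits into its zeroth coordinate and a shifted box. -/
lemma map_seqCons : ((expMeasure 1).prod seqLaw).map (fun p => seqCons p.1 p.2) = seqLaw := by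
  classical
  refine Measure.eq_infinitePi _ fun s t ht => ?_
  obtain ⟨n, hn⟩ := s.exists_nat_subset_range
  -- The given index set may omit coordinates. The omitted ones get `univ`, and `range (n + 1)`
  -- always contains the coordinate 0 to be split off.
  set t' : ℕ → Set ℝ := fun i => if i ∈ s then t i else Set.univ with ht'
  have hmt' : ∀ i, MeasurableSet (t' i) := fun i => by
    by_cases hi : i ∈ s <;> simp [ht', hi, ht]
  have hs : (s : Set ℕ).pi t = (Finset.range (n + 1) : Set ℕ).pi t' := by
    ext a
    simp only [Set.mem_pi, Finset.mem_coe]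
    refine ⟨fun h i _ => ?_, fun h i hi => ?_⟩
    · by_cases hi : i ∈ s
      · simpa [ht', hi] using h i hi
      · simp [ht', hi]
    · have := h i (Finset.range_subset_range.2 n.le_succ (hn hi))
      simpa [ht', hi] using this
  have hpre : (fun p : ℝ × (ℕ → ℝ) => seqCons p.1 p.2) ⁻¹'
      ((Finset.range (n + 1) : Set ℕ).pi t') =
      t' 0 ×ˢ (Finset.range n : Set ℕ).pi fun i => t' (i + 1) := by
    ext ⟨x, b⟩
    simp only [Set.mem_preimage, Set.mem_pi, Finset.coe_range, Set.mem_Iio, Set.mem_prod]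
    refine ⟨fun h => ⟨h 0 n.succ_pos, fun i hi => h (i + 1) (by omega)⟩, fun h i hi => ?_⟩
    cases i with
    | zero => exact h.1
    | succ i => exact h.2 i (by omega)
  rw [Measure.map_apply measurable_seqCons (.pi s.countable_toSet fun i _ => ht i), hs, hpre,
    Measure.prod_prod, seqLaw, Measure.infinitePi_pi _ fun i _ => hmt' _, mul_comm,
    ← Finset.prod_range_succ' fun i => expMeasure 1 (t' i),
    ← Finset.prod_subset (hn.trans (Finset.range_subset_range.2 n.le_succ))]
  · exact Finset.prod_congr rfl fun i hi => by simp [ht', hi]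
  · intro i _ hi
    simp [ht', hi]

lemma lintegral_seqLaw (F : (ℕ → ℝ) → ℝ≥0∞) (hF : Measurable F) :
    ∫⁻ a, F a ∂seqLaw = ∫⁻ x, ∫⁻ b, F (seqCons x b) ∂seqLaw ∂(expMeasure 1) := by
  conv_lhs => rw [← map_seqCons]
  rw [lintegral_map hF measurable_seqCons, lintegral_prod _ (by fun_prop)]

/-! ### The arrivals after a given time -/

/-- The inter-arrival times are positive and the arrival times tend to infinity. -/
def Good (a : ℕ → ℝ) : Prop :=
  (∀ i, 0 < a i) ∧ ∀ u, {k : ℕ | arrivalTime coord k a ≤ u}.Finite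

/-- The inter-arrival times seen from time `u` on. -/
noncomputable def after (u : ℝ) (a : ℕ → ℝ) : ℕ → ℝ :=
  seqCons (firstWait coord u a) fun j => a (numArrivals coord u a + 1 + j)

lemma seqCons_eta (a : ℕ → ℝ) : seqCons (a 0) (fun n => a (n + 1)) = a := by
  ext n
  cases n <;> rfl

lemma arrivalTime_seqCons_zero (x : ℝ) (b : ℕ → ℝ) : arrivalTime coord 0 (seqCons x b) = x := by
  simp [arrivalTime, coord]

lemma arrivalTime_seqCons_succ (k : ℕ) (x : ℝ) (b : ℕ → ℝ) :
    arrivalTime coord (k + 1) (seqCons x b) = x + arrivalTime coord k b := by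
  rw [arrivalTime, Finset.sum_range_succ', add_comm]
  rfl

lemma arrivalTime_pos {b : ℕ → ℝ} (hb : ∀ i, 0 < b i) (k : ℕ) : 0 < arrivalTime coord k b :=
  Finset.sum_pos (fun i _ => hb i) ⟨0, by simp⟩

lemma setOf_arrivalTime_seqCons {x u : ℝ} (h : x ≤ u) (b : ℕ → ℝ) :
    {k : ℕ | arrivalTime coord k (seqCons x b) ≤ u} =
      insert 0 (Nat.succ '' {k : ℕ | arrivalTime coord k b ≤ u - x}) := by
  ext k
  cases k with
  | zero => simp [arrivalTime_seqCons_zero, h]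
  | succ k => simp [arrivalTime_seqCons_succ, le_sub_iff_add_le']

lemma setOf_arrivalTime_seqCons_of_lt {x u : ℝ} (h : u < x) {b : ℕ → ℝ} (hb : ∀ i, 0 < b i) :
    {k : ℕ | arrivalTime coord k (seqCons x b) ≤ u} = ∅ := by
  ext k
  cases k with
  | zero => simp [arrivalTime_seqCons_zero, h]
  | succ k =>
    have := arrivalTime_pos hb k
    simp only [Set.mem_ofPred_eq, arrivalTime_seqCons_succ, Set.mem_empty_iff_false, iff_false,
      not_le]
    linarith

lemma good_seqCons_iff {x : ℝ} {b : ℕ → ℝ} : Good (seqCons x b) ↔ 0 < x ∧ Good b := by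
  refine ⟨fun h => ⟨h.1 0, fun i => h.1 (i + 1), fun u => ?_⟩, fun h => ⟨fun i => ?_, fun u => ?_⟩⟩
  · rcases le_or_gt 0 u with hu | hu
    · have := h.2 (x + u)
      rw [setOf_arrivalTime_seqCons (by linarith), Set.finite_insert, add_sub_cancel_left] at this
      exact this.of_finite_image (Nat.succ_injective.injOn)
    · convert Set.finite_empty
      ext k
      have := arrivalTime_pos (fun i => h.1 (i + 1)) k
      simp only [seqCons_succ, Set.mem_ofPred_eq, Set.mem_empty_iff_false, iff_false,
        not_le] at this ⊢
      exact hu.trans this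
  · cases i with
    | zero => exact h.1
    | succ i => exact h.2.1 i
  · rcases le_or_gt x u with hu | hu
    · rw [setOf_arrivalTime_seqCons hu]
      exact ((h.2.2 _).image _).insert _
    · rw [setOf_arrivalTime_seqCons_of_lt hu h.2.1]
      exact Set.finite_empty

lemma numArrivals_seqCons (u : ℝ) {x : ℝ} {b : ℕ → ℝ} (hb : Good b) :
    numArrivals coord u (seqCons x b) = if u < x then 0 else numArrivals coord (u - x) b + 1 := by
  unfold numArrivals
  split_ifs with h
  · rw [setOf_arrivalTime_seqCons_of_lt h hb.1, Set.ncard_empty]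
  · rw [setOf_arrivalTime_seqCons (not_lt.1 h), Set.ncard_insert_of_notMem (by simp)
      ((hb.2 _).image _), Set.ncard_image_of_injective _ Nat.succ_injective]

lemma after_seqCons (u : ℝ) {x : ℝ} {b : ℕ → ℝ} (hb : Good b) :
    after u (seqCons x b) = if u < x then seqCons (x - u) b else after (u - x) b := by
  unfold after firstWait
  rw [numArrivals_seqCons u hb]
  split_ifs with h
  · rw [arrivalTime_seqCons_zero]
    congr 1
    ext j
    rw [zero_add, add_comm, seqCons_succ]
  · rw [arrivalTime_seqCons_succ]
    congr 1
    · ring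
    · ext j
      rw [show numArrivals coord (u - x) b + 1 + 1 + j = numArrivals coord (u - x) b + 1 + j + 1
        by ring, seqCons_succ]

lemma Good.tail {a : ℕ → ℝ} (ha : Good a) : Good fun n => a (n + 1) := by
  rw [← seqCons_eta a, good_seqCons_iff] at ha
  exact ha.2

/-- Induction on the number of arrivals by time `s`: deleting the first arrival, at `x ≤ s`, leaves
one fewer arrival by time `s - x`. -/
lemma Good.induction {p : ℝ → (ℕ → ℝ) → Prop}
    (h₁ : ∀ s x b, Good (seqCons x b) → 0 ≤ s → s < x → p s (seqCons x b))
    (h₂ : ∀ s x b, Good (seqCons x b) → x ≤ s → p (s - x) b → p s (seqCons x b))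
    {s : ℝ} {a : ℕ → ℝ} (hs : 0 ≤ s) (ha : Good a) : p s a := by
  induction hn : numArrivals coord s a generalizing s a with
  | zero =>
    rw [← seqCons_eta a] at hn ha ⊢
    rw [numArrivals_seqCons _ (good_seqCons_iff.1 ha).2] at hn
    split_ifs at hn with h
    exact h₁ _ _ _ ha hs h
  | succ n ih =>
    rw [← seqCons_eta a] at hn ha ⊢
    rw [numArrivals_seqCons _ (good_seqCons_iff.1 ha).2] at hn
    split_ifs at hn with h
    rw [not_lt] at h
    exact h₂ _ _ _ ha h (ih (sub_nonneg.2 h) (good_seqCons_iff.1 ha).2 (by omega))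

lemma Good.after {s : ℝ} {a : ℕ → ℝ} (ha : Good a) (hs : 0 ≤ s) : Good (after s a) := by
  refine Good.induction (p := fun s a => Good (AgeOfInformation.after s a)) ?_ ?_ hs ha
  · intro s x b h _ hx
    rw [after_seqCons _ (good_seqCons_iff.1 h).2, if_pos hx, good_seqCons_iff]
    exact ⟨sub_pos.2 hx, (good_seqCons_iff.1 h).2⟩
  · intro s x b h hx hb
    rwa [after_seqCons _ (good_seqCons_iff.1 h).2, if_neg (not_lt.2 hx)]

/-- Flow property of the shift: shifting by the next delay, starting from the current update, is
shifting by the next update time. -/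
lemma after_after {s u : ℝ} {a : ℕ → ℝ} (ha : Good a) (hs : 0 ≤ s) (hu : 0 ≤ u) :
    after u (after s a) = after (s + u) a := by
  refine Good.induction (p := fun s a => after u (after s a) = after (s + u) a) ?_ ?_ hs ha
  · intro s x b h _ hx
    have hb := (good_seqCons_iff.1 h).2
    rw [after_seqCons _ hb, after_seqCons _ hb, if_pos hx, after_seqCons _ hb]
    simp only [lt_sub_iff_add_lt', sub_sub, sub_sub_eq_add_sub, add_comm u s]
  · intro s x b h hx ih
    have hb := (good_seqCons_iff.1 h).2
    rw [after_seqCons _ hb, after_seqCons _ hb, if_neg (not_lt.2 hx),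
      if_neg (by linarith), ih]
    congr 1
    ring

lemma after_zero {a : ℕ → ℝ} (ha : Good a) : after 0 a = a := by
  conv_lhs => rw [← seqCons_eta a]
  rw [after_seqCons _ ha.tail, if_pos (ha.1 0), sub_zero, seqCons_eta]

@[fun_prop] lemma measurable_arrivalTime (k : ℕ) : Measurable (arrivalTime coord k) := by
  unfold arrivalTime
  fun_prop

lemma measurable_ncard {α : Type*} [MeasurableSpace α] {s : ℕ → Set α}
    (hs : ∀ k, MeasurableSet (s k)) : Measurable fun a => Set.ncard {k : ℕ | a ∈ s k} := by
  -- For infinite sets both sides are 0: `Set.ncard` by convention, the right side because `toReal`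
  -- sends ∞ to 0.
  have h : ∀ a, Set.ncard {k : ℕ | a ∈ s k} =
      ⌊(∑' k : ℕ, (s k).indicator (fun _ => (1 : ℝ≥0∞)) a).toReal⌋₊ := by
    intro a
    have : ∑' k : ℕ, (s k).indicator (fun _ => (1 : ℝ≥0∞)) a =
        ({k : ℕ | a ∈ s k}.encard : ℝ≥0∞) := by
      rw [← ENNReal.tsum_set_one, tsum_subtype {k : ℕ | a ∈ s k} fun _ => (1 : ℝ≥0∞)]
      rfl
    rw [this, Set.ncard]
    generalize {k : ℕ | a ∈ s k}.encard = e
    cases e <;> simp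
  simp_rw [h]
  exact Nat.measurable_floor.comp
    (Measurable.tsum fun k => measurable_const.indicator (hs k)).ennreal_toReal

lemma measurable_numArrivals :
    Measurable fun p : ℝ × (ℕ → ℝ) => numArrivals coord p.1 p.2 :=
  measurable_ncard (s := fun k => {p : ℝ × (ℕ → ℝ) | arrivalTime coord k p.2 ≤ p.1})
    fun k => measurableSet_le (by fun_prop) measurable_fst

lemma measurable_after : Measurable fun p : ℝ × (ℕ → ℝ) => after p.1 p.2 := by
  have h₁ : Measurable fun q : ℕ × (ℕ → ℝ) => arrivalTime coord q.1 q.2 :=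
    measurable_from_prod_countable_right fun k => measurable_arrivalTime k
  have h₂ : ∀ j, Measurable fun q : ℕ × (ℕ → ℝ) => q.2 (q.1 + 1 + j) := fun j =>
    measurable_from_prod_countable_right fun k => measurable_pi_apply (k + 1 + j)
  refine measurable_seqCons_comp ?_ (measurable_pi_iff.2 fun j => ?_)
  · exact (h₁.comp (measurable_numArrivals.prodMk measurable_snd)).sub measurable_fst
  · exact (h₂ j).comp (measurable_numArrivals.prodMk measurable_snd)

lemma measurable_after_comp {α : Type*} [MeasurableSpace α] {f : α → ℝ} {g : α → ℕ → ℝ}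
    (hf : Measurable f) (hg : Measurable g) : Measurable fun x => after (f x) (g x) := by
  have h := measurable_after.comp (hf.prodMk hg)
  exact h

/-- If all arrivals come by time u, then the first one does, and so do all arrivals of the tail
sequence. By independence the probability e of this event satisfies e ≤ (1 - e^{-u}) e, hence
vanishes. Integer values of u suffice. -/
lemma ae_good : ∀ᵐ a ∂seqLaw, Good a := by
  have hpos : ∀ᵐ a ∂seqLaw, ∀ i, 0 < a i := ae_all_iff.2 fun i =>
    (measurePreserving_eval_infinitePi (fun _ : ℕ => expMeasure 1) i).quasiMeasurePreserving.ae
      ae_pos_expMeasure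
  set E : ℝ → Set (ℕ → ℝ) := fun u => {a | ∀ k, arrivalTime coord k a ≤ u} with hE
  have hEm : ∀ u, MeasurableSet (E u) := fun u => by
    simp only [hE, Set.ofPred_forall]
    exact .iInter fun k => measurableSet_le (by fun_prop) measurable_const
  have hmono : Monotone E := fun u v huv a ha k => (ha k).trans huv
  have h0 : ∀ u, 0 ≤ u → seqLaw (E u) = 0 := by
    intro u hu
    have h1 : seqLaw (E u) ≤ (1 - ENNReal.ofReal (Real.exp (-u))) * seqLaw (E u) := by
      calc seqLaw (E u) = ∫⁻ a, (E u).indicator 1 a ∂seqLaw := by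
            rw [lintegral_indicator_one (hEm u)]
        _ = ∫⁻ x, ∫⁻ b, (E u).indicator 1 (seqCons x b) ∂seqLaw ∂(expMeasure 1) :=
            lintegral_seqLaw _ (measurable_one.indicator (hEm u))
        _ ≤ ∫⁻ x, (Set.Iic u).indicator (fun _ => seqLaw (E u)) x ∂(expMeasure 1) := by
            refine lintegral_mono_ae ?_
            filter_upwards [ae_pos_expMeasure] with x hx
            rw [← lintegral_indicator_one (hEm u)]
            by_cases hxu : x ≤ u
            · rw [Set.indicator_of_mem (by exact hxu)]
              refine lintegral_mono fun b => ?_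
              by_cases hb : seqCons x b ∈ E u
              · have : b ∈ E u := fun k => by
                  have := hb (k + 1)
                  rw [arrivalTime_seqCons_succ] at this
                  linarith
                simp [this, hb]
              · simp [hb]
            · have hb : ∀ b, seqCons x b ∉ E u := fun b hb => hxu (by
                simpa [arrivalTime_seqCons_zero] using hb 0)
              simp [hb]
        _ = _ := by
            rw [lintegral_indicator measurableSet_Iic, setLIntegral_const, mul_comm]
            congr 1
            rw [← Set.compl_Ioi, prob_compl_eq_one_sub measurableSet_Ioi, expMeasure_Ioi hu]
    by_contra hne
    have h2 : (1 - ENNReal.ofReal (Real.exp (-u))) * seqLaw (E u) < 1 * seqLaw (E u) := by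
      refine (ENNReal.mul_lt_mul_iff_left hne (measure_ne_top _ _)).2 ?_
      exact ENNReal.sub_lt_self (by simp) (by simp) (by simp [Real.exp_pos])
    rw [one_mul] at h2
    exact absurd h1 (not_le.2 h2)
  have h3 : ∀ᵐ a ∂seqLaw, ∀ n : ℕ, a ∉ E n :=
    ae_all_iff.2 fun n => measure_eq_zero_iff_ae_notMem.1 (h0 n n.cast_nonneg)
  filter_upwards [hpos, h3] with a ha hn
  refine ⟨ha, fun u => ?_⟩
  obtain ⟨n, hun⟩ := exists_nat_ge u
  have := hn n
  simp only [hE, Set.mem_ofPred_eq, not_forall, not_le] at this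
  obtain ⟨k, hk⟩ := this
  refine (Set.finite_Iio k).subset fun j hj => ?_
  by_contra hjk
  have hle : arrivalTime coord k a ≤ arrivalTime coord j a :=
    Finset.sum_le_sum_of_subset_of_nonneg
      (Finset.range_subset_range.2 (by simp at hjk; omega)) fun i _ _ => (ha i).le
  have : arrivalTime coord j a ≤ u := hj
  linarith

/-! ### The strong Markov property -/

/-- A decision at age `c`: an arrival by then is used by an arbitrary `K`; otherwise the residual
wait followed by the later inter-arrival times is a fresh sequence. Both kinds of policy step have
this form. -/
lemma lintegral_memoryless_split {c : ℝ} (hc : 0 ≤ c) (K : ℝ → (ℕ → ℝ) → ℝ≥0∞)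
    {g : (ℕ → ℝ) → ℝ≥0∞} (hg : Measurable g) :
    ∫⁻ x, ∫⁻ b, (if x ≤ c then K x b else g (seqCons (x - c) b)) ∂seqLaw ∂(expMeasure 1) =
      ∫⁻ x, (if x ≤ c then ∫⁻ b, K x b ∂seqLaw else ∫⁻ b, g b ∂seqLaw) ∂(expMeasure 1) := by
  rw [← lintegral_add_compl _ (measurableSet_Iic (a := c)),
    ← lintegral_add_compl (fun x => if x ≤ c then _ else _) (measurableSet_Iic (a := c)),
    Set.compl_Iic]
  congr 1
  · refine setLIntegral_congr_fun measurableSet_Iic fun x hx => ?_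
    have hx : x ≤ c := hx
    simp [hx]
  · have hG : Measurable fun x => ∫⁻ b, g (seqCons x b) ∂seqLaw :=
      (hg.comp measurable_seqCons).lintegral_prod_right'
    calc _ = ∫⁻ x in Set.Ioi c, ∫⁻ b, g (seqCons (x - c) b) ∂seqLaw ∂(expMeasure 1) := by
          refine setLIntegral_congr_fun measurableSet_Ioi fun x hx => ?_
          have hx : ¬ x ≤ c := not_le.2 hx
          simp [hx]
      _ = _ := by
          rw [lintegral_expMeasure_memoryless' hc _ hG, ← lintegral_seqLaw g hg]
          refine setLIntegral_congr_fun measurableSet_Ioi fun x hx => ?_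
          have hx : ¬ x ≤ c := not_le.2 hx
          simp [hx]

lemma measurable_numArrivals_const (u : ℝ) : Measurable fun a => numArrivals coord u a := by
  have h := measurable_numArrivals.comp ((measurable_const (a := u)).prodMk measurable_id)
  exact h

lemma measurable_after_const (u : ℝ) : Measurable fun a => after u a := by
  have h := measurable_after_comp (measurable_const (a := u)) measurable_id
  exact h

/-- Fixing the number of arrivals before `u` makes an induction possible: with none the claim is
memorylessness, and otherwise the clock restarts at the first arrival `x` with horizon `u - x`. -/
lemma lintegral_after_of_numArrivals_eq {g : (ℕ → ℝ) → ℝ≥0∞} (hg : Measurable g) (m : ℕ)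
    {u : ℝ} (hu : 0 ≤ u) :
    ∫⁻ a, (if numArrivals coord u a = m then g (after u a) else 0) ∂seqLaw =
      ∫⁻ a, (if numArrivals coord u a = m then ∫⁻ b, g b ∂seqLaw else 0) ∂seqLaw := by
  have hset : ∀ u m, MeasurableSet {a | numArrivals coord u a = m} := fun u m =>
    measurable_numArrivals_const u (measurableSet_singleton m)
  have hL : ∀ u m, Measurable fun a => if numArrivals coord u a = m then g (after u a) else 0 :=
    fun u m => .ite (hset u m) (hg.comp (measurable_after_const u)) measurable_const
  have hR : ∀ u m, Measurable fun a =>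
      if numArrivals coord u a = m then ∫⁻ b, g b ∂seqLaw else 0 :=
    fun u m => .ite (hset u m) measurable_const measurable_const
  induction m generalizing u with
  | zero =>
    rw [lintegral_seqLaw _ (hL u _),
      lintegral_seqLaw _ (hR u _)]
    have h := lintegral_memoryless_split hu (fun _ _ => 0) hg
    trans ∫⁻ x, ∫⁻ b, (if x ≤ u then 0 else g (seqCons (x - u) b)) ∂seqLaw ∂(expMeasure 1)
    · refine lintegral_congr fun x => lintegral_congr_ae ?_
      filter_upwards [ae_good] with b hb
      rw [numArrivals_seqCons _ hb, after_seqCons _ hb]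
      by_cases hx : u < x <;> simp [hx, not_le.2, not_lt.1]
    · rw [h]
      refine lintegral_congr fun x => ?_
      trans ∫⁻ b, (if x ≤ u then 0 else ∫⁻ b, g b ∂seqLaw) ∂seqLaw
      · simp
      refine lintegral_congr_ae ?_
      filter_upwards [ae_good] with b hb
      rw [numArrivals_seqCons _ hb]
      by_cases hx : u < x <;> simp [hx, not_le.2, not_lt.1]
  | succ m ih =>
    rw [lintegral_seqLaw _ (hL u _),
      lintegral_seqLaw _ (hR u _)]
    refine lintegral_congr fun x => ?_
    trans ∫⁻ b, (if u < x then 0 else if numArrivals coord (u - x) b = m then g (after (u - x) b)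
      else 0) ∂seqLaw
    · refine lintegral_congr_ae ?_
      filter_upwards [ae_good] with b hb
      rw [numArrivals_seqCons _ hb, after_seqCons _ hb]
      by_cases hx : u < x <;> simp [hx]
    trans ∫⁻ b, (if u < x then 0 else if numArrivals coord (u - x) b = m then ∫⁻ b, g b ∂seqLaw
      else 0) ∂seqLaw
    · by_cases hx : u < x
      · simp [hx]
      · simpa [hx] using ih (sub_nonneg.2 (not_lt.1 hx))
    · refine lintegral_congr_ae ?_
      filter_upwards [ae_good] with b hb
      rw [numArrivals_seqCons _ hb]
      by_cases hx : u < x <;> simp [hx]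

/-- The arrivals after a fixed time have the same law as those after time `0`. -/
lemma lintegral_after {g : (ℕ → ℝ) → ℝ≥0∞} (hg : Measurable g) {u : ℝ} (hu : 0 ≤ u) :
    ∫⁻ a, g (after u a) ∂seqLaw = ∫⁻ a, g a ∂seqLaw := by
  have hset : ∀ m, MeasurableSet {a | numArrivals coord u a = m} := fun m =>
    measurable_numArrivals_const u (measurableSet_singleton m)
  calc ∫⁻ a, g (after u a) ∂seqLaw
      = ∫⁻ a, ∑' m, (if numArrivals coord u a = m then g (after u a) else 0) ∂seqLaw := by
        simp
    _ = ∑' m, ∫⁻ a, (if numArrivals coord u a = m then g (after u a) else 0) ∂seqLaw :=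
        lintegral_tsum fun m => (Measurable.ite (hset m)
          (hg.comp (measurable_after_const u)) measurable_const).aemeasurable
    _ = ∑' m, ∫⁻ a, (if numArrivals coord u a = m then ∫⁻ b, g b ∂seqLaw else 0) ∂seqLaw := by
        simp_rw [lintegral_after_of_numArrivals_eq hg _ hu]
    _ = ∫⁻ a, ∑' m, (if numArrivals coord u a = m then ∫⁻ b, g b ∂seqLaw else 0) ∂seqLaw :=
        (lintegral_tsum fun m => (Measurable.ite (hset m)
          measurable_const measurable_const).aemeasurable).symm
    _ = _ := by simp

namespace RenewalPolicy

variable (π : RenewalPolicy)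

lemma measurable_delay : Measurable fun q : Fin 2 × ℝ × ℝ => π.delay q.1 q.2.1 q.2.2 := by
  have h₁ := π.measurable_y₁
  have h₂ := π.measurable_y₂
  have h₃ : Measurable fun q : Fin 2 × ℝ × ℝ => π.y₂bar q.2.1 q.2.2 :=
    π.measurable_y₂bar.comp measurable_snd
  unfold delay
  refine Measurable.ite (measurable_fst (measurableSet_singleton 0)) ?_ ?_
  · exact Measurable.ite (measurableSet_le (by fun_prop) (by fun_prop)) h₃ (by fun_prop)
  · exact Measurable.ite (measurableSet_le (by fun_prop) (by fun_prop)) (by fun_prop) (by fun_prop)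

lemma measurable_remaining :
    Measurable fun q : Fin 2 × ℝ × ℝ => π.remaining q.1 q.2.1 q.2.2 := by
  have h₁ := π.measurable_y₁
  unfold remaining
  refine Measurable.ite (measurable_fst (measurableSet_singleton 0)) ?_ ?_ <;>
  exact Measurable.ite (measurableSet_le (by fun_prop) (by fun_prop)) (by fun_prop) (by fun_prop)

/-- The delay until the next update, as a function of the inter-arrival times from now on. -/
noncomputable def seqDelay (k : Fin 2) (b : ℕ → ℝ) : ℝ := π.delay k (b 0) (b 1)

/-- The number of units left by the next update, as a function of the inter-arrival times from
now on. -/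
noncomputable def seqRemaining (k : Fin 2) (b : ℕ → ℝ) : Fin 2 := π.remaining k (b 0) (b 1)

lemma measurable_seqDelay_uncurry :
    Measurable fun q : Fin 2 × (ℕ → ℝ) => π.seqDelay q.1 q.2 :=
  π.measurable_delay.comp (g := fun q : Fin 2 × ℝ × ℝ => π.delay q.1 q.2.1 q.2.2)
    (f := fun q : Fin 2 × (ℕ → ℝ) => (q.1, q.2 0, q.2 1)) (by fun_prop)

lemma measurable_seqRemaining_uncurry :
    Measurable fun q : Fin 2 × (ℕ → ℝ) => π.seqRemaining q.1 q.2 :=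
  π.measurable_remaining.comp (g := fun q : Fin 2 × ℝ × ℝ => π.remaining q.1 q.2.1 q.2.2)
    (f := fun q : Fin 2 × (ℕ → ℝ) => (q.1, q.2 0, q.2 1)) (by fun_prop)

@[fun_prop] lemma measurable_seqDelay {α : Type*} [MeasurableSpace α] {f : α → Fin 2}
    {g : α → ℕ → ℝ} (hf : Measurable f) (hg : Measurable g) :
    Measurable fun x => π.seqDelay (f x) (g x) := by
  have h := π.measurable_seqDelay_uncurry.comp (hf.prodMk hg)
  exact h

@[fun_prop] lemma measurable_seqRemaining {α : Type*} [MeasurableSpace α] {f : α → Fin 2}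
    {g : α → ℕ → ℝ} (hf : Measurable f) (hg : Measurable g) :
    Measurable fun x => π.seqRemaining (f x) (g x) := by
  have h := π.measurable_seqRemaining_uncurry.comp (hf.prodMk hg)
  exact h

lemma seqDelay_pos {b : ℕ → ℝ} (hb : ∀ i, 0 < b i) : 0 < π.seqDelay 0 b := by
  have h₁ := π.le_y₁ (b 0) (hb 0).le
  have h₂ := π.le_y₂bar (b 0) (b 1) (hb 0).le (hb 1).le
  have := hb 0
  have := hb 1
  simp only [seqDelay, delay, if_true]
  split_ifs <;> linarith

lemma seqDelay_nonneg (k : Fin 2) {b : ℕ → ℝ} (hb : ∀ i, 0 < b i) : 0 ≤ π.seqDelay k b := by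
  have h₁ := π.le_y₂ (b 0) (hb 0).le
  have := hb 0
  have := π.x₁_nonneg
  fin_cases k
  · exact (π.seqDelay_pos hb).le
  · simp only [seqDelay, delay]
    split_ifs with h₀ h₂
    · simp at h₀
    · simp at h₀
    · exact (hb 0).le.trans h₁
    · exact this

/-- One-step strong Markov property: given the delay until the next update and the energy it
leaves, the arrivals after it are again those of a Poisson process. -/
lemma lintegral_step (k : Fin 2) {H : ℝ → Fin 2 → (ℕ → ℝ) → ℝ≥0∞}
    (hH : Measurable fun p : ℝ × Fin 2 × (ℕ → ℝ) => H p.1 p.2.1 p.2.2) :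
    ∫⁻ b, H (π.seqDelay k b) (π.seqRemaining k b) (after (π.seqDelay k b) b) ∂seqLaw =
      ∫⁻ b, ∫⁻ c, H (π.seqDelay k b) (π.seqRemaining k b) c ∂seqLaw ∂seqLaw := by
  have hm₁ : Measurable fun b => after (π.seqDelay k b) b :=
    measurable_after_comp (by fun_prop) measurable_id
  have hH' : ∀ d j, Measurable (H d j) := fun d j =>
    hH.comp (measurable_const.prodMk (measurable_const.prodMk measurable_id))
  have hL : Measurable fun b =>
      H (π.seqDelay k b) (π.seqRemaining k b) (after (π.seqDelay k b) b) :=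
    hH.comp ((by fun_prop : Measurable fun b => π.seqDelay k b).prodMk
      ((by fun_prop : Measurable fun b => π.seqRemaining k b).prodMk hm₁))
  have hR : Measurable fun b => ∫⁻ c, H (π.seqDelay k b) (π.seqRemaining k b) c ∂seqLaw := by
    refine Measurable.lintegral_prod_right' (f := fun p : (ℕ → ℝ) × (ℕ → ℝ) =>
      H (π.seqDelay k p.1) (π.seqRemaining k p.1) p.2) ?_
    exact hH.comp ((by fun_prop : Measurable fun p : (ℕ → ℝ) × (ℕ → ℝ) => π.seqDelay k p.1).prodMk
      ((by fun_prop : Measurable fun p : (ℕ → ℝ) × (ℕ → ℝ) =>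
        π.seqRemaining k p.1).prodMk measurable_snd))
  rw [lintegral_seqLaw _ hL, lintegral_seqLaw _ hR]
  rcases (by omega : k = 0 ∨ k = 1) with rfl | rfl
  · refine lintegral_congr_ae ?_
    filter_upwards [ae_pos_expMeasure] with x hx
    have hc := π.le_y₁ x hx.le
    have hx₀ : Measurable fun b => seqCons x b :=
      measurable_seqCons_comp measurable_const measurable_id
    have hL₁ := hL.comp hx₀
    have hR₁ := hR.comp hx₀
    simp only [Function.comp_def] at hL₁ hR₁
    rw [lintegral_seqLaw _ hL₁, lintegral_seqLaw _ hR₁]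
    trans ∫⁻ x', ∫⁻ b, (if x' ≤ π.y₁ x - x then
        H (π.y₂bar x x') 1 (after (π.y₂bar x x' - x - x') b)
      else H (π.y₁ x) 0 (seqCons (x' - (π.y₁ x - x)) b)) ∂seqLaw ∂(expMeasure 1)
    · refine lintegral_congr_ae ?_
      filter_upwards [ae_pos_expMeasure] with x' hx'
      refine lintegral_congr_ae ?_
      filter_upwards [ae_good] with b hb
      have h2 := π.le_y₂bar x x' hx.le hx'.le
      have hb' : Good (seqCons x' b) := good_seqCons_iff.2 ⟨hx', hb⟩
      simp only [seqDelay, seqRemaining, delay, remaining, seqCons_zero, if_true,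
        show seqCons x (seqCons x' b) 1 = x' from rfl]
      split_ifs with h
      · rw [after_seqCons _ hb', if_neg (by linarith), after_seqCons _ hb, if_neg (by linarith)]
      · rw [after_seqCons _ hb', if_neg (by linarith), after_seqCons _ hb, if_pos (by linarith)]
    · rw [lintegral_memoryless_split (by linarith) _ (hH' _ _)]
      refine lintegral_congr_ae ?_
      filter_upwards [ae_pos_expMeasure] with x' hx'
      have h2 := π.le_y₂bar x x' hx.le hx'.le
      rw [lintegral_after (hH' _ _) (by linarith)]
      simp only [seqDelay, seqRemaining, delay, remaining, seqCons_zero, if_true,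
        show ∀ b, seqCons x (seqCons x' b) 1 = x' from fun _ => rfl, lintegral_const,
        measure_univ, mul_one]
      split_ifs <;> rfl
  · trans ∫⁻ x, ∫⁻ b, (if x ≤ π.x₁ then H (π.y₂ x) 1 (after (π.y₂ x - x) b)
      else H π.x₁ 0 (seqCons (x - π.x₁) b)) ∂seqLaw ∂(expMeasure 1)
    · refine lintegral_congr_ae ?_
      filter_upwards [ae_pos_expMeasure] with x hx
      refine lintegral_congr_ae ?_
      filter_upwards [ae_good] with b hb
      have h2 := π.le_y₂ x hx.le
      rw [after_seqCons _ hb]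
      by_cases h : x ≤ π.x₁
      · simp [seqDelay, seqRemaining, delay, remaining, h, not_lt.2 h2]
      · simp [seqDelay, seqRemaining, delay, remaining, h, not_le.1 h]
    · rw [lintegral_memoryless_split π.x₁_nonneg _ (hH' _ _)]
      refine lintegral_congr_ae ?_
      filter_upwards [ae_pos_expMeasure] with x hx
      have h2 := π.le_y₂ x hx.le
      rw [lintegral_after (hH' _ _) (by linarith)]
      by_cases h : x ≤ π.x₁ <;> simp [seqDelay, seqRemaining, delay, remaining, h]

end RenewalPolicy

/-! ### Monotone sequences crossing a level -/

section Crossing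

variable {s : ℕ → ℝ} {T : ℝ}

lemma tsum_le_level_eq (hs : Monotone s) (g : ℕ → ℝ≥0∞) :
    ∑' n, (if s n ≤ T then g n else 0) =
      ∑' n, (if s (n + 1) ≤ T then g n else 0) +
        ∑' n, (if s n ≤ T ∧ T < s (n + 1) then g n else 0) := by
  rw [← ENNReal.tsum_add]
  refine tsum_congr fun n => ?_
  have := hs n.le_succ
  by_cases h₁ : s (n + 1) ≤ T
  · simp [h₁, this.trans h₁, not_lt.2 h₁]
  · simp [h₁, not_le.1 h₁]

lemma tsum_crossing_le (hs : Monotone s) {g : ℕ → ℝ≥0∞} {C : ℝ≥0∞} (hg : ∀ n, g n ≤ C) :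
    ∑' n, (if s n ≤ T ∧ T < s (n + 1) then g n else 0) ≤ C := by
  by_cases h : ∃ n, s n ≤ T ∧ T < s (n + 1)
  · obtain ⟨n, hn⟩ := h
    rw [tsum_eq_single n]
    · simp [hn, hg]
    · intro m hm
      rw [if_neg]
      rintro ⟨h₁, h₂⟩
      rcases lt_or_gt_of_ne hm with h | h
      · exact absurd (hs (Nat.succ_le_of_lt h)) (by simp; linarith)
      · exact absurd (hs (Nat.succ_le_of_lt h)) (by simp; linarith)
  · push Not at h
    have h' : ∀ n, ¬(s n ≤ T ∧ T < s (n + 1)) := fun n hn => absurd hn.2 (not_lt.2 (h n hn.1))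
    simp [h']

/-- The interval covering `T` may be long. Since there is only one, increments of size at most `C`
contribute at most `C`; the larger ones are dominated by all large increments begun by time `T`. -/
lemma tsum_crossing_le_add (hs : Monotone s) (g : ℕ → ℝ≥0∞) (C : ℝ≥0∞) :
    ∑' n, (if s n ≤ T ∧ T < s (n + 1) then g n else 0) ≤
      C + ∑' n, (if s n ≤ T then (if C < g n then g n else 0) else 0) := by
  calc _ ≤ ∑' n, ((if s n ≤ T ∧ T < s (n + 1) then (if C < g n then 0 else g n) else 0) +
        (if s n ≤ T then (if C < g n then g n else 0) else 0)) := by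
        refine ENNReal.tsum_le_tsum fun n => ?_
        by_cases h₁ : s n ≤ T <;> by_cases h₂ : T < s (n + 1) <;> by_cases h₃ : C < g n <;>
          simp [h₁, h₂, h₃]
    _ ≤ _ := by
        rw [ENNReal.tsum_add]
        refine add_le_add (tsum_crossing_le hs fun n => ?_) le_rfl
        split_ifs with h
        · exact zero_le
        · exact not_lt.1 h

lemma tsum_increments_le (hs : Monotone s) (h0 : s 0 = 0) :
    ∑' n, (if s (n + 1) ≤ T then ENNReal.ofReal (s (n + 1) - s n) else 0) ≤ ENNReal.ofReal T := by
  refine ENNReal.tsum_le_of_sum_range_le fun m => ?_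
  have : ∑ n ∈ Finset.range m, (if s (n + 1) ≤ T then ENNReal.ofReal (s (n + 1) - s n) else 0) ≤
      ENNReal.ofReal (min (s m) T) := by
    induction m with
    | zero => simp
    | succ m ih =>
      have h1 := hs m.le_succ
      have h2 : 0 ≤ s m := h0 ▸ hs (Nat.zero_le m)
      rw [Finset.sum_range_succ]
      split_ifs with h
      · rw [min_eq_left (h1.trans h)] at ih
        rw [min_eq_left h]
        refine (add_le_add_left ih _).trans ?_
        rw [← ENNReal.ofReal_add h2 (sub_nonneg.2 h1)]
        simp
      · rw [add_zero]
        exact ih.trans (ENNReal.ofReal_le_ofReal (min_le_min_right _ h1))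
  exact this.trans (ENNReal.ofReal_le_ofReal (min_le_right _ _))

lemma exists_setOf_le_eq (hs : Monotone s) (h0 : s 0 = 0) (hT : 0 ≤ T)
    (hfin : {n | s n ≤ T}.Finite) : ∃ N, ∀ n, s n ≤ T ↔ n ≤ N := by
  obtain ⟨N, hN, hmax⟩ := hfin.exists_maximal ⟨0, by simpa [h0] using hT⟩
  exact ⟨N, fun n => ⟨fun h => by
    by_contra hlt
    exact hlt (hmax h (by simp at hlt; exact hlt.le)), fun h => (hs h).trans hN⟩⟩

lemma tsum_ite_le_eq_sum (N : ℕ) (g : ℕ → ℝ≥0∞) :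
    ∑' n, (if n ≤ N then g n else 0) = ∑ n ∈ Finset.range (N + 1), g n := by
  rw [tsum_eq_sum (s := Finset.range (N + 1))]
  · exact Finset.sum_congr rfl fun n hn => by
      rw [Finset.mem_range] at hn
      simp [Nat.le_of_lt_succ hn]
  · intro n hn
    rw [Finset.mem_range] at hn
    simp; omega

lemma le_tsum_increments (hs : Monotone s) (h0 : s 0 = 0) (hT : 0 ≤ T)
    (hfin : {n | s n ≤ T}.Finite) :
    ENNReal.ofReal T ≤ ∑' n, (if s n ≤ T then ENNReal.ofReal (s (n + 1) - s n) else 0) := by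
  obtain ⟨N, hN⟩ := exists_setOf_le_eq hs h0 hT hfin
  simp_rw [hN]
  rw [tsum_ite_le_eq_sum, ← ENNReal.ofReal_sum_of_nonneg fun n _ => sub_nonneg.2 (hs n.le_succ),
    Finset.sum_range_sub, h0, sub_zero]
  exact ENNReal.ofReal_le_ofReal (not_le.1 fun h => absurd ((hN _).1 h) (by omega)).le

end Crossing

namespace RenewalPolicy

variable (π : RenewalPolicy)

/-! ### Expectations over one step -/

/-- The expectation of a function of the delay until the next update and of the energy it leaves,
after an update that leaves `k` units. -/
noncomputable def stepMean (k : Fin 2) (f : ℝ → Fin 2 → ℝ≥0∞) : ℝ≥0∞ :=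
  ∫⁻ b, f (π.seqDelay k b) (π.seqRemaining k b) ∂seqLaw

lemma updateTime_succ (n : ℕ) (a : ℕ → ℝ) :
    π.updateTime coord (n + 1) a = π.updateTime coord n a +
      π.seqDelay (π.energy coord n a) (after (π.updateTime coord n a) a) := rfl

lemma energy_succ (n : ℕ) (a : ℕ → ℝ) :
    π.energy coord (n + 1) a =
      π.seqRemaining (π.energy coord n a) (after (π.updateTime coord n a) a) := rfl

lemma updateTime_zero (a : ℕ → ℝ) : π.updateTime coord 0 a = 0 := rfl

lemma energy_zero (a : ℕ → ℝ) : π.energy coord 0 a = 0 := rfl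

lemma interUpdate_eq (n : ℕ) (a : ℕ → ℝ) :
    π.interUpdate coord n a =
      π.seqDelay (π.energy coord n a) (after (π.updateTime coord n a) a) := by
  rw [interUpdate, updateTime_succ, add_sub_cancel_left]

lemma measurable_updateTime_energy (n : ℕ) :
    Measurable (π.updateTime coord n) ∧ Measurable (π.energy coord n) := by
  induction n with
  | zero => exact ⟨measurable_const, measurable_const⟩
  | succ n ih =>
    have h := measurable_after_comp ih.1 measurable_id
    exact ⟨ih.1.add (π.measurable_seqDelay ih.2 h), π.measurable_seqRemaining ih.2 h⟩

@[fun_prop] lemma measurable_updateTime (n : ℕ) : Measurable (π.updateTime coord n) :=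
  (π.measurable_updateTime_energy n).1

@[fun_prop] lemma measurable_energy (n : ℕ) : Measurable (π.energy coord n) :=
  (π.measurable_updateTime_energy n).2

@[fun_prop] lemma measurable_interUpdate (n : ℕ) : Measurable (π.interUpdate coord n) := by
  have h := (π.measurable_updateTime (n + 1)).sub (π.measurable_updateTime n)
  exact h

lemma updateTime_nonneg {a : ℕ → ℝ} (ha : Good a) (n : ℕ) : 0 ≤ π.updateTime coord n a := by
  induction n with
  | zero => exact le_rfl
  | succ n ih => exact add_nonneg ih (π.seqDelay_nonneg _ (ha.after ih).1)

lemma monotone_updateTime {a : ℕ → ℝ} (ha : Good a) :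
    Monotone fun n => π.updateTime coord n a :=
  monotone_nat_of_le_succ fun n =>
    le_add_of_nonneg_right (π.seqDelay_nonneg _ (ha.after (π.updateTime_nonneg ha n)).1)

/-- The weight `w` depends on the history up to the `n`-th update only: weighted by `w`, the
arrivals after this update are independent of its time and of the energy it leaves, and have the
law of the original arrivals. -/
def FreshAt (n : ℕ) (w : (ℕ → ℝ) → ℝ≥0∞) : Prop :=
  ∀ G : ℝ → Fin 2 → (ℕ → ℝ) → ℝ≥0∞,
    (Measurable fun p : ℝ × Fin 2 × (ℕ → ℝ) => G p.1 p.2.1 p.2.2) →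
    ∫⁻ a, w a * G (π.updateTime coord n a) (π.energy coord n a)
        (after (π.updateTime coord n a) a) ∂seqLaw =
      ∫⁻ a, w a * ∫⁻ b, G (π.updateTime coord n a) (π.energy coord n a) b ∂seqLaw ∂seqLaw

lemma freshAt_zero : π.FreshAt 0 fun _ => 1 := by
  intro G _
  simp only [one_mul, updateTime_zero, energy_zero]
  rw [lintegral_const, measure_univ, mul_one]
  refine lintegral_congr_ae ?_
  filter_upwards [ae_good] with a ha
  rw [after_zero ha]

/-- Freshness survives a step and a weight that depends on the energy just left. Weights of this
kind build up the event that the epoch is not yet over. -/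
lemma FreshAt.succ {π : RenewalPolicy} {n : ℕ} {w : (ℕ → ℝ) → ℝ≥0∞} (h : π.FreshAt n w)
    {ψ : Fin 2 → ℝ≥0∞} :
    π.FreshAt (n + 1) fun a => w a * ψ (π.energy coord (n + 1) a) := by
  intro G hG
  have hψ : Measurable ψ := measurable_of_finite ψ
  set H : ℝ → Fin 2 → ℝ → Fin 2 → (ℕ → ℝ) → ℝ≥0∞ := fun s _ d j c => ψ j * G (s + d) j c
  have hH : ∀ s k, Measurable fun p : ℝ × Fin 2 × (ℕ → ℝ) => H s k p.1 p.2.1 p.2.2 := by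
    intro s k
    refine (hψ.comp (measurable_fst.comp measurable_snd)).mul (hG.comp (f := fun p :
      ℝ × Fin 2 × (ℕ → ℝ) => (s + p.1, p.2.1, p.2.2)) (by fun_prop))
  have hG' : ∀ s j, Measurable (G s j) := fun s j =>
    hG.comp (measurable_const.prodMk (measurable_const.prodMk measurable_id))
  have hint : Measurable fun p : ℝ × Fin 2 => ∫⁻ c, G p.1 p.2 c ∂seqLaw :=
    Measurable.lintegral_prod_right' (f := fun p : (ℝ × Fin 2) × (ℕ → ℝ) => G p.1.1 p.1.2 p.2)
      (hG.comp (f := fun p : (ℝ × Fin 2) × (ℕ → ℝ) => (p.1.1, p.1.2, p.2)) (by fun_prop))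
  have hd : Measurable fun p : ℝ × Fin 2 × (ℕ → ℝ) => π.seqDelay p.2.1 p.2.2 :=
    π.measurable_seqDelay (by fun_prop) (by fun_prop)
  have hr : Measurable fun p : ℝ × Fin 2 × (ℕ → ℝ) => π.seqRemaining p.2.1 p.2.2 :=
    π.measurable_seqRemaining (by fun_prop) (by fun_prop)
  have ha : Measurable fun p : ℝ × Fin 2 × (ℕ → ℝ) =>
      after (π.seqDelay p.2.1 p.2.2) p.2.2 := measurable_after_comp hd (by fun_prop)
  -- In `h₁` the test function contains one step and everything after it; in `h₂` the future beyond
  -- that step is already averaged. The one-step strong Markov property identifies their right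
  -- sides.
  have h₁ := h (fun s k b => H s k (π.seqDelay k b) (π.seqRemaining k b)
    (after (π.seqDelay k b) b)) <| (hψ.comp hr).mul
      (hG.comp ((measurable_fst.add hd).prodMk (hr.prodMk ha)))
  have h₂ := h (fun s k b => ψ (π.seqRemaining k b) *
    ∫⁻ c, G (s + π.seqDelay k b) (π.seqRemaining k b) c ∂seqLaw) <| (hψ.comp hr).mul
      (hint.comp ((measurable_fst.add hd).prodMk hr))
  calc _ = ∫⁻ a, w a * H (π.updateTime coord n a) (π.energy coord n a)
        (π.seqDelay (π.energy coord n a) (after (π.updateTime coord n a) a))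
        (π.seqRemaining (π.energy coord n a) (after (π.updateTime coord n a) a))
        (after (π.seqDelay (π.energy coord n a) (after (π.updateTime coord n a) a))
          (after (π.updateTime coord n a) a)) ∂seqLaw := by
        refine lintegral_congr_ae ?_
        filter_upwards [ae_good] with a ha
        have hs := π.updateTime_nonneg ha n
        rw [after_after ha hs (π.seqDelay_nonneg _ (ha.after hs).1), ← updateTime_succ,
          ← energy_succ, mul_assoc]
        simp only [H, ← updateTime_succ]
    _ = _ := h₁
    _ = ∫⁻ a, w a * ∫⁻ b, ψ (π.seqRemaining (π.energy coord n a) b) *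
          ∫⁻ c, G (π.updateTime coord n a + π.seqDelay (π.energy coord n a) b)
            (π.seqRemaining (π.energy coord n a) b) c ∂seqLaw ∂seqLaw ∂seqLaw := by
        refine lintegral_congr fun a => ?_
        rw [π.lintegral_step _ (hH _ 0)]
        simp only [H]
        congr 1
        refine lintegral_congr fun b => ?_
        rw [lintegral_const_mul _ (hG' _ _)]
    _ = _ := h₂.symm
    _ = _ := by
        refine lintegral_congr fun a => ?_
        rw [← energy_succ, ← updateTime_succ, mul_assoc]

lemma freshAt_one (n : ℕ) : π.FreshAt n fun _ => 1 := by
  induction n with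
  | zero => exact π.freshAt_zero
  | succ n ih => simpa using ih.succ (ψ := fun _ => 1)

/-- Averages out the next step given the history, so that every expectation along the path reduces
to the two kernels `stepMean 0` and `stepMean 1`. -/
lemma FreshAt.lintegral_step {π : RenewalPolicy} {n : ℕ} {w : (ℕ → ℝ) → ℝ≥0∞} (h : π.FreshAt n w)
    {f : ℝ → Fin 2 → ℝ → Fin 2 → ℝ≥0∞}
    (hf : Measurable fun p : ℝ × Fin 2 × ℝ × Fin 2 => f p.1 p.2.1 p.2.2.1 p.2.2.2) :
    ∫⁻ a, w a * f (π.updateTime coord n a) (π.energy coord n a) (π.interUpdate coord n a)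
        (π.energy coord (n + 1) a) ∂seqLaw =
      ∫⁻ a, w a * π.stepMean (π.energy coord n a)
        (f (π.updateTime coord n a) (π.energy coord n a)) ∂seqLaw := by
  have hd : Measurable fun p : ℝ × Fin 2 × (ℕ → ℝ) => π.seqDelay p.2.1 p.2.2 :=
    π.measurable_seqDelay (by fun_prop) (by fun_prop)
  have hr : Measurable fun p : ℝ × Fin 2 × (ℕ → ℝ) => π.seqRemaining p.2.1 p.2.2 :=
    π.measurable_seqRemaining (by fun_prop) (by fun_prop)
  have := h (fun s k b => f s k (π.seqDelay k b) (π.seqRemaining k b))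
    (hf.comp (measurable_fst.prodMk ((measurable_fst.comp measurable_snd).prodMk (hd.prodMk hr))))
  simp_rw [interUpdate_eq, energy_succ]
  exact this

/-! ### Transition probabilities and epochs -/

/-- The probability that the update after one which leaves the battery empty leaves one unit. -/
noncomputable def refill : ℝ≥0∞ := π.stepMean 0 fun _ j => if j = 1 then 1 else 0

/-- The probability that the update after one which leaves one unit leaves the battery empty. -/
noncomputable def drain : ℝ≥0∞ := π.stepMean 1 fun _ j => if j = 0 then 1 else 0

/-- The expected sum over an epoch of a function of the inter-update times. -/
noncomputable def epochMean (f : ℝ → ℝ≥0∞) : ℝ≥0∞ :=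
  π.stepMean 0 (fun d _ => f d) + π.refill * π.drain⁻¹ * π.stepMean 1 (fun d _ => f d)

lemma measurable_comp_seqRemaining (k : Fin 2) (ψ : Fin 2 → ℝ≥0∞) :
    Measurable fun b => ψ (π.seqRemaining k b) :=
  (measurable_of_finite ψ).comp (π.measurable_seqRemaining measurable_const measurable_id)

lemma stepMean_zero_add_one (k : Fin 2) :
    π.stepMean k (fun _ j => if j = 0 then 1 else 0) +
      π.stepMean k (fun _ j => if j = 1 then 1 else 0) = 1 := by
  rw [stepMean, stepMean, ← lintegral_add_left (π.measurable_comp_seqRemaining k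
    fun j => if j = 0 then 1 else 0)]
  have : ∀ j : Fin 2, ((if j = 0 then 1 else 0 : ℝ≥0∞) + if j = 1 then 1 else 0) = 1 := by
    intro j
    fin_cases j <;> simp
  simp [this]

lemma drain_eq : π.drain = ENNReal.ofReal (Real.exp (-π.x₁)) := by
  have h : ∀ b, (if π.seqRemaining 1 b = 0 then 1 else 0 : ℝ≥0∞) =
      (Set.Ioi π.x₁).indicator 1 (b 0) := by
    intro b
    by_cases h : b 0 ≤ π.x₁
    · simp [seqRemaining, remaining, h]
    · simp [seqRemaining, remaining, h, not_le.1 h]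
  have hm : Measurable ((Set.Ioi π.x₁).indicator (1 : ℝ → ℝ≥0∞)) :=
    measurable_one.indicator measurableSet_Ioi
  have hm' : Measurable fun b : ℕ → ℝ => (Set.Ioi π.x₁).indicator (1 : ℝ → ℝ≥0∞) (b 0) :=
    hm.comp (measurable_pi_apply 0)
  rw [drain, stepMean]
  simp_rw [h]
  rw [lintegral_seqLaw _ hm', ← expMeasure_Ioi π.x₁_nonneg,
    ← lintegral_indicator_one measurableSet_Ioi]
  simp

lemma drain_ne_zero : π.drain ≠ 0 := by simp [drain_eq, Real.exp_pos]

lemma drain_ne_top : π.drain ≠ ∞ := by simp [drain_eq]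

lemma drain_le_one : π.drain ≤ 1 := by
  rw [← π.stepMean_zero_add_one 1]
  exact le_self_add

lemma refill_le_one : π.refill ≤ 1 := by
  rw [← π.stepMean_zero_add_one 0]
  exact le_add_self

lemma stepMean_one_stay :
    π.stepMean 1 (fun _ j => if j = 1 then 1 else 0) = 1 - π.drain := by
  have h := π.stepMean_zero_add_one 1
  exact ENNReal.eq_sub_of_add_eq π.drain_ne_top (by rw [add_comm]; exact h)

open Classical in
/-- The indicator of the event that the `(n+1)`-st update belongs to the first epoch. -/
noncomputable def epochWeight (n : ℕ) (a : ℕ → ℝ) : ℝ≥0∞ := if π.InEpoch coord n a then 1 else 0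

lemma epochWeight_zero (a : ℕ → ℝ) : π.epochWeight 0 a = 1 :=
  if_pos fun k h₁ h₂ => absurd h₁ (by omega)

lemma epochWeight_succ (n : ℕ) (a : ℕ → ℝ) : π.epochWeight (n + 1) a =
    π.epochWeight n a * if π.energy coord (n + 1) a = 1 then 1 else 0 := by
  have : π.InEpoch coord (n + 1) a ↔ π.InEpoch coord n a ∧ π.energy coord (n + 1) a = 1 := by
    refine ⟨fun h => ⟨fun k h₁ h₂ => h k h₁ (by omega), h _ (by omega) le_rfl⟩,
      fun h k h₁ h₂ => ?_⟩
    rcases Nat.lt_or_eq_of_le h₂ with h₃ | rfl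
    · exact h.1 k h₁ (by omega)
    · exact h.2
  by_cases h₁ : π.InEpoch coord n a <;> by_cases h₂ : π.energy coord (n + 1) a = 1 <;>
    simp [epochWeight, this, h₁, h₂]

lemma measurable_epochWeight (n : ℕ) : Measurable (π.epochWeight n) := by
  induction n with
  | zero => simpa only [funext π.epochWeight_zero] using measurable_const
  | succ n ih =>
    simp only [funext (π.epochWeight_succ n)]
    exact ih.mul ((measurable_of_finite fun j : Fin 2 => if j = 1 then (1 : ℝ≥0∞) else 0).comp
      (π.measurable_energy (n + 1)))

lemma freshAt_epochWeight (n : ℕ) : π.FreshAt n (π.epochWeight n) := by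
  induction n with
  | zero => simpa only [funext π.epochWeight_zero] using π.freshAt_zero
  | succ n ih =>
    simp only [funext (π.epochWeight_succ n)]
    exact ih.succ (ψ := fun j => if j = 1 then 1 else 0)

/-- Inside an epoch every update leaves one unit, so the state is constant under this weight. The
index starts at 1 because the epoch begins with an empty battery. -/
lemma epochWeight_mul_energy (n : ℕ) (a : ℕ → ℝ) (F : Fin 2 → ℝ≥0∞) :
    π.epochWeight (n + 1) a * F (π.energy coord (n + 1) a) = π.epochWeight (n + 1) a * F 1 := by
  rw [epochWeight_succ]
  split_ifs with h
  · rw [h]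
  · simp

lemma measurable_mul_step (ψ : Fin 2 → Fin 2 → ℝ≥0∞) {g : ℝ → ℝ≥0∞} (hg : Measurable g) :
    Measurable fun p : ℝ × Fin 2 × ℝ × Fin 2 => ψ p.2.1 p.2.2.2 * g p.2.2.1 :=
  ((measurable_of_finite fun q : Fin 2 × Fin 2 => ψ q.1 q.2).comp
    (f := fun p : ℝ × Fin 2 × ℝ × Fin 2 => (p.2.1, p.2.2.2)) (by fun_prop)).mul (by fun_prop)

lemma lintegral_epochWeight (n : ℕ) :
    ∫⁻ a, π.epochWeight (n + 1) a ∂seqLaw = π.refill * (1 - π.drain) ^ n := by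
  have h : ∀ n, ∫⁻ a, π.epochWeight (n + 1) a ∂seqLaw = ∫⁻ a, π.epochWeight n a *
      π.stepMean (π.energy coord n a) (fun _ j => if j = 1 then 1 else 0) ∂seqLaw := by
    intro n
    have := (π.freshAt_epochWeight n).lintegral_step
      (f := fun _ k d j => (fun _ j => if j = 1 then 1 else 0 : Fin 2 → Fin 2 → ℝ≥0∞) k j *
        (fun _ => 1 : ℝ → ℝ≥0∞) d) (measurable_mul_step (fun _ j => if j = 1 then 1 else 0)
        (g := fun _ => 1) measurable_const)
    simpa only [epochWeight_succ, mul_one] using this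
  induction n with
  | zero => simp [h, epochWeight_zero, energy_zero, refill]
  | succ n ih =>
    rw [h]
    simp_rw [π.epochWeight_mul_energy n _ fun k => π.stepMean k fun _ j => if j = 1 then 1 else 0]
    rw [lintegral_mul_const _ (π.measurable_epochWeight _), ih, stepMean_one_stay, pow_succ,
      mul_assoc]

-- The step of index n + 1 belongs to the epoch with probability `refill * (1 - drain) ^ n`, and it
-- starts from one unit. The geometric series sums to `refill / drain`.
open Classical in
lemma lintegral_epoch {f : ℝ → ℝ≥0∞} (hf : Measurable f) :
    ∫⁻ a, ∑' n, (if π.InEpoch coord n a then f (π.interUpdate coord n a) else 0) ∂seqLaw =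
      π.epochMean f := by
  have h₀ : ∀ n a, (if π.InEpoch coord n a then f (π.interUpdate coord n a) else 0) =
      π.epochWeight n a * f (π.interUpdate coord n a) := by
    intro n a
    by_cases h : π.InEpoch coord n a <;> simp [epochWeight, h]
  have h₁ : ∀ n, ∫⁻ a, π.epochWeight n a * f (π.interUpdate coord n a) ∂seqLaw =
      ∫⁻ a, π.epochWeight n a * π.stepMean (π.energy coord n a) (fun d _ => f d) ∂seqLaw := by
    intro n
    have := (π.freshAt_epochWeight n).lintegral_step
      (f := fun _ k d j => (fun _ _ => 1 : Fin 2 → Fin 2 → ℝ≥0∞) k j * f d)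
      (measurable_mul_step (fun _ _ => 1) hf)
    simpa only [one_mul] using this
  have h₂ : ∀ n, Measurable fun a => π.epochWeight n a * f (π.interUpdate coord n a) := fun n =>
    (π.measurable_epochWeight n).mul (hf.comp (π.measurable_interUpdate n))
  simp_rw [h₀]
  rw [lintegral_tsum fun n => (h₂ n).aemeasurable, tsum_eq_zero_add' ENNReal.summable]
  simp_rw [h₁, π.epochWeight_mul_energy _ _ fun k => π.stepMean k fun d _ => f d]
  simp_rw [lintegral_mul_const _ (π.measurable_epochWeight _), lintegral_epochWeight]
  rw [ENNReal.tsum_mul_right, ENNReal.tsum_mul_left, ENNReal.tsum_geometric,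
    ENNReal.sub_sub_cancel ENNReal.one_ne_top π.drain_le_one, epochMean]
  simp [epochWeight_zero, energy_zero]

/-! ### Visits -/

/-- The expected number of updates up to time `T` (including the start) that leave `k` units. -/
noncomputable def visits (T : ℝ) (k : Fin 2) : ℝ≥0∞ :=
  ∑' n, seqLaw {a | π.updateTime coord n a ≤ T ∧ π.energy coord n a = k}

lemma measurableSet_updateTime_le (n : ℕ) (T : ℝ) :
    MeasurableSet {a | π.updateTime coord n a ≤ T} :=
  measurableSet_le (π.measurable_updateTime n) measurable_const

/-- Wald's identity: whether the n-th update comes by time `T`, and in which state, is known before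
the next step, which is therefore averaged by the kernel of that state. -/
lemma lintegral_visits (T : ℝ) (ψ : Fin 2 → Fin 2 → ℝ≥0∞) {g : ℝ → ℝ≥0∞} (hg : Measurable g) :
    ∫⁻ a, ∑' n, (if π.updateTime coord n a ≤ T then ψ (π.energy coord n a)
      (π.energy coord (n + 1) a) * g (π.interUpdate coord n a) else 0) ∂seqLaw =
      π.visits T 0 * π.stepMean 0 (fun d j => ψ 0 j * g d) +
        π.visits T 1 * π.stepMean 1 (fun d j => ψ 1 j * g d) := by
  have hm := measurable_mul_step ψ hg
  have hS : MeasurableSet {p : ℝ × Fin 2 × ℝ × Fin 2 | p.1 ≤ T} :=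
    measurableSet_le measurable_fst measurable_const
  have hE : ∀ n k, MeasurableSet {a | π.updateTime coord n a ≤ T ∧ π.energy coord n a = k} :=
    fun n k => (π.measurableSet_updateTime_le n T).inter
      (π.measurable_energy n (measurableSet_singleton k))
  rw [lintegral_tsum, visits, visits, ← ENNReal.tsum_mul_right, ← ENNReal.tsum_mul_right,
    ← ENNReal.tsum_add]
  · refine tsum_congr fun n => ?_
    have := (π.freshAt_one n).lintegral_step
      (f := fun s k d j => if s ≤ T then ψ k j * g d else 0) (hm.ite hS measurable_const)
    simp only [one_mul] at this
    rw [this, ← lintegral_indicator_one (hE n 0), ← lintegral_indicator_one (hE n 1),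
      ← lintegral_mul_const _ (measurable_one.indicator (hE n 0)),
      ← lintegral_mul_const _ (measurable_one.indicator (hE n 1)),
      ← lintegral_add_left ((measurable_one.indicator (hE n 0)).mul_const _)]
    refine lintegral_congr fun a => ?_
    by_cases h : π.updateTime coord n a ≤ T
    · rcases (by omega : π.energy coord n a = 0 ∨ π.energy coord n a = 1) with hk | hk <;>
        simp [h, hk]
    · simp [h, stepMean]
  · intro n
    exact ((hm.ite hS measurable_const).comp (f := fun a => (π.updateTime coord n a,
      π.energy coord n a, π.interUpdate coord n a, π.energy coord (n + 1) a))
      (by fun_prop)).aemeasurable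

/-- The expected sum of a function of the inter-update times over the updates up to time `T`. -/
noncomputable def visitMean (T : ℝ) (g : ℝ → ℝ≥0∞) : ℝ≥0∞ :=
  π.visits T 0 * π.stepMean 0 (fun d _ => g d) + π.visits T 1 * π.stepMean 1 (fun d _ => g d)

lemma lintegral_visitMean (T : ℝ) {g : ℝ → ℝ≥0∞} (hg : Measurable g) :
    ∫⁻ a, ∑' n, (if π.updateTime coord n a ≤ T then g (π.interUpdate coord n a) else 0) ∂seqLaw =
      π.visitMean T g := by
  simpa [visitMean] using π.lintegral_visits T (fun _ _ => 1) hg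

/-! ### Bounds on the number of updates -/

/-- The area under the age curve between two updates at distance `d`. -/
noncomputable def delayArea (d : ℝ) : ℝ≥0∞ := ENNReal.ofReal ((1 / 2) * d ^ 2)

@[fun_prop] lemma measurable_delayArea : Measurable delayArea := by
  unfold delayArea
  fun_prop

lemma measurable_tsum_updateTime_le (T : ℝ) {g : ℝ → ℝ≥0∞} (hg : Measurable g) :
    Measurable fun a => ∑' n, (if π.updateTime coord n a ≤ T then g (π.interUpdate coord n a)
      else 0) :=
  Measurable.tsum fun n => .ite (π.measurableSet_updateTime_le n T)
    (hg.comp (π.measurable_interUpdate n)) measurable_const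

lemma measurable_tsum_crossing (T : ℝ) {g : ℝ → ℝ≥0∞} (hg : Measurable g) :
    Measurable fun a => ∑' n, (if π.updateTime coord n a ≤ T ∧ T < π.updateTime coord (n + 1) a
      then g (π.interUpdate coord n a) else 0) :=
  Measurable.tsum fun n => .ite ((π.measurableSet_updateTime_le n T).inter
    (measurableSet_lt measurable_const (π.measurable_updateTime (n + 1))))
    (hg.comp (π.measurable_interUpdate n)) measurable_const

lemma lintegral_crossing_le (T : ℝ) {g : ℝ → ℝ≥0∞} (hg : Measurable g) (C : ℝ≥0∞) :
    ∫⁻ a, ∑' n, (if π.updateTime coord n a ≤ T ∧ T < π.updateTime coord (n + 1) a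
      then g (π.interUpdate coord n a) else 0) ∂seqLaw ≤
      C + π.visitMean T fun d => if C < g d then g d else 0 := by
  have hg' : Measurable fun d => if C < g d then g d else 0 :=
    hg.ite (measurableSet_lt measurable_const hg) measurable_const
  rw [← π.lintegral_visitMean T hg']
  calc _ ≤ ∫⁻ a, (C + ∑' n, (if π.updateTime coord n a ≤ T then
        (if C < g (π.interUpdate coord n a) then g (π.interUpdate coord n a) else 0) else 0))
          ∂seqLaw := by
        refine lintegral_mono_ae ?_
        filter_upwards [ae_good] with a ha
        exact tsum_crossing_le_add (π.monotone_updateTime ha) _ C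
    _ = _ := by
        rw [lintegral_add_left measurable_const, lintegral_const, measure_univ, mul_one]

/-- Completed intervals telescope to at most `T`, and the cap at 1 bounds the interval covering `T`.
This needs no moment assumption. -/
lemma visitMean_min_le {T : ℝ} :
    π.visitMean T (fun d => ENNReal.ofReal (min d 1)) ≤ ENNReal.ofReal T + 1 := by
  rw [← π.lintegral_visitMean T (by fun_prop)]
  calc _ ≤ ∫⁻ _, (ENNReal.ofReal T + 1) ∂seqLaw := by
        refine lintegral_mono_ae ?_
        filter_upwards [ae_good] with a ha
        have hmono := π.monotone_updateTime ha
        rw [tsum_le_level_eq hmono]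
        refine add_le_add (le_trans (ENNReal.tsum_le_tsum fun n => ?_)
          (tsum_increments_le hmono (π.updateTime_zero a))) (tsum_crossing_le hmono fun n => ?_)
        · split_ifs
          · exact ENNReal.ofReal_le_ofReal (min_le_left _ _)
          · exact le_rfl
        · exact (ENNReal.ofReal_le_ofReal (min_le_right _ _)).trans (by simp)
    _ = _ := by simp

/-- From an empty battery a positive wait for energy is unavoidable. From one unit the delay can
vanish, when `x₁ = 0`, so only visits to the empty state are bounded through this mean. -/
lemma stepMean_min_ne_zero : π.stepMean 0 (fun d _ => ENNReal.ofReal (min d 1)) ≠ 0 := by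
  intro h
  rw [stepMean, lintegral_eq_zero_iff (by fun_prop)] at h
  have : ∀ᵐ a ∂seqLaw, False := by
    filter_upwards [h, ae_good] with a h₁ h₂
    have := π.seqDelay_pos h₂.1
    have h₃ := ENNReal.ofReal_eq_zero.1 h₁
    exact absurd h₃ (not_le.2 (lt_min this one_pos))
  rw [ae_iff] at this
  simp at this

lemma visits_zero_le (T : ℝ) : π.visits T 0 ≤
    (ENNReal.ofReal T + 1) / π.stepMean 0 (fun d _ => ENNReal.ofReal (min d 1)) := by
  rw [ENNReal.le_div_iff_mul_le (.inl π.stepMean_min_ne_zero) (.inr (by simp))]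
  exact le_self_add.trans π.visitMean_min_le

lemma visits_zero_ne_top (T : ℝ) : π.visits T 0 ≠ ∞ :=
  ne_top_of_le_ne_top (ENNReal.div_ne_top (by simp) π.stepMean_min_ne_zero) (π.visits_zero_le T)

/-- Each visit to the empty state is either the start, which gives the `1`, or the end of a step
arriving by time `T`. Steps that start by `T` include one more, the step across `T`; `Y` is the
probability that it ends with an empty battery. -/
lemma visits_balance {T : ℝ} (hT : 0 ≤ T) :
    ∃ Y ≤ (1 : ℝ≥0∞), π.visits T 0 * π.stepMean 0 (fun _ j => if j = 0 then 1 else 0) +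
      π.visits T 1 * π.drain + 1 = π.visits T 0 + Y := by
  have hset : ∀ n, MeasurableSet {a | π.updateTime coord n a ≤ T ∧ π.energy coord n a = 0} :=
    fun n => (π.measurableSet_updateTime_le n T).inter
      (π.measurable_energy n (measurableSet_singleton 0))
  have h := π.lintegral_visits T (fun _ j => if j = 0 then 1 else 0) (g := fun _ => 1)
    measurable_const
  simp only [mul_one] at h
  refine ⟨∫⁻ a, ∑' n, (if π.updateTime coord n a ≤ T ∧ T < π.updateTime coord (n + 1) a
    then (if π.energy coord (n + 1) a = 0 then 1 else 0) else 0) ∂seqLaw, ?_, ?_⟩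
  · calc _ ≤ ∫⁻ _, 1 ∂seqLaw := by
          refine lintegral_mono_ae ?_
          filter_upwards [ae_good] with a ha
          refine tsum_crossing_le (π.monotone_updateTime ha) fun n => ?_
          split_ifs <;> simp
      _ = 1 := by simp
  · have hv : π.visits T 0 = 1 + ∫⁻ a, ∑' n, (if π.updateTime coord (n + 1) a ≤ T then
        (if π.energy coord (n + 1) a = 0 then 1 else 0) else 0) ∂seqLaw := by
      rw [visits, tsum_eq_zero_add' ENNReal.summable, lintegral_tsum]
      · congr 1
        · simp [updateTime_zero, energy_zero, hT]
        · refine tsum_congr fun n => ?_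
          rw [← lintegral_indicator_one (hset _)]
          refine lintegral_congr fun a => ?_
          simp [Set.indicator, ite_and]
      · intro n
        exact (Measurable.ite (π.measurableSet_updateTime_le _ T)
          (.ite (π.measurable_energy _ (measurableSet_singleton 0)) measurable_const
            measurable_const) measurable_const).aemeasurable
    have hind : ∀ n, Measurable fun a => if π.energy coord (n + 1) a = 0 then (1 : ℝ≥0∞) else 0 :=
      fun n => .ite (π.measurable_energy _ (measurableSet_singleton 0)) measurable_const
        measurable_const
    rw [drain, ← h, hv, add_assoc, add_comm, ← lintegral_add_left
      (Measurable.tsum fun n =>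
        (hind n).ite (π.measurableSet_updateTime_le _ T) measurable_const)]
    congr 1
    refine lintegral_congr_ae ?_
    filter_upwards [ae_good] with a ha
    exact tsum_le_level_eq (π.monotone_updateTime ha) _

lemma visits_one_mul_drain_le {T : ℝ} (hT : 0 ≤ T) :
    π.visits T 1 * π.drain ≤ π.visits T 0 * π.refill := by
  obtain ⟨Y, hY, h⟩ := π.visits_balance hT
  have h₁ : π.visits T 0 = π.visits T 0 * π.stepMean 0 (fun _ j => if j = 0 then 1 else 0) +
      π.visits T 0 * π.refill := by
    rw [refill, ← mul_add, stepMean_zero_add_one, mul_one]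
  have hfin : π.visits T 0 * π.stepMean 0 (fun _ j => if j = 0 then 1 else 0) ≠ ∞ :=
    ne_top_of_le_ne_top (π.visits_zero_ne_top T) (by conv_rhs => rw [h₁]
                                                     exact le_self_add)
  have h₂ : π.visits T 0 * π.stepMean 0 (fun _ j => if j = 0 then 1 else 0) +
      π.visits T 1 * π.drain ≤ π.visits T 0 :=
    (ENNReal.add_le_add_iff_right ENNReal.one_ne_top).1 (h.trans_le (by gcongr))
  exact (ENNReal.add_le_add_iff_left hfin).1 (h₂.trans_eq h₁)

lemma visits_zero_mul_refill_le {T : ℝ} (hT : 0 ≤ T) :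
    π.visits T 0 * π.refill ≤ π.visits T 1 * π.drain + 1 := by
  obtain ⟨Y, hY, h⟩ := π.visits_balance hT
  have h₁ : π.visits T 0 = π.visits T 0 * π.stepMean 0 (fun _ j => if j = 0 then 1 else 0) +
      π.visits T 0 * π.refill := by
    rw [refill, ← mul_add, stepMean_zero_add_one, mul_one]
  have hfin : π.visits T 0 * π.stepMean 0 (fun _ j => if j = 0 then 1 else 0) ≠ ∞ :=
    ne_top_of_le_ne_top (π.visits_zero_ne_top T) (by conv_rhs => rw [h₁]
                                                     exact le_self_add)
  refine (ENNReal.add_le_add_iff_left hfin).1 ?_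
  rw [← h₁, ← add_assoc, h]
  exact le_self_add

lemma visits_one_le {T : ℝ} (hT : 0 ≤ T) :
    π.visits T 1 ≤ π.visits T 0 * (π.refill * π.drain⁻¹) := by
  rw [← mul_assoc, ← div_eq_mul_inv,
    ENNReal.le_div_iff_mul_le (.inl π.drain_ne_zero) (.inl π.drain_ne_top)]
  exact π.visits_one_mul_drain_le hT

lemma visitMean_le {T : ℝ} (hT : 0 ≤ T) (f : ℝ → ℝ≥0∞) :
    π.visitMean T f ≤ π.visits T 0 * π.epochMean f := by
  rw [visitMean, epochMean, mul_add, ← mul_assoc (π.visits T 0)]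
  gcongr
  exact π.visits_one_le hT

open Classical in
/-- The expected sum over the part of an epoch after its first update, or `0` if there is none. -/
noncomputable def remainder (f : ℝ → ℝ≥0∞) : ℝ≥0∞ :=
  if π.refill = 0 then 0 else π.drain⁻¹ * π.stepMean 1 fun d _ => f d

/-- Replacing the visits by `visits T 0` complete epochs overcounts at most the unfinished part of
one epoch, a bound that does not depend on `T`. -/
lemma visits_mul_epochMean_le {T : ℝ} (hT : 0 ≤ T) (f : ℝ → ℝ≥0∞) :
    π.visits T 0 * π.epochMean f ≤ π.visitMean T f + π.remainder f := by
  rw [visitMean, epochMean, mul_add, remainder]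
  split_ifs with h
  · simp [h]
  · rw [add_assoc]
    gcongr
    have h₁ := π.visits_zero_mul_refill_le hT
    calc _ = (π.visits T 0 * π.refill) * (π.drain⁻¹ * π.stepMean 1 fun d _ => f d) := by ring
      _ ≤ (π.visits T 1 * π.drain + 1) * (π.drain⁻¹ * π.stepMean 1 fun d _ => f d) := by gcongr
      _ = π.visits T 1 * (π.drain * π.drain⁻¹) * (π.stepMean 1 fun d _ => f d) +
          π.drain⁻¹ * π.stepMean 1 fun d _ => f d := by ring
      _ = _ := by rw [ENNReal.mul_inv_cancel π.drain_ne_zero π.drain_ne_top, mul_one]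

/-- The case distinction in `remainder` is needed here: if `refill = 0`, the mean from one unit may
be infinite although `epochMean f` is finite. -/
lemma remainder_ne_top {f : ℝ → ℝ≥0∞} (h : π.epochMean f ≠ ∞) : π.remainder f ≠ ∞ := by
  rw [remainder]
  split_ifs with hq
  · simp
  · have h₁ : π.refill * π.drain⁻¹ * π.stepMean 1 (fun d _ => f d) ≠ ∞ :=
      ne_top_of_le_ne_top h le_add_self
    rw [mul_assoc] at h₁
    exact fun h₂ => h₁ (by rw [h₂, ENNReal.mul_top hq])

lemma epochMean_one_ne_top : π.epochMean (fun _ => 1) ≠ ∞ := by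
  have h₁ : π.refill ≠ ∞ := ne_top_of_le_ne_top ENNReal.one_ne_top π.refill_le_one
  simp [epochMean, stepMean, ENNReal.mul_eq_top, h₁, π.drain_ne_zero]

/-- The expected number of updates by time `T` is at most `visits T 0` times the mean number per
epoch, hence finite. So updates do not accumulate and `numUpdates` really counts them. -/
lemma ae_finite_updateTime_le {T : ℝ} (hT : 0 ≤ T) :
    ∀ᵐ a ∂seqLaw, {n | π.updateTime coord n a ≤ T}.Finite := by
  have h : ∫⁻ a, ∑' n, (if π.updateTime coord n a ≤ T then 1 else 0) ∂seqLaw ≠ ∞ := by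
    rw [π.lintegral_visitMean T (g := fun _ => 1) measurable_const]
    exact ne_top_of_le_ne_top (ENNReal.mul_ne_top (π.visits_zero_ne_top T) π.epochMean_one_ne_top)
      (π.visitMean_le hT _)
  filter_upwards [ae_lt_top (π.measurable_tsum_updateTime_le T (g := fun _ => 1) measurable_const)
    h] with a ha
  refine (ENNReal.finite_const_le_of_tsum_ne_top ha.ne one_ne_zero).subset fun n hn => ?_
  have hn : π.updateTime coord n a ≤ T := hn
  simp [hn]

/-! ### Elapsed time and age area -/

lemma le_visitMean_ofReal {T : ℝ} (hT : 0 ≤ T) :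
    ENNReal.ofReal T ≤ π.visitMean T ENNReal.ofReal := by
  rw [← π.lintegral_visitMean T (by fun_prop)]
  calc ENNReal.ofReal T = ∫⁻ _, ENNReal.ofReal T ∂seqLaw := by simp
    _ ≤ _ := by
      refine lintegral_mono_ae ?_
      filter_upwards [ae_good, π.ae_finite_updateTime_le hT] with a ha hfin
      exact le_tsum_increments (π.monotone_updateTime ha) (π.updateTime_zero a) hT hfin

lemma visitMean_ofReal_le (T : ℝ) (C : ℝ≥0∞) :
    π.visitMean T ENNReal.ofReal ≤ ENNReal.ofReal T +
      (C + π.visitMean T fun d => if C < ENNReal.ofReal d then ENNReal.ofReal d else 0) := by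
  refine le_trans ?_ (add_le_add_right (π.lintegral_crossing_le T (by fun_prop) C) _)
  rw [← π.lintegral_visitMean T (by fun_prop)]
  calc _ ≤ ∫⁻ a, (ENNReal.ofReal T +
        ∑' n, (if π.updateTime coord n a ≤ T ∧ T < π.updateTime coord (n + 1) a
          then ENNReal.ofReal (π.interUpdate coord n a) else 0)) ∂seqLaw := by
        refine lintegral_mono_ae ?_
        filter_upwards [ae_good] with a ha
        have hmono := π.monotone_updateTime ha
        rw [tsum_le_level_eq hmono]
        exact add_le_add_left (tsum_increments_le hmono (π.updateTime_zero a)) _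
    _ = _ := by
        rw [lintegral_add_left measurable_const, lintegral_const, measure_univ, mul_one]

lemma numUpdates_eq {a : ℕ → ℝ} {T : ℝ} {N : ℕ}
    (hN : ∀ n, π.updateTime coord n a ≤ T ↔ n ≤ N) : π.numUpdates coord T a = N := by
  have : {n : ℕ | 1 ≤ n ∧ π.updateTime coord n a ≤ T} = Set.Icc 1 N := by
    ext n
    simp [hN]
  rw [numUpdates, this, ← Finset.coe_Icc, Set.ncard_coe_finset]
  simp

/-- The area lies between the sum over the completed intervals and the sum that also contains the
whole interval covering `T`; the difference of the two sums is the crossing term. -/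
lemma ageArea_bounds {a : ℕ → ℝ} (ha : Good a) {T : ℝ} (hT : 0 ≤ T)
    (hfin : {n | π.updateTime coord n a ≤ T}.Finite) :
    (∑' n, (if π.updateTime coord (n + 1) a ≤ T then delayArea (π.interUpdate coord n a) else 0)
      ≤ ENNReal.ofReal (π.ageArea coord T a)) ∧
    ENNReal.ofReal (π.ageArea coord T a) ≤
      ∑' n, (if π.updateTime coord n a ≤ T then delayArea (π.interUpdate coord n a) else 0) := by
  obtain ⟨N, hN⟩ := exists_setOf_le_eq (π.monotone_updateTime ha) (π.updateTime_zero a) hT hfin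
  have hnum := π.numUpdates_eq hN
  have hsum : ∀ m, ∑ n ∈ Finset.range m, delayArea (π.interUpdate coord n a) =
      ENNReal.ofReal ((1 / 2) * ∑ n ∈ Finset.range m, π.interUpdate coord n a ^ 2) := by
    intro m
    rw [Finset.mul_sum, ENNReal.ofReal_sum_of_nonneg fun n _ => by positivity]
    rfl
  simp_rw [hN]
  rw [ageArea, hnum]
  constructor
  · have : ∀ n, (if n + 1 ≤ N then delayArea (π.interUpdate coord n a) else 0) =
        if n < N then delayArea (π.interUpdate coord n a) else 0 := fun n => rfl
    rw [tsum_eq_sum (s := Finset.range N) fun n hn => by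
      rw [if_neg]; rw [Finset.mem_range] at hn; omega]
    rw [Finset.sum_congr rfl fun n hn => if_pos (Nat.succ_le_of_lt (Finset.mem_range.1 hn)), hsum]
    refine ENNReal.ofReal_le_ofReal (le_add_of_nonneg_right (by positivity))
  · rw [tsum_ite_le_eq_sum, hsum]
    refine ENNReal.ofReal_le_ofReal ?_
    rw [Finset.sum_range_succ, mul_add]
    have h₁ : π.updateTime coord N a ≤ T := (hN N).2 le_rfl
    have h₂ : T < π.updateTime coord (N + 1) a := not_le.1 fun h => absurd ((hN _).1 h) (by omega)
    have h₃ : (T - π.updateTime coord N a) ^ 2 ≤ π.interUpdate coord N a ^ 2 := by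
      rw [interUpdate]
      exact pow_le_pow_left₀ (by linarith) (by linarith) 2
    linarith

lemma lintegral_ageArea_le {T : ℝ} (hT : 0 ≤ T) :
    ∫⁻ a, ENNReal.ofReal (π.ageArea coord T a) ∂seqLaw ≤ π.visitMean T delayArea := by
  rw [← π.lintegral_visitMean T (by fun_prop)]
  refine lintegral_mono_ae ?_
  filter_upwards [ae_good, π.ae_finite_updateTime_le hT] with a ha hfin
  exact (π.ageArea_bounds ha hT hfin).2

lemma visitMean_delayArea_le {T : ℝ} (hT : 0 ≤ T) (C : ℝ≥0∞) :
    π.visitMean T delayArea ≤ ∫⁻ a, ENNReal.ofReal (π.ageArea coord T a) ∂seqLaw +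
      (C + π.visitMean T fun d => if C < delayArea d then delayArea d else 0) := by
  refine le_trans ?_ (add_le_add_right (π.lintegral_crossing_le T (by fun_prop) C) _)
  rw [← π.lintegral_visitMean T (by fun_prop),
    ← lintegral_add_right _ (π.measurable_tsum_crossing T (by fun_prop))]
  refine lintegral_mono_ae ?_
  filter_upwards [ae_good, π.ae_finite_updateTime_le hT] with a ha hfin
  rw [tsum_le_level_eq (π.monotone_updateTime ha)]
  exact add_le_add_left (π.ageArea_bounds ha hT hfin).1 _

end RenewalPolicy

/-! ### The renewal reward theorem -/

lemma tendsto_div_zero_of_le {n f : ℝ → ℝ} {K : ℝ} (hn : ∀ T, 0 ≤ T → n T ≤ K * (T + 1))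
    (hf : ∀ T, 0 ≤ T → 0 ≤ f T)
    (h : ∀ ε, 0 < ε → ∃ M, ∀ T, 0 ≤ T → f T ≤ M + ε * n T) :
    Tendsto (fun T => f T / T) atTop (𝓝 0) := by
  rw [Metric.tendsto_atTop]
  intro δ hδ
  set K' := max K 1
  have hK' : 0 < K' := lt_max_of_lt_right one_pos
  -- For `T ≥ 1` one has `n T ≤ 2 K' T`, so this ε costs at most `δ T / 2`; the second lower bound
  -- on `T` makes `M` at most `δ T / 4`.
  obtain ⟨M, hM⟩ := h (δ / (4 * K')) (by positivity)
  refine ⟨max 1 (4 * M / δ), fun T hT => ?_⟩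
  have hT1 : 1 ≤ T := (le_max_left _ _).trans hT
  have hT2 : 4 * M / δ ≤ T := (le_max_right _ _).trans hT
  have hT0 : 0 ≤ T := by linarith
  have h2 : n T ≤ K' * (2 * T) := (hn T hT0).trans (by
    have : K ≤ K' := le_max_left _ _
    nlinarith)
  have h3 : δ / (4 * K') * n T ≤ δ / 2 * T := by
    calc _ ≤ δ / (4 * K') * (K' * (2 * T)) := by gcongr
      _ = _ := by field_simp; ring
  rw [div_le_iff₀ hδ] at hT2
  rw [Real.dist_eq, sub_zero, abs_of_nonneg (div_nonneg (hf T hT0) hT0), div_lt_iff₀ (by linarith)]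
  have := hM T hT0
  nlinarith

/-- With `n b - T = o(T)` and `n a - ρ = o(T)`, the limit follows from ρ/T = (n b/T)(a/b) - (n a -
ρ)/T. -/
lemma tendsto_reward_div {n ρ : ℝ → ℝ} {a b K : ℝ} (hb : 0 < b)
    (hn : ∀ T, 0 ≤ T → n T ≤ K * (T + 1))
    (h₁ : ∀ T, 0 ≤ T → T ≤ n T * b)
    (h₂ : ∀ ε, 0 < ε → ∃ M, ∀ T, 0 ≤ T → n T * b ≤ T + (M + ε * n T))
    (h₃ : ∀ T, 0 ≤ T → ρ T ≤ n T * a)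
    (h₄ : ∀ ε, 0 < ε → ∃ M, ∀ T, 0 ≤ T → n T * a ≤ ρ T + (M + ε * n T)) :
    Tendsto (fun T => ρ T / T) atTop (𝓝 (a / b)) := by
  have l₁ := tendsto_div_zero_of_le (f := fun T => n T * b - T) hn
    (fun T hT => sub_nonneg.2 (h₁ T hT)) fun ε hε => by
      obtain ⟨M, hM⟩ := h₂ ε hε
      exact ⟨M, fun T hT => by linarith [hM T hT]⟩
  have l₂ := tendsto_div_zero_of_le (f := fun T => n T * a - ρ T) hn
    (fun T hT => sub_nonneg.2 (h₃ T hT)) fun ε hε => by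
      obtain ⟨M, hM⟩ := h₄ ε hε
      exact ⟨M, fun T hT => by linarith [hM T hT]⟩
  have l := ((l₁.add_const 1).mul_const (a / b)).sub l₂
  rw [zero_add, one_mul, sub_zero] at l
  refine l.congr' ?_
  filter_upwards [eventually_gt_atTop 0] with T hT
  field_simp
  ring

/-! ### Moment conditions, truncation and the limit of the average age -/

namespace RenewalPolicy

variable (π : RenewalPolicy)

lemma stepMean_mono (k : Fin 2) {f g : ℝ → Fin 2 → ℝ≥0∞} (h : ∀ d j, f d j ≤ g d j) :
    π.stepMean k f ≤ π.stepMean k g :=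
  lintegral_mono fun _ => h _ _

lemma epochMean_mono {f g : ℝ → ℝ≥0∞} (h : ∀ d, f d ≤ g d) : π.epochMean f ≤ π.epochMean g :=
  add_le_add (π.stepMean_mono _ fun _ _ => h _)
    (mul_le_mul_right (π.stepMean_mono _ fun _ _ => h _) _)

lemma epochMean_add {f g : ℝ → ℝ≥0∞} (hf : Measurable f) :
    π.epochMean (fun d => f d + g d) = π.epochMean f + π.epochMean g := by
  have h : ∀ k, π.stepMean k (fun d _ => f d + g d) =
      π.stepMean k (fun d _ => f d) + π.stepMean k (fun d _ => g d) := fun k =>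
    lintegral_add_left (hf.comp (π.measurable_seqDelay measurable_const measurable_id)) _
  simp only [epochMean, h]
  ring

lemma lintegral_interUpdate (n : ℕ) {f : ℝ → ℝ≥0∞} (hf : Measurable f) :
    ∫⁻ a, f (π.interUpdate coord n a) ∂seqLaw =
      ∫⁻ a, π.stepMean (π.energy coord n a) (fun d _ => f d) ∂seqLaw := by
  have := (π.freshAt_one n).lintegral_step
    (f := fun _ k d j => (fun _ _ => 1 : Fin 2 → Fin 2 → ℝ≥0∞) k j * f d)
    (measurable_mul_step (fun _ _ => 1) hf)
  simpa only [one_mul] using this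

/-- The second inter-update time starts from one unit with probability `refill`. This is how a
moment bound on inter-update times reaches the kernel `stepMean 1`, and why only the first two times
are needed for the epoch moments. -/
lemma refill_mul_stepMean_le {f : ℝ → ℝ≥0∞} (hf : Measurable f) :
    π.refill * π.stepMean 1 (fun d _ => f d) ≤ ∫⁻ a, f (π.interUpdate coord 1 a) ∂seqLaw := by
  have h := π.lintegral_epochWeight 0
  rw [pow_zero, mul_one] at h
  rw [π.lintegral_interUpdate 1 hf, ← h, ← lintegral_mul_const _ (π.measurable_epochWeight _)]
  refine lintegral_mono fun a => ?_
  rw [← π.epochWeight_mul_energy 0 a fun k => π.stepMean k fun d _ => f d]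
  refine mul_le_of_le_one_left zero_le ?_
  rw [epochWeight]
  split_ifs <;> simp

lemma epochMean_sq_ne_top (h : π.UniformlyBounded seqLaw coord) :
    π.epochMean (fun d => ENNReal.ofReal (d ^ 2)) ≠ ∞ := by
  obtain ⟨C, hC⟩ := h
  have h0 := hC 0
  have h1 := (π.refill_mul_stepMean_le (f := fun d => ENNReal.ofReal (d ^ 2))
    (by fun_prop)).trans (hC 1)
  rw [π.lintegral_interUpdate 0 (f := fun d => ENNReal.ofReal (d ^ 2)) (by fun_prop)] at h0
  simp only [energy_zero, lintegral_const, measure_univ, mul_one] at h0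
  rw [epochMean, mul_right_comm]
  exact ENNReal.add_ne_top.2 ⟨ne_top_of_le_ne_top ENNReal.coe_ne_top h0,
    ENNReal.mul_ne_top (ne_top_of_le_ne_top ENNReal.coe_ne_top h1)
      (ENNReal.inv_ne_top.2 π.drain_ne_zero)⟩

lemma epochMean_delayArea_ne_top (h : π.UniformlyBounded seqLaw coord) :
    π.epochMean delayArea ≠ ∞ :=
  ne_top_of_le_ne_top (π.epochMean_sq_ne_top h) (π.epochMean_mono fun d =>
    ENNReal.ofReal_le_ofReal (by nlinarith [sq_nonneg d]))

lemma epochMean_ofReal_ne_top (h : π.UniformlyBounded seqLaw coord) :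
    π.epochMean ENNReal.ofReal ≠ ∞ := by
  have h₁ : π.epochMean (fun d => 1 + ENNReal.ofReal (d ^ 2)) ≠ ∞ := by
    rw [π.epochMean_add measurable_const]
    exact ENNReal.add_ne_top.2 ⟨π.epochMean_one_ne_top, π.epochMean_sq_ne_top h⟩
  refine ne_top_of_le_ne_top h₁ (π.epochMean_mono fun d => ?_)
  rw [← ENNReal.ofReal_one, ← ENNReal.ofReal_add zero_le_one (sq_nonneg d)]
  exact ENNReal.ofReal_le_ofReal (by nlinarith [sq_nonneg (d - 1)])

lemma epochMean_ofReal_ne_zero : π.epochMean ENNReal.ofReal ≠ 0 := by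
  intro h
  refine π.stepMean_min_ne_zero (le_antisymm ?_ zero_le)
  refine (π.stepMean_mono 0 fun d _ => ENNReal.ofReal_le_ofReal (min_le_left d 1)).trans ?_
  rw [← h]
  exact le_self_add

lemma uniformlyBounded_of_stepMean_ne_top
    (h : ∀ k, π.stepMean k (fun d _ => ENNReal.ofReal (d ^ 2)) ≠ ∞) :
    π.UniformlyBounded seqLaw coord := by
  set m := fun k => π.stepMean k (fun d _ => ENNReal.ofReal (d ^ 2))
  refine ⟨(m 0).toNNReal + (m 1).toNNReal, fun n => ?_⟩
  rw [π.lintegral_interUpdate n (f := fun d => ENNReal.ofReal (d ^ 2)) (by fun_prop),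
    ENNReal.coe_add, ENNReal.coe_toNNReal (h 0), ENNReal.coe_toNNReal (h 1)]
  calc _ ≤ ∫⁻ _, (m 0 + m 1) ∂seqLaw := by
        refine lintegral_mono fun a => ?_
        rcases (by omega : π.energy coord n a = 0 ∨ π.energy coord n a = 1) with hk | hk
        · simp [hk, m]
        · simp [hk, m]
    _ = _ := by simp [m]

lemma tendsto_stepMean_tail (k : Fin 2) {g : ℝ → ℝ≥0∞} (hg : Measurable g)
    (hg' : ∀ d, g d ≠ ∞) (h : π.stepMean k (fun d _ => g d) ≠ ∞) :
    Tendsto (fun M : ℕ => π.stepMean k fun d _ => if (M : ℝ≥0∞) < g d then g d else 0)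
      atTop (𝓝 0) := by
  have hd : Measurable (π.seqDelay k) := π.measurable_seqDelay measurable_const measurable_id
  have := tendsto_lintegral_of_dominated_convergence (μ := seqLaw) (f := fun _ => 0)
    (F := fun (M : ℕ) b => if (M : ℝ≥0∞) < g (π.seqDelay k b) then g (π.seqDelay k b) else 0)
    (fun b => g (π.seqDelay k b))
    (fun M => .ite (measurableSet_lt measurable_const (hg.comp hd)) (hg.comp hd)
      measurable_const) (fun M => ae_of_all _ fun b => by
        show (if _ then _ else _) ≤ _
        split_ifs <;> simp) h
    (ae_of_all _ fun b => by
      obtain ⟨M, hM⟩ := ENNReal.exists_nat_gt (hg' (π.seqDelay k b))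
      refine tendsto_const_nhds.congr' ?_
      filter_upwards [eventually_ge_atTop M] with m hm
      rw [if_neg (not_lt.2 (hM.le.trans (by exact_mod_cast hm)))])
  simpa [stepMean] using this

lemma tendsto_epochMean_tail {g : ℝ → ℝ≥0∞} (hg : Measurable g)
    (hg' : ∀ d, g d ≠ ∞) (h : π.epochMean g ≠ ∞) :
    Tendsto (fun M : ℕ => π.epochMean fun d => if (M : ℝ≥0∞) < g d then g d else 0)
      atTop (𝓝 0) := by
  have l₀ := π.tendsto_stepMean_tail 0 hg hg' (ne_top_of_le_ne_top h le_self_add)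
  by_cases hq : π.refill = 0
  · simpa [epochMean, hq] using l₀
  · have hq' : π.refill * π.drain⁻¹ ≠ 0 := by simp [hq, π.drain_ne_top]
    have hq'' : π.refill * π.drain⁻¹ ≠ ∞ := ENNReal.mul_ne_top
      (ne_top_of_le_ne_top ENNReal.one_ne_top π.refill_le_one)
      (ENNReal.inv_ne_top.2 π.drain_ne_zero)
    have h₁ : π.stepMean 1 (fun d _ => g d) ≠ ∞ := fun h₁ => by
      rw [epochMean, h₁, ENNReal.mul_top hq'] at h
      simp at h
    have l₁ := ENNReal.Tendsto.const_mul (π.tendsto_stepMean_tail 1 hg hg' h₁) (.inr hq'')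
    simpa [epochMean] using l₀.add l₁

/-- The truncation level `M` is chosen so that the part of `g` above it has epoch mean below ε. The
error then consists of the level, the unfinished epoch, and ε for each epoch begun. -/
lemma visits_mul_epochMean_le_of_tail {g : ℝ → ℝ≥0∞} (hg : Measurable g)
    (hg' : ∀ d, g d ≠ ∞) (h : π.epochMean g ≠ ∞) {r : ℝ → ℝ≥0∞}
    (hr : ∀ T, 0 ≤ T → r T ≠ ∞)
    (hb : ∀ T, 0 ≤ T → ∀ C, π.visitMean T g ≤
      r T + (C + π.visitMean T fun d => if C < g d then g d else 0)) {ε : ℝ} (hε : 0 < ε) :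
    ∃ M, ∀ T, 0 ≤ T → (π.visits T 0).toReal * (π.epochMean g).toReal ≤
      (r T).toReal + (M + ε * (π.visits T 0).toReal) := by
  obtain ⟨M, hM⟩ := ((π.tendsto_epochMean_tail hg hg' h).eventually
    (gt_mem_nhds (ENNReal.ofReal_pos.2 hε))).exists
  have hrem := π.remainder_ne_top h
  refine ⟨M + (π.remainder g).toReal, fun T hT => ?_⟩
  have hv := π.visits_zero_ne_top T
  have h₁ : π.visits T 0 * π.epochMean g ≤
      r T + ((M + π.remainder g) + ENNReal.ofReal ε * π.visits T 0) := by
    refine (π.visits_mul_epochMean_le hT g).trans ((add_le_add_left (hb T hT M) _).trans ?_)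
    have h₂ := (π.visitMean_le hT fun d => if (M : ℝ≥0∞) < g d then g d else 0).trans
      (mul_le_mul_right hM.le _)
    calc _ ≤ r T + (M + π.visits T 0 * ENNReal.ofReal ε) + π.remainder g := by gcongr
      _ = _ := by ring
  have h₃ := ENNReal.toReal_mono (by finiteness [hr T hT]) h₁
  rwa [ENNReal.toReal_mul, ENNReal.toReal_add (hr T hT) (by finiteness),
    ENNReal.toReal_add (by finiteness) (by finiteness), ENNReal.toReal_add (by finiteness) hrem,
    ENNReal.toReal_mul, ENNReal.toReal_ofReal hε.le, ENNReal.toReal_natCast] at h₃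

/-- Renewal reward in expectation, with `visits T 0` as the expected number of epochs begun by time
`T`. The limsup is in fact a limit. -/
lemma averageAge_eq_epochMean_div (h : π.UniformlyBounded seqLaw coord) :
    π.averageAge seqLaw coord = π.epochMean delayArea / π.epochMean ENNReal.ofReal := by
  have hA := π.epochMean_delayArea_ne_top h
  have hL := π.epochMean_ofReal_ne_top h
  have hv := π.visits_zero_ne_top
  have hL0 : 0 < (π.epochMean ENNReal.ofReal).toReal :=
    ENNReal.toReal_pos π.epochMean_ofReal_ne_zero hL
  set r : ℝ → ℝ≥0∞ := fun T => ∫⁻ a, ENNReal.ofReal (π.ageArea coord T a) ∂seqLaw with hr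
  have hrle : ∀ T, 0 ≤ T → r T ≤ π.visits T 0 * π.epochMean delayArea := fun T hT =>
    (π.lintegral_ageArea_le hT).trans (π.visitMean_le hT _)
  have hrfin : ∀ T, 0 ≤ T → r T ≠ ∞ := fun T hT =>
    ne_top_of_le_ne_top (ENNReal.mul_ne_top (hv T) hA) (hrle T hT)
  set b := π.stepMean 0 (fun d _ => ENNReal.ofReal (min d 1))
  have key : Tendsto (fun T => (r T).toReal / T) atTop
      (𝓝 ((π.epochMean delayArea).toReal / (π.epochMean ENNReal.ofReal).toReal)) := by
    refine tendsto_reward_div (n := fun T => (π.visits T 0).toReal) (K := b.toReal⁻¹) hL0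
      (fun T hT => ?_) (fun T hT => ?_) (fun ε hε => ?_) (fun T hT => ?_) (fun ε hε => ?_)
    · have := ENNReal.toReal_mono (ENNReal.div_ne_top (by simp) π.stepMean_min_ne_zero)
        (π.visits_zero_le T)
      rwa [ENNReal.toReal_div, ENNReal.toReal_add (by simp) (by simp), ENNReal.toReal_ofReal hT,
        ENNReal.toReal_one, div_eq_inv_mul] at this
    · have := ENNReal.toReal_mono (ENNReal.mul_ne_top (hv T) hL)
        ((π.le_visitMean_ofReal hT).trans (π.visitMean_le hT _))
      rwa [ENNReal.toReal_ofReal hT, ENNReal.toReal_mul] at this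
    · obtain ⟨M, hM⟩ := π.visits_mul_epochMean_le_of_tail (g := ENNReal.ofReal) (by fun_prop)
        (by simp) hL (r := ENNReal.ofReal) (by simp) (fun T _ C => π.visitMean_ofReal_le T C) hε
      exact ⟨M, fun T hT => by simpa [ENNReal.toReal_ofReal hT] using hM T hT⟩
    · have := ENNReal.toReal_mono (ENNReal.mul_ne_top (hv T) hA) (hrle T hT)
      rwa [ENNReal.toReal_mul] at this
    · exact π.visits_mul_epochMean_le_of_tail (by fun_prop) (fun d => ENNReal.ofReal_ne_top) hA hrfin
        (fun T hT C => π.visitMean_delayArea_le hT C) hε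
  have key' := ENNReal.tendsto_ofReal key
  rw [ENNReal.ofReal_div_of_pos hL0, ENNReal.ofReal_toReal hA, ENNReal.ofReal_toReal hL] at key'
  refine Tendsto.limsup_eq (key'.congr' ?_)
  filter_upwards [eventually_gt_atTop 0] with T hT
  rw [ENNReal.ofReal_div_of_pos hT, ENNReal.ofReal_toReal (hrfin T hT.le)]

/-! ### Transfer to the sequence space -/

section Transfer

variable {Ω : Type*} (τ : ℕ → Ω → ℝ)

lemma state_eq_coord (n : ℕ) (ω : Ω) : π.state τ n ω = π.state coord n fun i => τ i ω := by
  induction n with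
  | zero => rfl
  | succ n ih =>
    simp only [state, ih]
    rfl

lemma energy_eq_coord (n : ℕ) (ω : Ω) : π.energy τ n ω = π.energy coord n fun i => τ i ω := by
  rw [energy, state_eq_coord]
  rfl

lemma updateTime_eq_coord (n : ℕ) (ω : Ω) :
    π.updateTime τ n ω = π.updateTime coord n fun i => τ i ω := by
  rw [updateTime, state_eq_coord]
  rfl

lemma interUpdate_eq_coord (n : ℕ) (ω : Ω) :
    π.interUpdate τ n ω = π.interUpdate coord n fun i => τ i ω := by
  simp only [interUpdate, updateTime_eq_coord π τ]

lemma inEpoch_eq_coord (n : ℕ) (ω : Ω) : π.InEpoch τ n ω ↔ π.InEpoch coord n fun i => τ i ω := by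
  simp only [InEpoch, energy_eq_coord π τ]

lemma ageArea_eq_coord (T : ℝ) (ω : Ω) : π.ageArea τ T ω = π.ageArea coord T fun i => τ i ω := by
  simp only [ageArea, numUpdates, interUpdate_eq_coord π τ, updateTime_eq_coord π τ]

lemma measurable_ageArea (T : ℝ) : Measurable (π.ageArea coord T) := by
  have hN : Measurable (π.numUpdates coord T) :=
    measurable_ncard (s := fun n => {a | 1 ≤ n ∧ π.updateTime coord n a ≤ T}) fun n =>
      (MeasurableSet.const _).inter (π.measurableSet_updateTime_le n T)
  have h : Measurable fun q : ℕ × (ℕ → ℝ) =>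
      (1 / 2) * ∑ i ∈ Finset.range q.1, π.interUpdate coord i q.2 ^ 2
        + (1 / 2) * (T - π.updateTime coord q.1 q.2) ^ 2 :=
    measurable_from_prod_countable_right fun k => by
      show Measurable fun a => (1 / 2) * ∑ i ∈ Finset.range k, π.interUpdate coord i a ^ 2
        + (1 / 2) * (T - π.updateTime coord k a) ^ 2
      fun_prop
  have h' := h.comp (hN.prodMk measurable_id)
  exact h'

open Classical in
lemma measurable_epochSum {f : ℝ → ℝ≥0∞} (hf : Measurable f) : Measurable fun a =>
    ∑' n, (if π.InEpoch coord n a then f (π.interUpdate coord n a) else 0) := by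
  refine Measurable.tsum fun n => ?_
  have : ∀ a, (if π.InEpoch coord n a then f (π.interUpdate coord n a) else 0) =
      π.epochWeight n a * f (π.interUpdate coord n a) := fun a => by
    by_cases h : π.InEpoch coord n a <;> simp [epochWeight, h]
  simp_rw [this]
  exact (π.measurable_epochWeight n).mul (hf.comp (π.measurable_interUpdate n))

variable [MeasurableSpace Ω] {P : Measure Ω} {τ}

lemma measurePreserving_seqLaw (hmeas : ∀ i, Measurable (τ i))
    (hlaw : ∀ i, P.map (τ i) = expMeasure 1)
    (hindep : iIndepFun τ P) : MeasurePreserving (fun ω i => τ i ω) P seqLaw := by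
  refine ⟨measurable_pi_iff.2 hmeas, ?_⟩
  rw [hindep.map_fun_eq_infinitePi_map hmeas, seqLaw]
  congr
  ext1 i
  exact hlaw i

open Classical in
lemma meanArea_eq_epochMean (hτ : MeasurePreserving (fun ω i => τ i ω) P seqLaw) :
    π.meanArea P τ = π.epochMean delayArea := by
  rw [← π.lintegral_epoch measurable_delayArea,
    ← hτ.lintegral_comp (π.measurable_epochSum measurable_delayArea), meanArea]
  refine lintegral_congr fun ω => tsum_congr fun n => ?_
  rw [← interUpdate_eq_coord]
  exact if_congr (π.inEpoch_eq_coord τ n ω) rfl rfl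

open Classical in
lemma meanLength_eq_epochMean (hτ : MeasurePreserving (fun ω i => τ i ω) P seqLaw) :
    π.meanLength P τ = π.epochMean ENNReal.ofReal := by
  rw [← π.lintegral_epoch ENNReal.measurable_ofReal,
    ← hτ.lintegral_comp (π.measurable_epochSum ENNReal.measurable_ofReal), meanLength]
  refine lintegral_congr fun ω => tsum_congr fun n => ?_
  rw [← interUpdate_eq_coord]
  exact if_congr (π.inEpoch_eq_coord τ n ω) rfl rfl

lemma uniformlyBounded_iff_coord (hτ : MeasurePreserving (fun ω i => τ i ω) P seqLaw) :
    π.UniformlyBounded P τ ↔ π.UniformlyBounded seqLaw coord := by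
  have h : ∀ n, ∫⁻ ω, ENNReal.ofReal (π.interUpdate τ n ω ^ 2) ∂P =
      ∫⁻ a, ENNReal.ofReal (π.interUpdate coord n a ^ 2) ∂seqLaw := fun n => by
    rw [← hτ.lintegral_comp (by fun_prop)]
    simp only [interUpdate_eq_coord π τ]
  simp only [UniformlyBounded, h]

lemma averageAge_eq_coord (hτ : MeasurePreserving (fun ω i => τ i ω) P seqLaw) :
    π.averageAge P τ = π.averageAge seqLaw coord := by
  have h : ∀ T, ∫⁻ ω, ENNReal.ofReal (π.ageArea τ T ω) ∂P =
      ∫⁻ a, ENNReal.ofReal (π.ageArea coord T a) ∂seqLaw := fun T => by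
    rw [← hτ.lintegral_comp (π.measurable_ageArea T).ennreal_ofReal]
    simp only [ageArea_eq_coord π τ]
  simp only [averageAge, h]

end Transfer

end RenewalPolicy

/-! ### Integrals against the exponential law -/

lemma integrable_expMeasure_iff (f : ℝ → ℝ) :
    Integrable f (expMeasure 1) ↔ IntegrableOn (fun t => Real.exp (-t) * f t) (Set.Ioi 0) := by
  rw [expMeasure_one_eq, integrable_withDensity_iff_integrable_smul' (by fun_prop) (by simp)]
  simp [ENNReal.toReal_ofReal (Real.exp_pos _).le, IntegrableOn]

lemma integrable_pow_expMeasure (n : ℕ) : Integrable (fun t => t ^ n) (expMeasure 1) := by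
  rw [integrable_expMeasure_iff]
  have := Real.GammaIntegral_convergent (s := n + 1) (by positivity)
  simpa using this

lemma integral_pow_expMeasure (n : ℕ) : ∫ t, t ^ n ∂(expMeasure 1) = n.factorial := by
  rw [integral_expMeasure, ← Real.Gamma_nat_eq_factorial, Real.Gamma_eq_integral (by positivity)]
  simp

lemma integral_expMeasure_split {c : ℝ} (hc : 0 ≤ c) {g : ℝ → ℝ} (hg : Continuous g) (d : ℝ) :
    Integrable (fun t => if t ≤ c then g t else d) (expMeasure 1) ∧
    ∫ t, (if t ≤ c then g t else d) ∂(expMeasure 1) =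
      (∫ t in (0 : ℝ)..c, Real.exp (-t) * g t) + d * Real.exp (-c) := by
  have hexp : IntegrableOn (fun t : ℝ => Real.exp (-t)) (Set.Ioi c) := by
    simpa using exp_neg_integrableOn_Ioi c one_pos
  have e₁ : Set.EqOn (fun t => Real.exp (-t) * if t ≤ c then g t else d)
      (fun t => Real.exp (-t) * g t) (Set.Ioc 0 c) := fun t ht => by simp [ht.2]
  have e₂ : Set.EqOn (fun t => Real.exp (-t) * if t ≤ c then g t else d)
      (fun t => Real.exp (-t) * d) (Set.Ioi c) := fun t ht => by
    have : ¬ t ≤ c := not_le.2 ht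
    simp [this]
  have i₁ : IntegrableOn (fun t => Real.exp (-t) * if t ≤ c then g t else d) (Set.Ioc 0 c) := by
    rw [integrableOn_congr_fun e₁ measurableSet_Ioc]
    exact ((by fun_prop : Continuous fun t => Real.exp (-t) * g t).integrableOn_Icc).mono_set
      Set.Ioc_subset_Icc_self
  have i₂ : IntegrableOn (fun t => Real.exp (-t) * if t ≤ c then g t else d) (Set.Ioi c) := by
    rw [integrableOn_congr_fun e₂ measurableSet_Ioi]
    exact hexp.mul_const d
  rw [integrable_expMeasure_iff, integral_expMeasure, ← Set.Ioc_union_Ioi_eq_Ioi hc]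
  refine ⟨i₁.union i₂, ?_⟩
  rw [setIntegral_union (Set.Ioc_disjoint_Ioi le_rfl)
    measurableSet_Ioi i₁ i₂, setIntegral_congr_fun measurableSet_Ioc e₁,
    setIntegral_congr_fun measurableSet_Ioi e₂, intervalIntegral.integral_of_le hc,
    integral_mul_const, integral_exp_neg_Ioi, mul_comm d]

/-! ### The cost of a delay -/

/-- The contribution `y² / 2 - l y` of a delay `y` to the parametrized objective. -/
noncomputable def cost (l y : ℝ) : ℝ := (1 / 2) * y ^ 2 - l * y

/-- The least cost of a delay which is at least `t`. -/
noncomputable def fullCost (l t : ℝ) : ℝ := cost l (max t l)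

/-- The marginal cost of a longer threshold, when a second arrival is worth `-v`. -/
noncomputable def marginal (l v t : ℝ) : ℝ := fullCost l t + v + (t - l) - cost l t

@[fun_prop] lemma continuous_cost (l : ℝ) : Continuous (cost l) := by
  unfold cost
  fun_prop

@[fun_prop] lemma continuous_fullCost (l : ℝ) : Continuous (fullCost l) := by
  unfold fullCost
  fun_prop

@[fun_prop] lemma continuous_marginal (l v : ℝ) : Continuous (marginal l v) := by
  unfold marginal
  fun_prop

/-- The cost is a parabola with vertex at `l`, so on the half-line from `t` it is least at `max t
l`, and only there. -/
lemma fullCost_le_cost {l t y : ℝ} (h : t ≤ y) : fullCost l t ≤ cost l y := by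
  unfold fullCost cost
  rcases le_total t l with ht | ht
  · rw [max_eq_right ht]
    nlinarith [sq_nonneg (y - l)]
  · rw [max_eq_left ht]
    nlinarith

lemma eq_max_of_cost_eq {l t y : ℝ} (h : t ≤ y) (he : cost l y = fullCost l t) :
    y = max t l := by
  unfold fullCost cost at he
  rcases le_total t l with ht | ht
  · rw [max_eq_right ht] at he ⊢
    have : (y - l) ^ 2 = 0 := by linarith
    nlinarith [pow_eq_zero_iff (two_ne_zero) |>.1 this]
  · rw [max_eq_left ht] at he ⊢
    by_contra hne
    have h₁ : t < y := lt_of_le_of_ne h (Ne.symm hne)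
    nlinarith [mul_pos (sub_pos.2 h₁) (by linarith : 0 < y - l)]

lemma marginal_of_le {l v t : ℝ} (h : t ≤ l) :
    marginal l v t = t - l + v - (1 / 2) * (l - t) ^ 2 := by
  unfold marginal fullCost cost
  rw [max_eq_right h]
  ring

lemma marginal_of_ge {l v t : ℝ} (h : l ≤ t) : marginal l v t = t - l + v := by
  unfold marginal fullCost
  rw [max_eq_left h]
  ring

/-- The expected cost up to the next update when the first arrival comes after `a` and the
threshold is `y`. -/
noncomputable def waitCost (l v a y : ℝ) : ℝ :=
  ∫ t, (if t ≤ y - a then fullCost l (a + t) + v else cost l y) ∂(expMeasure 1)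

/-- At `y = a` the cost is `cost l a`. Raising the threshold from y to y + dy matters only if
nothing has arrived, which has probability e^{-(y-a)}: an arrival replaces `cost l y` by `fullCost l
y + v`, and waiting costs the slope `y - l`. The sum of these effects is `marginal`. -/
lemma waitCost_eq (l v : ℝ) {a y : ℝ} (h : a ≤ y) :
    waitCost l v a y =
      cost l a + Real.exp a * ∫ t in a..y, Real.exp (-t) * marginal l v t := by
  rw [waitCost, (integral_expMeasure_split (sub_nonneg.2 h) (by fun_prop) _).2]
  -- The boundary term is written as the integral of the derivative of e^{-t} `cost l (a + t)`, so
  -- that it merges with the integral over arrivals.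
  have h₁ : cost l y * Real.exp (-(y - a)) - cost l a =
      ∫ t in (0 : ℝ)..(y - a), Real.exp (-t) * ((a + t - l) - cost l (a + t)) := by
    rw [intervalIntegral.integral_eq_sub_of_hasDerivAt
      (f := fun t => Real.exp (-t) * cost l (a + t))]
    · simp
      ring
    · intro t _
      have h₂ : HasDerivAt (fun t => Real.exp (-t)) (-Real.exp (-t)) t := by
        simpa using (hasDerivAt_neg t).exp
      have h₃ : HasDerivAt (fun t => cost l (a + t)) (a + t - l) t := by
        unfold cost
        have := (((hasDerivAt_id t).const_add a).pow 2).const_mul (1 / 2 : ℝ)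
        convert! this.sub (((hasDerivAt_id t).const_add a).const_mul l) using 1
        simp
      convert! h₂.mul h₃ using 1
      ring
    · exact (by fun_prop : Continuous fun t => Real.exp (-t) *
        ((a + t - l) - cost l (a + t))).intervalIntegrable _ _
  have h₂ : Real.exp a * ∫ t in a..y, Real.exp (-t) * marginal l v t =
      ∫ t in (0 : ℝ)..(y - a), Real.exp (-t) * marginal l v (a + t) := by
    have := intervalIntegral.integral_comp_add_left (a := 0) (b := y - a)
      (fun t => Real.exp (-t) * marginal l v t) a
    rw [add_zero, add_sub_cancel] at this
    rw [← this, ← intervalIntegral.integral_const_mul]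
    refine intervalIntegral.integral_congr fun t _ => ?_
    simp only [neg_add, Real.exp_add]
    rw [← mul_assoc, ← mul_assoc, ← Real.exp_add, add_neg_cancel, Real.exp_zero, one_mul]
  have h₃ : cost l y * Real.exp (-(y - a)) = cost l a +
      ∫ t in (0 : ℝ)..(y - a), Real.exp (-t) * ((a + t - l) - cost l (a + t)) := by linarith
  rw [h₂, h₃, add_left_comm, ← intervalIntegral.integral_add]
  · congr 1
    refine intervalIntegral.integral_congr fun t _ => ?_
    simp only [marginal]
    ring
  · exact (by fun_prop : Continuous fun t => Real.exp (-t) *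
      (fullCost l (a + t) + v)).intervalIntegrable _ _
  · exact (by fun_prop : Continuous fun t => Real.exp (-t) *
      ((a + t - l) - cost l (a + t))).intervalIntegrable _ _

/-- The discounted marginal cost accumulated between the thresholds `a` and `y`. -/
noncomputable def excess (l v a y : ℝ) : ℝ := ∫ t in a..y, Real.exp (-t) * marginal l v t

lemma intervalIntegrable_excess (l v a y : ℝ) :
    IntervalIntegrable (fun t => Real.exp (-t) * marginal l v t) volume a y :=
  (by fun_prop : Continuous fun t => Real.exp (-t) * marginal l v t).intervalIntegrable _ _

lemma excess_add (l v a b c : ℝ) : excess l v a b + excess l v b c = excess l v a c :=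
  intervalIntegral.integral_add_adjacent_intervals (intervalIntegrable_excess _ _ _ _)
    (intervalIntegrable_excess _ _ _ _)

/-! ### Sign of the accumulated marginal cost -/

section Sign

variable {l x : ℝ}

/-- For `v = l - x` the marginal cost is `t - x` when `t ≥ l`, and it is at most `t - x` when `t ≤
l`. It is thus negative before `x` and positive after it. -/
lemma excess_pos_of_gt (hlx : l ≤ x) {m y : ℝ} (hm : x ≤ m) (hy : m < y) :
    0 < excess l (l - x) m y := by
  refine intervalIntegral.intervalIntegral_pos_of_pos_on (intervalIntegrable_excess _ _ _ _)
    (fun t ht => ?_) hy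
  rw [marginal_of_ge (by linarith [ht.1])]
  exact mul_pos (Real.exp_pos _) (by linarith [ht.1])

lemma excess_pos_of_lt {y : ℝ} (hy : y < x) : 0 < excess l (l - x) x y := by
  rw [excess, intervalIntegral.integral_symm, ← intervalIntegral.integral_neg]
  refine intervalIntegral.intervalIntegral_pos_of_pos_on (intervalIntegrable_excess _ _ _ _).neg
    (fun t ht => ?_) hy
  rw [← mul_neg]
  refine mul_pos (Real.exp_pos _) ?_
  rcases le_total t l with h | h
  · rw [marginal_of_le h]
    nlinarith [ht.2, sq_nonneg (l - t)]
  · rw [marginal_of_ge h]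
    linarith [ht.2]

/-- The constraint `a ≤ y` clips the best threshold `x` to `max a x`; every other admissible
threshold is strictly worse. -/
lemma excess_max_pos (hlx : l ≤ x) {a y : ℝ} (hay : a ≤ y) (hne : y ≠ max a x) :
    0 < excess l (l - x) (max a x) y := by
  rcases lt_or_gt_of_ne hne with h | h
  · rcases lt_max_iff.1 h with h' | h'
    · linarith
    · rw [max_eq_right (hay.trans h'.le)]
      exact excess_pos_of_lt h'
  · exact excess_pos_of_gt hlx (le_max_right _ _) h

lemma excess_self (v a : ℝ) : excess l v a a = 0 := intervalIntegral.integral_same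

lemma excess_max_nonneg (hlx : l ≤ x) {a y : ℝ} (hay : a ≤ y) :
    0 ≤ excess l (l - x) (max a x) y := by
  by_cases h : y = max a x
  · rw [h, excess_self]
  · exact (excess_max_pos hlx hay h).le

end Sign

/-! ### Closed forms of the accumulated marginal cost -/

lemma excess_of_ge {l v a y : ℝ} (ha : l ≤ a) (hy : l ≤ y) :
    excess l v a y = Real.exp (-a) * (a - l + v + 1) - Real.exp (-y) * (y - l + v + 1) := by
  have h : ∀ t ∈ Set.uIcc a y, Real.exp (-t) * marginal l v t = Real.exp (-t) * (t - l + v) := by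
    intro t ht
    rw [marginal_of_ge ((le_min ha hy).trans ht.1)]
  rw [excess, intervalIntegral.integral_congr h, intervalIntegral.integral_eq_sub_of_hasDerivAt
    (f := fun t => -(Real.exp (-t) * (t - l + v + 1)))]
  · ring
  · intro t _
    have h₂ : HasDerivAt (fun t => Real.exp (-t)) (-Real.exp (-t)) t := by
      simpa using (hasDerivAt_neg t).exp
    convert! (h₂.mul ((((hasDerivAt_id t).sub_const l).add_const v).add_const 1)).neg using 1
    simp
    ring
  · exact (by fun_prop : Continuous fun t => Real.exp (-t) * (t - l + v)).intervalIntegrable _ _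

lemma excess_of_le {l v a : ℝ} (ha : a ≤ l) :
    excess l v a l = Real.exp (-a) * (v - (1 / 2) * (l - a) ^ 2) + Real.exp (-l) * (-v) := by
  have h : ∀ t ∈ Set.uIcc a l, Real.exp (-t) * marginal l v t =
      Real.exp (-t) * (t - l + v - (1 / 2) * (l - t) ^ 2) := by
    intro t ht
    rw [Set.uIcc_of_le ha] at ht
    rw [marginal_of_le ht.2]
  rw [excess, intervalIntegral.integral_congr h, intervalIntegral.integral_eq_sub_of_hasDerivAt
    (f := fun t => -(Real.exp (-t) * (v - (1 / 2) * (l - t) ^ 2)))]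
  · simp
    ring
  · intro t _
    have h₂ : HasDerivAt (fun t => Real.exp (-t)) (-Real.exp (-t)) t := by
      simpa using (hasDerivAt_neg t).exp
    convert! (h₂.mul ((((hasDerivAt_id t).const_sub l).pow 2).const_mul (1 / 2 : ℝ) |>.const_sub
      v)).neg using 1
    simp
    ring
  · exact (by fun_prop : Continuous fun t => Real.exp (-t) *
      (t - l + v - (1 / 2) * (l - t) ^ 2)).intervalIntegrable _ _

lemma excess_zero_of_ge {l v y : ℝ} (hl : 0 ≤ l) (hy : l ≤ y) :
    excess l v 0 y = v + expGap l - Real.exp (-y) * (y - l + v + 1) := by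
  rw [← excess_add l v 0 l y, excess_of_le hl, excess_of_ge le_rfl hy, expGap]
  simp
  ring

/-! ### The optimal value -/

lemma exp_neg_lowThreshold {l : ℝ} (hG : 0 < expGap l) :
    Real.exp (-lowThreshold l) = expGap l := by
  rw [lowThreshold, one_div, Real.log_inv, neg_neg, Real.exp_log hG]

lemma expGap_le {l : ℝ} : expGap l ≤ Real.exp (-l) := by
  unfold expGap
  nlinarith [sq_nonneg l]

lemma le_lowThreshold {l : ℝ} (hG : 0 < expGap l) : l ≤ lowThreshold l := by
  have h := exp_neg_lowThreshold hG ▸ expGap_le (l := l)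
  linarith [Real.exp_le_exp.1 h]

lemma lt_lowThreshold {l : ℝ} (hl : 0 < l) (hG : 0 < expGap l) : l < lowThreshold l := by
  have h : expGap l < Real.exp (-l) := by
    unfold expGap
    nlinarith [mul_pos hl hl]
  rw [← exp_neg_lowThreshold hG] at h
  linarith [Real.exp_lt_exp.1 h]

/-- The consistency equation of the problem: with `v = l - x`, the condition that the integral from
0 to `x` equals `v` reduces to e^{-x} = `expGap l`. It makes `v` the value of leaving one unit when
`x` is used. -/
lemma excess_lowThreshold {l : ℝ} (hl : 0 ≤ l) (hG : 0 < expGap l) :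
    excess l (l - lowThreshold l) 0 (lowThreshold l) = l - lowThreshold l := by
  rw [excess_zero_of_ge hl (le_lowThreshold hG), exp_neg_lowThreshold hG]
  ring

lemma continuous_excess_left (l v y : ℝ) : Continuous fun t => excess l v t y := by
  have h := intervalIntegral.continuous_primitive (μ := volume)
    (fun a b => intervalIntegrable_excess l v a b) y
  have e : (fun t => excess l v t y) = fun t => -∫ s in y..t, Real.exp (-s) * marginal l v s := by
    ext t
    rw [excess, intervalIntegral.integral_symm]
  rw [e]
  exact h.neg

lemma hasDerivAt_exp_neg (t : ℝ) : HasDerivAt (fun t => Real.exp (-t)) (-Real.exp (-t)) t := by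
  simpa using (hasDerivAt_neg t).exp

lemma integral_excess {l x : ℝ} (hl : 0 ≤ l) (hx : l ≤ x) :
    ∫ t in (0 : ℝ)..x, excess l (l - x) t x =
      2 * l - 1 - (1 / 2) * l ^ 2 - x + (l + 3) * Real.exp (-l) - (x + 2) * Real.exp (-x) := by
  have hcont := continuous_excess_left l (l - x) x
  rw [← intervalIntegral.integral_add_adjacent_intervals (hcont.intervalIntegrable 0 l)
    (hcont.intervalIntegrable l x)]
  have h₁ : ∀ t ∈ Set.uIcc 0 l, excess l (l - x) t x =
      Real.exp (-t) * (l - x - (1 / 2) * (l - t) ^ 2) + (Real.exp (-l) - Real.exp (-x)) := by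
    intro t ht
    rw [Set.uIcc_of_le hl] at ht
    rw [← excess_add l (l - x) t l x, excess_of_le ht.2, excess_of_ge le_rfl hx]
    ring
  have h₂ : ∀ t ∈ Set.uIcc l x, excess l (l - x) t x =
      Real.exp (-t) * (t - x + 1) - Real.exp (-x) := by
    intro t ht
    rw [Set.uIcc_of_le hx] at ht
    rw [excess_of_ge ht.1 hx]
    ring
  rw [intervalIntegral.integral_congr h₁, intervalIntegral.integral_congr h₂,
    -- For a polynomial p, an antiderivative of e^{-t} p is -e^{-t}(p + p' + p'' + …); here p is
    -- quadratic, and in the next use it is linear.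
    intervalIntegral.integral_eq_sub_of_hasDerivAt (f := fun t =>
      -(Real.exp (-t) * (l - x - (1 / 2) * (l - t) ^ 2 + (l - t) - 1)) +
        t * (Real.exp (-l) - Real.exp (-x))),
    intervalIntegral.integral_eq_sub_of_hasDerivAt (f := fun t =>
      -(Real.exp (-t) * (t - x + 2)) - t * Real.exp (-x))]
  · simp
    ring
  · intro t _
    convert! ((hasDerivAt_exp_neg t).mul (((hasDerivAt_id t).sub_const x).add_const 2)).neg.sub
      ((hasDerivAt_id t).mul_const (Real.exp (-x))) using 1
    simp
    ring
  · exact (by fun_prop : Continuous fun t =>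
      Real.exp (-t) * (t - x + 1) - Real.exp (-x)).intervalIntegrable _ _
  · intro t _
    have h₃ := (hasDerivAt_id t).const_sub l
    convert! ((hasDerivAt_exp_neg t).mul (((((h₃.pow 2).const_mul (1 / 2 : ℝ)).const_sub
      (l - x)).add h₃).sub_const 1)).neg.add
      ((hasDerivAt_id t).mul_const (Real.exp (-l) - Real.exp (-x))) using 1
    simp
    ring
  · exact (by fun_prop : Continuous fun t => Real.exp (-t) * (l - x - (1 / 2) * (l - t) ^ 2) +
      (Real.exp (-l) - Real.exp (-x))).intervalIntegrable _ _

lemma integral_cost (l : ℝ) :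
    Integrable (cost l) (expMeasure 1) ∧ ∫ t, cost l t ∂(expMeasure 1) = 1 - l := by
  have i₂ := (integrable_pow_expMeasure 2).const_mul (1 / 2 : ℝ)
  have i₁ := (integrable_pow_expMeasure 1).const_mul l
  have e₂ := integral_pow_expMeasure 2
  have e₁ := integral_pow_expMeasure 1
  simp only [pow_one] at i₁ e₁
  refine ⟨i₂.sub i₁, ?_⟩
  simp only [cost]
  rw [integral_sub i₂ i₁, integral_const_mul, integral_const_mul, e₁, e₂]
  norm_num

lemma waitCost_max (l v x a : ℝ) :
    waitCost l v a (max a x) = cost l a + if a ≤ x then Real.exp a * excess l v a x else 0 := by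
  rw [waitCost_eq l v (le_max_left a x)]
  split_ifs with h
  · rw [max_eq_right h]
    rfl
  · rw [max_eq_left (not_le.1 h).le]
    simp

/-- The density e^{-t} of the first arrival cancels the factor e^t of `waitCost_eq`, which leaves
the mean cost `1 - l` plus a plain integral of `excess` over `[0, x]`. -/
lemma integral_waitCost {l : ℝ} (hl : 0 ≤ l) (hG : 0 < expGap l) :
    ∫ t, waitCost l (l - lowThreshold l) t (max t (lowThreshold l)) ∂(expMeasure 1) =
      p₂Formula l := by
  have hx := le_lowThreshold hG
  have hE := exp_neg_lowThreshold hG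
  have hform : p₂Formula l = (1 / 2) * l ^ 2 + (l + 1) * Real.exp (-l) + l -
    (expGap l + 1) * lowThreshold l := rfl
  rw [hform]
  set x := lowThreshold l
  have hs := integral_expMeasure_split (hl.trans hx)
    (g := fun t => Real.exp t * excess l (l - x) t x)
    (Real.continuous_exp.mul (continuous_excess_left _ _ _)) 0
  simp_rw [waitCost_max]
  rw [integral_add (integral_cost l).1 hs.1, (integral_cost l).2, hs.2]
  have : ∀ t ∈ Set.uIcc 0 x, Real.exp (-t) * (Real.exp t * excess l (l - x) t x) =
      excess l (l - x) t x := by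
    intro t _
    rw [← mul_assoc, ← Real.exp_add, neg_add_cancel, Real.exp_zero, one_mul]
  rw [intervalIntegral.integral_congr this, integral_excess hl hx, hE]
  unfold expGap
  ring

/-! ### The law of two inter-arrival times and quadratic bounds -/

/-- The joint law of the first two inter-arrival times. -/
noncomputable def pairLaw : Measure (ℝ × ℝ) := (expMeasure 1).prod (expMeasure 1)

instance : IsProbabilityMeasure pairLaw := by unfold pairLaw; infer_instance

lemma measurePreserving_pairLaw :
    MeasurePreserving (fun b : ℕ → ℝ => (b 0, b 1)) seqLaw pairLaw :=
  ⟨by fun_prop, Measure.infinitePi_map_eval_prod zero_ne_one⟩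

lemma ae_pos_pairLaw : ∀ᵐ p ∂pairLaw, 0 < p.1 ∧ 0 < p.2 :=
  (Measure.quasiMeasurePreserving_fst.ae ae_pos_expMeasure).and
    (Measure.quasiMeasurePreserving_snd.ae ae_pos_expMeasure)

lemma integrable_sq_pairLaw (c : ℝ) :
    Integrable (fun p : ℝ × ℝ => 3 * (p.1 ^ 2 + p.2 ^ 2 + c ^ 2)) pairLaw :=
  ((((integrable_pow_expMeasure 2).comp_fst _).add
    ((integrable_pow_expMeasure 2).comp_snd _)).add (integrable_const (c ^ 2))).const_mul 3

lemma add_sq_le (a b c : ℝ) : (a + b + c) ^ 2 ≤ 3 * (a ^ 2 + b ^ 2 + c ^ 2) := by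
  nlinarith [sq_nonneg (a - b), sq_nonneg (a - c), sq_nonneg (b - c)]

lemma abs_cost_le {l y z : ℝ} (hy : 0 ≤ y) (hz : y ≤ z) : |cost l y| ≤ z ^ 2 + l ^ 2 := by
  have : y ^ 2 ≤ z ^ 2 := pow_le_pow_left₀ hy hz 2
  rw [cost, abs_le]
  constructor <;> nlinarith [sq_nonneg (y - l), sq_nonneg (y + l)]

namespace RenewalPolicy

variable (π : RenewalPolicy)

/-! ### The parametrized objective -/

lemma measurable_delay_pair (k : Fin 2) : Measurable fun p : ℝ × ℝ => π.delay k p.1 p.2 :=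
  π.measurable_delay.comp (g := fun q : Fin 2 × ℝ × ℝ => π.delay q.1 q.2.1 q.2.2)
    (measurable_const.prodMk measurable_id)

lemma stepMean_eq_lintegral_pairLaw (k : Fin 2) {f : ℝ → ℝ≥0∞} (hf : Measurable f) :
    π.stepMean k (fun d _ => f d) = ∫⁻ p, f (π.delay k p.1 p.2) ∂pairLaw := by
  have h := measurePreserving_pairLaw.lintegral_comp (hf.comp (π.measurable_delay_pair k))
  exact h

lemma delay_nonneg (k : Fin 2) {t₁ t₂ : ℝ} (h₁ : 0 < t₁) (h₂ : 0 < t₂) :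
    0 ≤ π.delay k t₁ t₂ :=
  π.seqDelay_nonneg k (b := seqCons t₁ fun _ => t₂) fun i => by cases i <;> simp [h₁, h₂]

lemma uniformlyBounded_of_delay_le {c : ℝ}
    (h : ∀ k t₁ t₂, 0 < t₁ → 0 < t₂ → π.delay k t₁ t₂ ≤ t₁ + t₂ + c) :
    π.UniformlyBounded seqLaw coord := by
  refine π.uniformlyBounded_of_stepMean_ne_top fun k => ?_
  rw [π.stepMean_eq_lintegral_pairLaw k (f := fun d => ENNReal.ofReal (d ^ 2)) (by fun_prop)]
  have hi := (integrable_sq_pairLaw c).lintegral_lt_top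
  refine ne_top_of_le_ne_top hi.ne (lintegral_mono_ae ?_)
  filter_upwards [ae_pos_pairLaw] with p hp
  exact ENNReal.ofReal_le_ofReal ((pow_le_pow_left₀ (π.delay_nonneg k hp.1 hp.2)
    (h k p.1 p.2 hp.1 hp.2) 2).trans (add_sq_le _ _ _))

lemma integrable_delay_sq {k : Fin 2}
    (h : π.stepMean k (fun d _ => ENNReal.ofReal (d ^ 2)) ≠ ∞) :
    Integrable (fun p : ℝ × ℝ => π.delay k p.1 p.2 ^ 2) pairLaw := by
  rw [π.stepMean_eq_lintegral_pairLaw k (f := fun d => ENNReal.ofReal (d ^ 2)) (by fun_prop)] at h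
  refine (lintegral_ofReal_ne_top_iff_integrable
    ((π.measurable_delay_pair k).pow_const 2).aestronglyMeasurable
    (ae_of_all _ fun p => sq_nonneg _)).1 h

lemma integrable_delay {k : Fin 2}
    (h : π.stepMean k (fun d _ => ENNReal.ofReal (d ^ 2)) ≠ ∞) :
    Integrable (fun p : ℝ × ℝ => π.delay k p.1 p.2) pairLaw := by
  refine ((integrable_const (1 : ℝ)).add (π.integrable_delay_sq h)).mono'
    (π.measurable_delay_pair k).aestronglyMeasurable (ae_of_all _ fun p => ?_)
  rw [Real.norm_eq_abs, abs_le, Pi.add_apply]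
  constructor <;> nlinarith [sq_nonneg (π.delay k p.1 p.2 - 1), sq_nonneg (π.delay k p.1 p.2 + 1)]

lemma integrable_cost_delay (l : ℝ) {k : Fin 2}
    (h : π.stepMean k (fun d _ => ENNReal.ofReal (d ^ 2)) ≠ ∞) :
    Integrable (fun p : ℝ × ℝ => cost l (π.delay k p.1 p.2)) pairLaw :=
  ((π.integrable_delay_sq h).const_mul (1 / 2)).sub ((π.integrable_delay h).const_mul l)

/-- The expected cost of the delay after an update that leaves `k` units. -/
noncomputable def meanCost (l : ℝ) (k : Fin 2) : ℝ :=
  ∫ p, cost l (π.delay k p.1 p.2) ∂pairLaw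

lemma toReal_stepMean_sub (l : ℝ) {k : Fin 2}
    (h : π.stepMean k (fun d _ => ENNReal.ofReal (d ^ 2)) ≠ ∞) :
    (π.stepMean k fun d _ => delayArea d).toReal -
      l * (π.stepMean k fun d _ => ENNReal.ofReal d).toReal = π.meanCost l k := by
  rw [π.stepMean_eq_lintegral_pairLaw k measurable_delayArea,
    π.stepMean_eq_lintegral_pairLaw k ENNReal.measurable_ofReal]
  simp only [delayArea]
  rw [← integral_eq_lintegral_of_nonneg_ae (ae_of_all _ fun p => by positivity)
      ((π.integrable_delay_sq h).const_mul (1 / 2)).aestronglyMeasurable,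
    ← integral_eq_lintegral_of_nonneg_ae (f := fun p : ℝ × ℝ => π.delay k p.1 p.2) (by
      filter_upwards [ae_pos_pairLaw] with p hp using π.delay_nonneg k hp.1 hp.2)
      (π.integrable_delay h).aestronglyMeasurable,
    ← integral_const_mul l, ← integral_sub ((π.integrable_delay_sq h).const_mul (1 / 2))
      ((π.integrable_delay h).const_mul l)]
  rfl

lemma stepMean_zero_sq_ne_top (h : π.UniformlyBounded seqLaw coord) :
    π.stepMean 0 (fun d _ => ENNReal.ofReal (d ^ 2)) ≠ ∞ :=
  ne_top_of_le_ne_top (π.epochMean_sq_ne_top h) le_self_add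

lemma stepMean_one_sq_ne_top (h : π.UniformlyBounded seqLaw coord) (hq : π.refill ≠ 0) :
    π.stepMean 1 (fun d _ => ENNReal.ofReal (d ^ 2)) ≠ ∞ := by
  intro h₁
  have h₂ : π.refill * π.drain⁻¹ * π.stepMean 1 (fun d _ => ENNReal.ofReal (d ^ 2)) ≠ ∞ :=
    ne_top_of_le_ne_top (π.epochMean_sq_ne_top h) le_add_self
  rw [h₁, ENNReal.mul_top (by simp [hq, π.drain_ne_top])] at h₂
  exact h₂ rfl

lemma epochMean_toReal (h : π.UniformlyBounded seqLaw coord) (l : ℝ) :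
    (π.epochMean delayArea).toReal - l * (π.epochMean ENNReal.ofReal).toReal =
      π.meanCost l 0 + π.refill.toReal * (Real.exp π.x₁ * π.meanCost l 1) := by
  have hA := π.epochMean_delayArea_ne_top h
  have hL := π.epochMean_ofReal_ne_top h
  rw [epochMean, ENNReal.add_ne_top] at hA hL
  rw [epochMean, epochMean, ENNReal.toReal_add hA.1 hA.2, ENNReal.toReal_add hL.1 hL.2,
    ← π.toReal_stepMean_sub l (π.stepMean_zero_sq_ne_top h)]
  have hd : π.drain⁻¹.toReal = Real.exp π.x₁ := by
    rw [drain_eq, ENNReal.toReal_inv, ENNReal.toReal_ofReal (Real.exp_pos _).le, Real.exp_neg,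
      inv_inv]
  simp only [ENNReal.toReal_mul, hd]
  -- With `refill = 0` the delay from one unit need not have a second moment, but all its
  -- contributions are multiplied by 0.
  by_cases hq : π.refill = 0
  · simp [hq]
  · rw [← π.toReal_stepMean_sub l (π.stepMean_one_sq_ne_top h hq)]
    ring

lemma objective_eq {Ω : Type*} [MeasurableSpace Ω] {P : Measure Ω} {τ : ℕ → Ω → ℝ}
    (hτ : MeasurePreserving (fun ω i => τ i ω) P seqLaw)
    (h : π.UniformlyBounded seqLaw coord) (l : ℝ) :
    π.objective P τ l =
      π.meanCost l 0 + π.refill.toReal * (Real.exp π.x₁ * π.meanCost l 1) := by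
  rw [objective, π.meanArea_eq_epochMean hτ, π.meanLength_eq_epochMean hτ, π.epochMean_toReal h]

/-- The event, in terms of the next two inter-arrival times, that the update after one which leaves
the battery empty leaves one unit. -/
def refillSet : Set (ℝ × ℝ) := {p | p.2 ≤ π.y₁ p.1 - p.1}

lemma measurableSet_refillSet : MeasurableSet π.refillSet := by
  have := π.measurable_y₁
  exact measurableSet_le (by fun_prop) (by fun_prop)

lemma refill_eq : π.refill = pairLaw π.refillSet := by
  rw [← lintegral_indicator_one π.measurableSet_refillSet,
    ← measurePreserving_pairLaw.lintegral_comp (measurable_one.indicator π.measurableSet_refillSet)]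
  refine lintegral_congr fun b => ?_
  by_cases h : b 1 ≤ π.y₁ (b 0) - b 0 <;>
    simp [seqRemaining, remaining, Set.indicator, refillSet, h]

/-! ### Comparison with the threshold policy, one unit left -/

/-- The expected cost lost by the choice of `y₂`. -/
noncomputable def fullGapOne (l : ℝ) : ℝ :=
  ∫ t, (if t ≤ π.x₁ then cost l (π.y₂ t) - fullCost l t else 0) ∂(expMeasure 1)

lemma cost_delay_one (l : ℝ) (p : ℝ × ℝ) : cost l (π.delay 1 p.1 p.2) =
    if p.1 ≤ π.x₁ then cost l (π.y₂ p.1) else cost l π.x₁ := by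
  by_cases h : p.1 ≤ π.x₁ <;> simp [delay, h]

lemma integrable_cost_one {l : ℝ}
    (h : π.stepMean 1 (fun d _ => ENNReal.ofReal (d ^ 2)) ≠ ∞) :
    Integrable (fun t => if t ≤ π.x₁ then cost l (π.y₂ t) else cost l π.x₁) (expMeasure 1) := by
  have h₁ := π.integrable_cost_delay l h
  simp only [cost_delay_one] at h₁
  exact Integrable.of_comp_fst (f := fun t => if t ≤ π.x₁ then cost l (π.y₂ t) else cost l π.x₁)
    h₁ (IsProbabilityMeasure.ne_zero _)

lemma meanCost_one_eq_integral (l : ℝ) :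
    π.meanCost l 1 = ∫ t, (if t ≤ π.x₁ then cost l (π.y₂ t) else cost l π.x₁) ∂(expMeasure 1) := by
  simp only [meanCost, cost_delay_one, pairLaw]
  rw [integral_fun_fst (f := fun t => if t ≤ π.x₁ then cost l (π.y₂ t) else cost l π.x₁)]
  simp

lemma integrable_fullGapOne {l : ℝ}
    (h : π.stepMean 1 (fun d _ => ENNReal.ofReal (d ^ 2)) ≠ ∞) :
    Integrable (fun t => if t ≤ π.x₁ then cost l (π.y₂ t) - fullCost l t else 0)
      (expMeasure 1) := by
  refine ((π.integrable_cost_one (l := l) h).sub (integral_expMeasure_split π.x₁_nonneg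
    (continuous_fullCost l) (cost l π.x₁)).1).congr (ae_of_all _ fun t => ?_)
  by_cases ht : t ≤ π.x₁ <;> simp [ht]

/-- This is `waitCost` from age 0 with the charge `v` per arrival, namely `v (1 - e^{-x₁})`, taken
out again. The free `v` is later set to `l - lowThreshold l`, and to 0 for the unbounded case. -/
lemma meanCost_one_eq {l : ℝ} (h : π.stepMean 1 (fun d _ => ENNReal.ofReal (d ^ 2)) ≠ ∞)
    (v : ℝ) : π.meanCost l 1 =
      π.fullGapOne l + (excess l v 0 π.x₁ - v + v * Real.exp (-π.x₁)) := by
  have i₁ := integral_expMeasure_split π.x₁_nonneg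
    (by fun_prop : Continuous fun t => fullCost l (0 + t) + v) (cost l π.x₁)
  have i₂ := integral_expMeasure_split π.x₁_nonneg (g := fun _ => 0) continuous_const v
  have hw := waitCost_eq l v π.x₁_nonneg
  rw [waitCost, sub_zero] at hw
  have hc : cost l 0 = 0 := by simp [cost]
  rw [hc, Real.exp_zero, one_mul, zero_add] at hw
  have h₂ := i₂.2
  simp only [mul_zero, intervalIntegral.integral_zero, zero_add] at h₂
  rw [meanCost_one_eq_integral, fullGapOne, excess, ← hw, ← h₂, ← sub_eq_zero]
  have e : ∀ t, (if t ≤ π.x₁ then cost l (π.y₂ t) else cost l π.x₁) =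
      (if t ≤ π.x₁ then cost l (π.y₂ t) - fullCost l t else 0) +
        ((if t ≤ π.x₁ then fullCost l (0 + t) + v else cost l π.x₁) - v +
          if t ≤ π.x₁ then 0 else v) := by
    intro t
    by_cases ht : t ≤ π.x₁ <;> simp [ht]
  simp_rw [e]
  have i₃ : Integrable (fun t => (if t ≤ π.x₁ then fullCost l (0 + t) + v else cost l π.x₁) - v)
      (expMeasure 1) := i₁.1.sub (integrable_const v)
  have i₄ : Integrable (fun t => (if t ≤ π.x₁ then fullCost l (0 + t) + v else cost l π.x₁) - v +
      if t ≤ π.x₁ then 0 else v) (expMeasure 1) := i₃.add i₂.1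
  rw [integral_add (π.integrable_fullGapOne h) i₄, integral_add i₃ i₂.1,
    integral_sub i₁.1 (integrable_const v)]
  simp

lemma ite_cost_sub_nonneg_one (l : ℝ) {t : ℝ} (ht : 0 < t) :
    0 ≤ if t ≤ π.x₁ then cost l (π.y₂ t) - fullCost l t else 0 := by
  split_ifs
  · exact sub_nonneg.2 (fullCost_le_cost (π.le_y₂ t ht.le))
  · exact le_rfl

lemma fullGapOne_nonneg (l : ℝ) : 0 ≤ π.fullGapOne l := by
  refine integral_nonneg_of_ae ?_
  filter_upwards [ae_pos_expMeasure] with t ht using π.ite_cost_sub_nonneg_one l ht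

/-! ### Comparison with the threshold policy, empty battery -/

/-- The expected cost lost by the choice of `y₂bar`. -/
noncomputable def fullGapZero (l : ℝ) : ℝ :=
  ∫ p : ℝ × ℝ, (if p.2 ≤ π.y₁ p.1 - p.1 then cost l (π.y₂bar p.1 p.2) - fullCost l (p.1 + p.2)
    else 0) ∂pairLaw

/-- This holds for every policy: `y₁` enters only when the second arrival comes after it, and it is
then smaller than `p.1 + p.2`. -/
lemma integrable_waitCost_pair {l : ℝ} (hl : 0 ≤ l) (v : ℝ) :
    Integrable (fun p : ℝ × ℝ => if p.2 ≤ π.y₁ p.1 - p.1 then fullCost l (p.1 + p.2) + v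
      else cost l (π.y₁ p.1)) pairLaw := by
  have hy := π.measurable_y₁
  have hm : Measurable fun p : ℝ × ℝ => if p.2 ≤ π.y₁ p.1 - p.1 then fullCost l (p.1 + p.2) + v
      else cost l (π.y₁ p.1) :=
    Measurable.ite π.measurableSet_refillSet
      (((continuous_fullCost l).measurable.comp (by fun_prop)).add_const v)
      ((continuous_cost l).measurable.comp (by fun_prop))
  refine ((integrable_sq_pairLaw l).add (integrable_const (l ^ 2 + |v|))).mono'
    hm.aestronglyMeasurable ?_
  filter_upwards [ae_pos_pairLaw] with p hp
  have h₁ := π.le_y₁ p.1 hp.1.le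
  have h₂ := add_sq_le p.1 p.2 l
  rw [Real.norm_eq_abs, Pi.add_apply]
  split_ifs with h
  · have h₃ := abs_cost_le (l := l) (y := max (p.1 + p.2) l) (z := p.1 + p.2 + l)
      ((add_pos hp.1 hp.2).le.trans (le_max_left _ _))
      (max_le (by linarith) (by linarith [hp.1, hp.2]))
    have h₄ := abs_add_le (fullCost l (p.1 + p.2)) v
    unfold fullCost at h₄ ⊢
    linarith
  · have h₃ := abs_cost_le (l := l) (y := π.y₁ p.1) (z := p.1 + p.2 + l) (hp.1.le.trans h₁)
      (by linarith)
    linarith [abs_nonneg v]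

lemma integrable_refill (v : ℝ) :
    Integrable (fun p : ℝ × ℝ => if p.2 ≤ π.y₁ p.1 - p.1 then v else 0) pairLaw :=
  (integrable_const v).indicator π.measurableSet_refillSet

lemma integral_refill (v : ℝ) :
    ∫ p : ℝ × ℝ, (if p.2 ≤ π.y₁ p.1 - p.1 then v else 0) ∂pairLaw = π.refill.toReal * v := by
  have := integral_indicator_const (μ := pairLaw) v π.measurableSet_refillSet
  rw [refill_eq]
  exact this

lemma integrable_fullGapZero {l : ℝ} (hl : 0 ≤ l) (h : π.UniformlyBounded seqLaw coord) :
    Integrable (fun p : ℝ × ℝ => if p.2 ≤ π.y₁ p.1 - p.1 then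
      cost l (π.y₂bar p.1 p.2) - fullCost l (p.1 + p.2) else 0) pairLaw := by
  refine ((π.integrable_cost_delay l (π.stepMean_zero_sq_ne_top h)).sub
    (π.integrable_waitCost_pair hl 0)).congr (ae_of_all _ fun p => ?_)
  by_cases hp : p.2 ≤ π.y₁ p.1 - p.1 <;> simp [delay, hp]

lemma integrable_waitCost {l : ℝ} (hl : 0 ≤ l) (v : ℝ) :
    Integrable (fun t => waitCost l v t (π.y₁ t)) (expMeasure 1) := by
  refine (π.integrable_waitCost_pair hl v).integral_prod_left.congr ?_
  filter_upwards [ae_pos_expMeasure] with t ht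
  rfl

/-- Charging `v` for each update that leaves one unit separates the choice of `y₂bar` from that of
`y₁`; the latter becomes a separate problem for each first arrival time. -/
lemma meanCost_zero_eq {l : ℝ} (hl : 0 ≤ l) (h : π.UniformlyBounded seqLaw coord) (v : ℝ) :
    π.meanCost l 0 + π.refill.toReal * v =
      π.fullGapZero l + ∫ t, waitCost l v t (π.y₁ t) ∂(expMeasure 1) := by
  have e : ∫ t, waitCost l v t (π.y₁ t) ∂(expMeasure 1) =
      ∫ p : ℝ × ℝ, (if p.2 ≤ π.y₁ p.1 - p.1 then fullCost l (p.1 + p.2) + v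
        else cost l (π.y₁ p.1)) ∂pairLaw :=
    (integral_prod _ (π.integrable_waitCost_pair hl v)).symm
  rw [e, ← integral_refill, meanCost, fullGapZero,
    ← integral_add (π.integrable_cost_delay l (π.stepMean_zero_sq_ne_top h))
      (π.integrable_refill v),
    ← integral_add (π.integrable_fullGapZero hl h) (π.integrable_waitCost_pair hl v)]
  refine integral_congr_ae (ae_of_all _ fun p => ?_)
  by_cases hp : p.2 ≤ π.y₁ p.1 - p.1
  · simp only [delay, hp, if_true]
    ring
  · simp [delay, hp]

lemma ite_cost_sub_nonneg_zero (l : ℝ) {p : ℝ × ℝ} (hp : 0 < p.1 ∧ 0 < p.2) :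
    0 ≤ if p.2 ≤ π.y₁ p.1 - p.1 then cost l (π.y₂bar p.1 p.2) - fullCost l (p.1 + p.2) else 0 := by
  split_ifs
  · exact sub_nonneg.2 (fullCost_le_cost (π.le_y₂bar _ _ hp.1.le hp.2.le))
  · exact le_rfl

lemma fullGapZero_nonneg (l : ℝ) : 0 ≤ π.fullGapZero l := by
  refine integral_nonneg_of_ae ?_
  filter_upwards [ae_pos_pairLaw] with p hp using π.ite_cost_sub_nonneg_zero l hp

lemma integrable_waitCost_max {l x : ℝ} (hl : 0 ≤ l) (hx : 0 ≤ x) (v : ℝ) :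
    Integrable (fun t => waitCost l v t (max t x)) (expMeasure 1) :=
  (threshold l x hx).integrable_waitCost hl v

/-- The expected cost lost by the choice of `y₁`, when the best threshold is `x`. -/
noncomputable def waitGap (l x : ℝ) : ℝ :=
  ∫ t, (waitCost l (l - x) t (π.y₁ t) - waitCost l (l - x) t (max t x)) ∂(expMeasure 1)

lemma waitCost_sub_waitCost_max {l x : ℝ} {t : ℝ} (ht : 0 < t) :
    waitCost l (l - x) t (π.y₁ t) - waitCost l (l - x) t (max t x) =
      Real.exp t * excess l (l - x) (max t x) (π.y₁ t) := by
  rw [waitCost_eq _ _ (π.le_y₁ t ht.le), waitCost_eq _ _ (le_max_left t x)]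
  have := excess_add l (l - x) t (max t x) (π.y₁ t)
  simp only [excess] at this ⊢
  rw [← this]
  ring

lemma waitCost_sub_nonneg {l x : ℝ} (hlx : l ≤ x) {t : ℝ} (ht : 0 < t) :
    0 ≤ waitCost l (l - x) t (π.y₁ t) - waitCost l (l - x) t (max t x) := by
  rw [π.waitCost_sub_waitCost_max ht]
  exact mul_nonneg (Real.exp_pos _).le (excess_max_nonneg hlx (π.le_y₁ t ht.le))

lemma waitGap_nonneg {l x : ℝ} (hlx : l ≤ x) : 0 ≤ π.waitGap l x := by
  refine integral_nonneg_of_ae ?_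
  filter_upwards [ae_pos_expMeasure] with t ht using π.waitCost_sub_nonneg hlx ht

/-! ### The objective and the optimal value -/

section Objective

variable {Ω : Type*} [MeasurableSpace Ω] {P : Measure Ω} {τ : ℕ → Ω → ℝ}

/-- The heart of the optimization. For the consistent `v = l - lowThreshold l`, the one-unit term
e^{x₁} m₁ is `v` plus two gaps, and the empty-battery term with charge `v` is the closed form plus
two gaps. Every gap is nonnegative. -/
lemma objective_eq_add {l : ℝ} (hτ : MeasurePreserving (fun ω i => τ i ω) P seqLaw)
    (h : π.UniformlyBounded seqLaw coord) (hl : 0 ≤ l) (hG : 0 < expGap l) :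
    π.objective P τ l = p₂Formula l + π.fullGapZero l + π.waitGap l (lowThreshold l) +
      π.refill.toReal * (Real.exp π.x₁ * (π.fullGapOne l +
        excess l (l - lowThreshold l) (lowThreshold l) π.x₁)) := by
  have hx := le_lowThreshold hG
  have h₀ := π.meanCost_zero_eq hl h (l - lowThreshold l)
  have hw : π.waitGap l (lowThreshold l) = _ :=
    integral_sub (π.integrable_waitCost hl _) (integrable_waitCost_max hl (hl.trans hx) _)
  rw [integral_waitCost hl hG] at hw
  rw [π.objective_eq hτ h]
  by_cases hq : π.refill = 0
  · simp only [hq, ENNReal.toReal_zero, zero_mul, add_zero] at h₀ ⊢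
    linarith
  · have h₁ := π.meanCost_one_eq (l := l) (π.stepMean_one_sq_ne_top h hq) (l - lowThreshold l)
    have h₂ := excess_add l (l - lowThreshold l) 0 (lowThreshold l) π.x₁
    rw [excess_lowThreshold hl hG] at h₂
    have h₃ : Real.exp π.x₁ * π.meanCost l 1 = Real.exp π.x₁ * (π.fullGapOne l +
        excess l (l - lowThreshold l) (lowThreshold l) π.x₁) + (l - lowThreshold l) := by
      have : Real.exp π.x₁ * Real.exp (-π.x₁) = 1 := by rw [← Real.exp_add]; simp
      rw [h₁, ← h₂]
      linear_combination (l - lowThreshold l) * this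
    rw [h₃]
    linarith

lemma p₂Formula_le_objective {l : ℝ} (hτ : MeasurePreserving (fun ω i => τ i ω) P seqLaw)
    (h : π.UniformlyBounded seqLaw coord) (hl : 0 ≤ l) (hG : 0 < expGap l) :
    p₂Formula l ≤ π.objective P τ l := by
  have hx := le_lowThreshold hG
  rw [π.objective_eq_add hτ h hl hG]
  have h₁ := π.fullGapZero_nonneg l
  have h₂ := π.waitGap_nonneg hx
  have h₃ := π.fullGapOne_nonneg l
  have h₄ : 0 ≤ excess l (l - lowThreshold l) (lowThreshold l) π.x₁ := by
    have := excess_max_nonneg hx π.x₁_nonneg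
    rwa [max_eq_right (hl.trans hx)] at this
  have := mul_nonneg (ENNReal.toReal_nonneg (a := π.refill))
    (mul_nonneg (Real.exp_pos π.x₁).le (add_nonneg h₃ h₄))
  linarith

lemma uniformlyBounded_threshold {l x : ℝ} (hl : 0 ≤ l) (hx : 0 ≤ x) :
    (threshold l x hx).UniformlyBounded seqLaw coord := by
  refine uniformlyBounded_of_delay_le _ (c := l + x) fun k t₁ t₂ h₁ h₂ => ?_
  unfold delay
  split_ifs
  · show max (t₁ + t₂) l ≤ _
    exact max_le (by linarith) (by linarith)
  · show max t₁ x ≤ _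
    exact max_le (by linarith) (by linarith)
  · show max t₁ l ≤ _
    exact max_le (by linarith) (by linarith)
  · show x ≤ _
    linarith

lemma objective_threshold {l : ℝ} (hτ : MeasurePreserving (fun ω i => τ i ω) P seqLaw)
    (hl : 0 ≤ l) (hG : 0 < expGap l) (hx : 0 ≤ lowThreshold l) :
    (threshold l (lowThreshold l) hx).objective P τ l = p₂Formula l := by
  rw [objective_eq_add _ hτ (uniformlyBounded_threshold hl hx) hl hG]
  have h₁ : (threshold l (lowThreshold l) hx).fullGapZero l = 0 := by
    simp [fullGapZero, threshold, fullCost]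
  have h₂ : (threshold l (lowThreshold l) hx).fullGapOne l = 0 := by
    simp [fullGapOne, threshold, fullCost]
  have h₃ : (threshold l (lowThreshold l) hx).waitGap l (lowThreshold l) = 0 := by
    simp [waitGap, threshold]
  rw [h₁, h₂, h₃]
  simp [threshold, excess_self]

end Objective

end RenewalPolicy

/-! ### Uniqueness of the minimizer -/

lemma not_ae_le_expMeasure {c : ℝ} (hc : 0 < c) : ¬ ∀ᵐ t ∂(expMeasure 1), c ≤ t := by
  intro h
  have h₁ : Set.Ioi (c / 2) ∈ ae (expMeasure 1) := by
    filter_upwards [h] with t ht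
    show c / 2 < t
    linarith
  rw [mem_ae_iff_prob_eq_one measurableSet_Ioi, expMeasure_Ioi (by positivity),
    ENNReal.ofReal_eq_one, Real.exp_eq_one_iff] at h₁
  linarith

lemma restrict_Ioi_ac_expMeasure : volume.restrict (Set.Ioi (0 : ℝ)) ≪ expMeasure 1 := by
  refine Measure.AbsolutelyContinuous.mk fun s hs h => ?_
  rw [Measure.restrict_apply hs]
  have := ae_of_ae_expMeasure (measure_eq_zero_iff_ae_notMem.1 h)
  rw [measure_eq_zero_iff_ae_notMem]
  filter_upwards [this] with t ht h₁ using ht h₁.2 h₁.1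

lemma ae_of_ae_pairLaw {q : ℝ × ℝ → Prop} (h : ∀ᵐ p ∂pairLaw, q p) :
    ∀ᵐ p : ℝ × ℝ, 0 < p.1 → 0 < p.2 → q p := by
  have h₁ : ∀ᵐ p ∂((volume.restrict (Set.Ioi (0 : ℝ))).prod (volume.restrict (Set.Ioi (0 : ℝ)))),
      q p := (restrict_Ioi_ac_expMeasure.prod restrict_Ioi_ac_expMeasure).ae_le h
  rw [Measure.prod_restrict, ae_restrict_iff' (measurableSet_Ioi.prod measurableSet_Ioi)] at h₁
  filter_upwards [h₁] with p hp h₂ h₃ using hp ⟨h₂, h₃⟩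

namespace RenewalPolicy

variable (π : RenewalPolicy)

/-- A first arrival at `t < c`, followed by a second one within `c - t`, has positive probability
and leaves one unit. -/
lemma refill_ne_zero {c : ℝ} (hc : 0 < c) (h : ∀ᵐ t ∂(expMeasure 1), π.y₁ t = max t c) :
    π.refill ≠ 0 := by
  intro h₀
  rw [refill_eq, measure_eq_zero_iff_ae_notMem] at h₀
  refine not_ae_le_expMeasure hc ?_
  filter_upwards [Measure.ae_ae_of_ae_prod h₀, h] with t h₁ h₂
  by_contra hlt
  rw [not_le] at hlt
  refine not_ae_le_expMeasure (sub_pos.2 hlt) ?_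
  filter_upwards [h₁] with s hs
  have hs : ¬ s ≤ π.y₁ t - t := hs
  rw [h₂, max_eq_right hlt.le] at hs
  exact (not_le.1 hs).le

lemma refill_toReal_pos (h : π.refill ≠ 0) : 0 < π.refill.toReal :=
  ENNReal.toReal_pos h (ne_top_of_le_ne_top ENNReal.one_ne_top π.refill_le_one)

section Objective

variable {Ω : Type*} [MeasurableSpace Ω] {P : Measure Ω} {τ : ℕ → Ω → ℝ}

/-- Equality makes every gap vanish, and a nonnegative integrand with integral 0 vanishes almost
everywhere. -/
lemma isThreshold_of_objective_eq {l : ℝ} (hτ : MeasurePreserving (fun ω i => τ i ω) P seqLaw)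
    (h : π.UniformlyBounded seqLaw coord) (hl : 0 < l) (hG : 0 < expGap l)
    (he : π.objective P τ l = p₂Formula l) : π.IsThreshold l (lowThreshold l) := by
  have hlx := lt_lowThreshold hl hG
  have hx := le_lowThreshold hG
  have hx0 : 0 < lowThreshold l := hl.trans hlx
  rw [π.objective_eq_add hτ h hl.le hG] at he
  have n₁ := π.fullGapZero_nonneg l
  have n₂ := π.waitGap_nonneg hx
  have n₃ := π.fullGapOne_nonneg l
  have n₄ : 0 ≤ excess l (l - lowThreshold l) (lowThreshold l) π.x₁ := by
    have := excess_max_nonneg hx π.x₁_nonneg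
    rwa [max_eq_right hx0.le] at this
  have n₅ := mul_nonneg (ENNReal.toReal_nonneg (a := π.refill))
    (mul_nonneg (Real.exp_pos π.x₁).le (add_nonneg n₃ n₄))
  have z₂ : π.waitGap l (lowThreshold l) = 0 := by linarith
  have z₁ : π.fullGapZero l = 0 := by linarith
  have z₅ : π.refill.toReal * (Real.exp π.x₁ * (π.fullGapOne l +
        excess l (l - lowThreshold l) (lowThreshold l) π.x₁)) = 0 := by linarith
  have hy₁ : ∀ᵐ t ∂(expMeasure 1), π.y₁ t = max t (lowThreshold l) := by
    have z := (integral_eq_zero_iff_of_nonneg_ae (by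
      filter_upwards [ae_pos_expMeasure] with t ht using π.waitCost_sub_nonneg hx ht)
      ((π.integrable_waitCost hl.le _).sub (integrable_waitCost_max hl.le hx0.le _))).1 z₂
    filter_upwards [z, ae_pos_expMeasure] with t ht h₀
    by_contra hne
    have h₁ := mul_pos (Real.exp_pos t) (excess_max_pos hx (π.le_y₁ t h₀.le) hne)
    rw [← π.waitCost_sub_waitCost_max h₀] at h₁
    exact h₁.ne' ht
  -- The gaps of `x₁` and `y₂` carry the factor `refill`; it is positive only because `y₁` is
  -- already known to be the threshold rule with positive threshold.
  have hq := π.refill_ne_zero hx0 hy₁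
  have hs := π.stepMean_one_sq_ne_top h hq
  rw [mul_eq_zero, mul_eq_zero, or_iff_right (π.refill_toReal_pos hq).ne',
    or_iff_right (Real.exp_pos _).ne'] at z₅
  have z₃ : π.fullGapOne l = 0 := by linarith
  have z₄ : excess l (l - lowThreshold l) (lowThreshold l) π.x₁ = 0 := by linarith
  have hx₁ : π.x₁ = lowThreshold l := by
    by_contra hne
    have := excess_max_pos hx π.x₁_nonneg (by rwa [max_eq_right hx0.le])
    rw [max_eq_right hx0.le] at this
    exact this.ne' z₄
  refine ⟨hx₁, ae_of_ae_expMeasure hy₁, ?_, ?_⟩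
  · have z := (integral_eq_zero_iff_of_nonneg_ae (by
      filter_upwards [ae_pos_expMeasure] with t ht using π.ite_cost_sub_nonneg_one l ht)
      (π.integrable_fullGapOne hs)).1 z₃
    filter_upwards [ae_of_ae_expMeasure z] with t ht h₀ h₁
    have := ht h₀
    simp only [hx₁, h₁.le, if_true, Pi.zero_apply] at this
    exact eq_max_of_cost_eq (π.le_y₂ t h₀.le) (sub_eq_zero.1 this)
  · have z := (integral_eq_zero_iff_of_nonneg_ae (by
      filter_upwards [ae_pos_pairLaw] with p hp using π.ite_cost_sub_nonneg_zero l hp)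
      (π.integrable_fullGapZero hl.le h)).1 z₁
    have hy₁' : ∀ᵐ p ∂pairLaw, π.y₁ p.1 = max p.1 (lowThreshold l) :=
      Measure.quasiMeasurePreserving_fst.ae hy₁
    filter_upwards [ae_of_ae_pairLaw (z.and hy₁')] with p hp h₁ h₂ h₃
    obtain ⟨h₄, h₅⟩ := hp h₁ h₂
    have h₆ : p.2 ≤ π.y₁ p.1 - p.1 := by
      rw [h₅]
      linarith [le_max_right p.1 (lowThreshold l)]
    simp only [h₆, if_true, Pi.zero_apply] at h₄
    exact eq_max_of_cost_eq (π.le_y₂bar _ _ h₁.le h₂.le) (sub_eq_zero.1 h₄)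

/-! ### The parametrized problem -/

/-- A policy that uses the threshold `x` after an update that leaves one unit only. -/
noncomputable def delayed (l x : ℝ) (hx : 0 ≤ x) : RenewalPolicy :=
  { threshold l x hx with
    y₁ := fun t => max t 1
    measurable_y₁ := by fun_prop
    le_y₁ := fun t _ => le_max_left t 1 }

lemma uniformlyBounded_delayed {l x : ℝ} (hl : 0 ≤ l) (hx : 0 ≤ x) :
    (delayed l x hx).UniformlyBounded seqLaw coord := by
  refine uniformlyBounded_of_delay_le _ (c := l + x + 1) fun k t₁ t₂ h₁ h₂ => ?_
  unfold delay
  split_ifs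
  · show max (t₁ + t₂) l ≤ _
    exact max_le (by linarith) (by linarith)
  · show max t₁ 1 ≤ _
    exact max_le (by linarith) (by linarith)
  · show max t₁ l ≤ _
    exact max_le (by linarith) (by linarith)
  · show x ≤ _
    linarith

/-- The choice of `y₁` does not involve `x`, so `refill` and the cost from the empty state are
fixed. The one-unit term is e^x `expGap l - (x - l + 1)`, which tends to -∞ when `expGap l ≤ 0`. -/
lemma objective_delayed_le {l x : ℝ} (hτ : MeasurePreserving (fun ω i => τ i ω) P seqLaw)
    (hl : 0 ≤ l) (hx : 0 ≤ x) (hlx : l ≤ x) (hG : expGap l ≤ 0) :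
    (delayed l x hx).objective P τ l ≤ (delayed l 0 le_rfl).meanCost l 0 -
      (delayed l 0 le_rfl).refill.toReal * (x - l + 1) := by
  have hub := uniformlyBounded_delayed hl hx
  have hq : (delayed l x hx).refill ≠ 0 :=
    refill_ne_zero _ one_pos (ae_of_all _ fun t => rfl)
  rw [objective_eq _ hτ hub, meanCost_one_eq _ (stepMean_one_sq_ne_top _ hub hq) 0]
  have e₁ : (delayed l x hx).fullGapOne l = 0 := by
    simp [fullGapOne, delayed, threshold, fullCost]
  have e₂ : (delayed l x hx).meanCost l 0 = (delayed l 0 le_rfl).meanCost l 0 := rfl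
  have e₃ : (delayed l x hx).refill = (delayed l 0 le_rfl).refill := rfl
  have e₄ : (delayed l x hx).x₁ = x := rfl
  rw [e₁, e₂, e₃, e₄, excess_zero_of_ge hl hlx]
  have h₁ : Real.exp x * (0 + (0 + expGap l - Real.exp (-x) * (x - l + 0 + 1) - 0 +
      0 * Real.exp (-x))) = Real.exp x * expGap l - (x - l + 1) := by
    have : Real.exp x * Real.exp (-x) = 1 := by rw [← Real.exp_add]; simp
    linear_combination -(x - l + 1) * this
  rw [h₁]
  have h₂ : Real.exp x * expGap l ≤ 0 :=
    mul_nonpos_of_nonneg_of_nonpos (Real.exp_pos x).le hG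
  have h₃ := mul_nonneg (ENNReal.toReal_nonneg (a := (delayed l 0 le_rfl).refill))
    (neg_nonneg.2 h₂)
  nlinarith

end Objective

end RenewalPolicy

section ParametrizedProblem

variable {Ω : Type*} [MeasurableSpace Ω] {P : Measure Ω} {τ : ℕ → Ω → ℝ}

open RenewalPolicy

lemma p₂_le {π : RenewalPolicy} (l : ℝ) (h : π.UniformlyBounded P τ) :
    p₂ P τ l ≤ ((π.objective P τ l : ℝ) : EReal) :=
  iInf₂_le (f := fun (π : RenewalPolicy) (_ : π.UniformlyBounded P τ) =>
    ((π.objective P τ l : ℝ) : EReal)) π h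

lemma p₂_eq_bot (hτ : MeasurePreserving (fun ω i => τ i ω) P seqLaw) {l : ℝ} (hl : 0 ≤ l)
    (hG : expGap l ≤ 0) : p₂ P τ l = ⊥ := by
  rw [EReal.eq_bot_iff_forall_lt]
  intro M
  set q := (delayed l 0 le_rfl).refill.toReal
  set j := (delayed l 0 le_rfl).meanCost l 0
  have hq : 0 < q := refill_toReal_pos _ (refill_ne_zero _ one_pos (ae_of_all _ fun t => rfl))
  -- Chosen so that `q * (x - l + 1)` exceeds `j - M`.
  set x := l + |j - M| / q
  have hlx : l ≤ x := le_add_of_nonneg_right (by positivity)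
  have hx : 0 ≤ x := hl.trans hlx
  have h := objective_delayed_le hτ hl hx hlx hG
  have h₁ : q * (x - l + 1) = |j - M| + q := by
    simp only [x]
    field_simp
    ring
  have h₂ : (delayed l x hx).objective P τ l < M := by
    have := le_abs_self (j - M)
    linarith
  exact lt_of_le_of_lt
    (p₂_le l ((uniformlyBounded_iff_coord _ hτ).2 (uniformlyBounded_delayed hl hx))) (EReal.coe_lt_coe_iff.2 h₂)

lemma p₂_eq_p₂Formula (hτ : MeasurePreserving (fun ω i => τ i ω) P seqLaw) {l : ℝ} (hl : 0 ≤ l)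
    (hG : 0 < expGap l) : p₂ P τ l = ((p₂Formula l : ℝ) : EReal) := by
  have hx := hl.trans (le_lowThreshold hG)
  refine le_antisymm ?_ (le_iInf₂ fun π hπ => ?_)
  · rw [← objective_threshold hτ hl hG hx]
    exact p₂_le l ((uniformlyBounded_iff_coord _ hτ).2 (uniformlyBounded_threshold hl hx))
  · exact EReal.coe_le_coe_iff.2
      (π.p₂Formula_le_objective hτ ((uniformlyBounded_iff_coord _ hτ).1 hπ) hl hG)

/-- Since lengths are nonnegative, the objective at a negative parameter is at least the one at 0,
whose infimum is `p₂Formula 0 = 1`. -/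
lemma p₂_pos_of_neg (hτ : MeasurePreserving (fun ω i => τ i ω) P seqLaw) {l : ℝ} (hl : l < 0) :
    0 < p₂ P τ l := by
  have hG : 0 < expGap 0 := by simp [expGap]
  refine lt_of_lt_of_le (b := ((1 : ℝ) : EReal)) (by simp) (le_iInf₂ fun π hπ => ?_)
  rw [EReal.coe_le_coe_iff]
  have h := π.p₂Formula_le_objective hτ ((uniformlyBounded_iff_coord _ hτ).1 hπ) le_rfl hG
  have h₁ : p₂Formula 0 = 1 := by simp [p₂Formula]
  rw [h₁] at h
  refine h.trans ?_
  unfold objective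
  have := mul_nonneg (neg_nonneg.2 hl.le) (ENNReal.toReal_nonneg (a := π.meanLength P τ))
  linarith

/-! ### The parametrized objective and the average age -/

namespace RenewalPolicy

variable (π : RenewalPolicy)

lemma meanLength_toReal_pos (hτ : MeasurePreserving (fun ω i => τ i ω) P seqLaw)
    (h : π.UniformlyBounded P τ) : 0 < (π.meanLength P τ).toReal := by
  rw [π.meanLength_eq_epochMean hτ]
  exact ENNReal.toReal_pos π.epochMean_ofReal_ne_zero
    (π.epochMean_ofReal_ne_top ((uniformlyBounded_iff_coord _ hτ).1 h))

lemma averageAge_eq (hτ : MeasurePreserving (fun ω i => τ i ω) P seqLaw)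
    (h : π.UniformlyBounded P τ) :
    π.averageAge P τ = π.meanArea P τ / π.meanLength P τ := by
  rw [π.averageAge_eq_coord hτ, π.meanLength_eq_epochMean hτ, π.meanArea_eq_epochMean hτ,
    π.averageAge_eq_epochMean_div ((uniformlyBounded_iff_coord _ hτ).1 h)]

lemma averageAge_eq_ofReal (hτ : MeasurePreserving (fun ω i => τ i ω) P seqLaw)
    (h : π.UniformlyBounded P τ) :
    π.averageAge P τ =
      ENNReal.ofReal ((π.meanArea P τ).toReal / (π.meanLength P τ).toReal) := by
  have h' := (uniformlyBounded_iff_coord _ hτ).1 h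
  rw [ENNReal.ofReal_div_of_pos (π.meanLength_toReal_pos hτ h), π.averageAge_eq hτ h,
    ENNReal.ofReal_toReal, ENNReal.ofReal_toReal]
  · rw [π.meanLength_eq_epochMean hτ]
    exact π.epochMean_ofReal_ne_top h'
  · rw [π.meanArea_eq_epochMean hτ]
    exact π.epochMean_delayArea_ne_top h'

lemma le_averageAge_iff (hτ : MeasurePreserving (fun ω i => τ i ω) P seqLaw)
    (h : π.UniformlyBounded P τ) (l : ℝ) :
    ENNReal.ofReal l ≤ π.averageAge P τ ↔ 0 ≤ π.objective P τ l := by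
  have hL := π.meanLength_toReal_pos hτ h
  rw [π.averageAge_eq_ofReal hτ h, ENNReal.ofReal_le_ofReal_iff (by positivity),
    le_div_iff₀ hL, objective, sub_nonneg]

lemma averageAge_eq_iff (hτ : MeasurePreserving (fun ω i => τ i ω) P seqLaw)
    (h : π.UniformlyBounded P τ) {l : ℝ} (hl : 0 ≤ l) :
    π.averageAge P τ = ENNReal.ofReal l ↔ π.objective P τ l = 0 := by
  have hL := π.meanLength_toReal_pos hτ h
  rw [π.averageAge_eq_ofReal hτ h, ENNReal.ofReal_eq_ofReal_iff (by positivity) hl,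
    div_eq_iff hL.ne', objective, sub_eq_zero]

end RenewalPolicy

/-- The threshold policy for `l` has objective 0 at `l`. Its objective is strictly decreasing in the
parameter, as 𝔼[L] > 0, so it would be negative at a larger `l'`, below the infimum 0 there. -/
lemma le_of_p₂Formula_eq_zero (hτ : MeasurePreserving (fun ω i => τ i ω) P seqLaw) {l l' : ℝ}
    (hl : 0 ≤ l) (hl' : 0 ≤ l') (hG : 0 < expGap l) (hG' : 0 < expGap l')
    (h : p₂Formula l = 0) (h' : p₂Formula l' = 0) : l' ≤ l := by
  by_contra hlt
  rw [not_le] at hlt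
  have hx := hl.trans (le_lowThreshold hG)
  have hub := uniformlyBounded_threshold hl hx
  have h₁ := objective_threshold hτ hl hG hx
  have h₂ := p₂Formula_le_objective _ hτ hub hl' hG'
  have hL := meanLength_toReal_pos _ hτ ((uniformlyBounded_iff_coord _ hτ).2 hub)
  rw [h] at h₁
  rw [h'] at h₂
  unfold objective at h₁ h₂
  nlinarith

end ParametrizedProblem

/-! ### Numerical values -/

/-- The constant is the factor 10/(9! · 9) in the remainder bound of `Real.exp_bound` with nine
terms. -/
lemma exp_neg_bounds {x : ℝ} (h0 : 0 ≤ x) (h1 : x ≤ 1) :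
    |Real.exp (-x) - (1 - x + x ^ 2 / 2 - x ^ 3 / 6 + x ^ 4 / 24 - x ^ 5 / 120 + x ^ 6 / 720 -
      x ^ 7 / 5040 + x ^ 8 / 40320)| ≤ x ^ 9 * (1 / 326592) := by
  have h := Real.exp_bound (x := -x) (by rwa [abs_neg, abs_of_nonneg h0]) (n := 9) (by norm_num)
  rw [abs_neg, abs_of_nonneg h0] at h
  norm_num [Finset.sum_range_succ, Nat.factorial] at h
  convert h using 3
  ring

lemma expGap_le_of_le {a b : ℝ} (ha : 0 ≤ a) (hab : a ≤ b) : expGap b ≤ expGap a := by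
  unfold expGap
  have := Real.exp_le_exp.2 (neg_le_neg hab)
  nlinarith

lemma lowThreshold_lt {l X : ℝ} (h : Real.exp (-X) < expGap l) : lowThreshold l < X := by
  rw [← exp_neg_lowThreshold ((Real.exp_pos _).trans h), Real.exp_lt_exp] at h
  linarith

lemma lt_lowThreshold_of_lt {l X : ℝ} (hG : 0 < expGap l) (h : expGap l < Real.exp (-X)) :
    X < lowThreshold l := by
  rw [← exp_neg_lowThreshold hG, Real.exp_lt_exp] at h
  linarith

/-- Thresholds near 1.48 lie outside the range `[0, 1]` of the Taylor bound, but their halves lie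
inside. -/
lemma exp_neg_two_mul (x : ℝ) : Real.exp (-(2 * x)) = Real.exp (-x) ^ 2 := by
  rw [← Real.exp_nat_mul]
  congr 1
  push_cast
  ring

lemma lt_exp_neg {x c : ℝ} (h0 : 0 ≤ x) (h1 : x ≤ 1)
    (h : c + x ^ 9 * (1 / 326592) < 1 - x + x ^ 2 / 2 - x ^ 3 / 6 + x ^ 4 / 24 - x ^ 5 / 120 +
      x ^ 6 / 720 - x ^ 7 / 5040 + x ^ 8 / 40320) : c < Real.exp (-x) := by
  linarith [(abs_le.1 (exp_neg_bounds h0 h1)).1]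

lemma exp_neg_lt {x c : ℝ} (h0 : 0 ≤ x) (h1 : x ≤ 1)
    (h : 1 - x + x ^ 2 / 2 - x ^ 3 / 6 + x ^ 4 / 24 - x ^ 5 / 120 + x ^ 6 / 720 - x ^ 7 / 5040 +
      x ^ 8 / 40320 + x ^ 9 * (1 / 326592) < c) : Real.exp (-x) < c := by
  linarith [(abs_le.1 (exp_neg_bounds h0 h1)).2]

lemma expGap_lt_left : expGap 0.7195 < 0.22817 := by
  have := exp_neg_lt (x := 0.7195) (c := 0.487) (by norm_num) (by norm_num) (by norm_num)
  unfold expGap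
  linarith

lemma lt_expGap_left : 0.22814 < expGap 0.7195 := by
  have := lt_exp_neg (x := 0.7195) (c := 0.48699) (by norm_num) (by norm_num) (by norm_num)
  unfold expGap
  linarith

lemma expGap_lt_right : expGap 0.72 < 0.22757 := by
  have := exp_neg_lt (x := 0.72) (c := 0.48676) (by norm_num) (by norm_num) (by norm_num)
  unfold expGap
  linarith

lemma lt_expGap_right : 0.22754 < expGap 0.72 := by
  have := lt_exp_neg (x := 0.72) (c := 0.48675) (by norm_num) (by norm_num) (by norm_num)
  unfold expGap
  linarith

lemma lt_exp_neg_two_mul {x c : ℝ} (hc : 0 ≤ c) (h : c < Real.exp (-x)) :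
    c ^ 2 < Real.exp (-(2 * x)) := by
  rw [exp_neg_two_mul]
  exact pow_lt_pow_left₀ h hc two_ne_zero

lemma exp_neg_two_mul_lt {x c : ℝ} (h : Real.exp (-x) < c) : Real.exp (-(2 * x)) < c ^ 2 := by
  rw [exp_neg_two_mul]
  exact pow_lt_pow_left₀ h (Real.exp_pos _).le two_ne_zero

lemma p₂Formula_eq (l : ℝ) : p₂Formula l = (1 / 2) * l ^ 2 + (l + 1) * (expGap l + (1 / 2) * l ^ 2) +
    l - (expGap l + 1) * lowThreshold l := by
  unfold p₂Formula lowThreshold expGap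
  ring

/-- The term with `lowThreshold` is subtracted, so an upper bound on it suffices: 0.4776² lies below
the lower bound for `expGap`. The right endpoint uses the opposite inequalities. -/
lemma p₂Formula_left_nonneg : 0 ≤ p₂Formula 0.7195 := by
  have h₁ := lt_expGap_left
  have h₂ := expGap_lt_left
  have h₃ : lowThreshold 0.7195 < 2 * 0.739 := lowThreshold_lt <|
    (exp_neg_two_mul_lt (c := 0.4776)
      (exp_neg_lt (by norm_num) (by norm_num) (by norm_num))).trans (lt_trans (by norm_num) h₁)
  have h₄ := mul_le_mul_of_nonneg_left h₃.le (by linarith : 0 ≤ expGap 0.7195 + 1)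
  rw [p₂Formula_eq]
  linarith

lemma p₂Formula_right_nonpos : p₂Formula 0.72 ≤ 0 := by
  have h₁ := lt_expGap_right
  have h₂ := expGap_lt_right
  have h₃ : 2 * 0.74 < lowThreshold 0.72 := lt_lowThreshold_of_lt (by linarith) <|
    (lt_trans h₂ (by norm_num)).trans (lt_exp_neg_two_mul (c := 0.4771) (by norm_num)
      (lt_exp_neg (by norm_num) (by norm_num) (by norm_num)))
  have h₄ := mul_le_mul_of_nonneg_left h₃.le (by linarith : 0 ≤ expGap 0.72 + 1)
  rw [p₂Formula_eq]
  linarith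

lemma continuous_expGap : Continuous expGap := by
  unfold expGap
  fun_prop

lemma exists_p₂Formula_eq_zero : ∃ l : ℝ, 0 < l ∧ 0 < expGap l ∧ p₂Formula l = 0 ∧
    |l - 0.72| < 0.005 ∧ |lowThreshold l - 1.48| < 0.005 := by
  -- `expGap` decreases, so its values at the endpoints bound it on the whole interval.
  have hanti {l : ℝ} (hl : l ∈ Set.Icc (0.7195 : ℝ) 0.72) :
      0.22754 < expGap l ∧ expGap l < 0.22817 := by
    refine ⟨lt_expGap_right.trans_le (expGap_le_of_le ?_ hl.2),
      (expGap_le_of_le ?_ hl.1).trans_lt expGap_lt_left⟩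
    · linarith [hl.1]
    · norm_num
  have hcont : ContinuousOn p₂Formula (Set.Icc 0.7195 0.72) := by
    have h₁ : ContinuousOn lowThreshold (Set.Icc 0.7195 0.72) := by
      have h₂ (l : ℝ) (hl : l ∈ Set.Icc (0.7195 : ℝ) 0.72) : expGap l ≠ 0 := by
        linarith [(hanti hl).1]
      exact (continuousOn_const.div continuous_expGap.continuousOn h₂).log
        fun l hl => one_div_ne_zero (h₂ l hl)
    have h₃ := continuous_expGap
    rw [funext p₂Formula_eq]
    fun_prop
  obtain ⟨l, hl, h₀⟩ := intermediate_value_Icc' (by norm_num) hcont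
    ⟨p₂Formula_right_nonpos, p₂Formula_left_nonneg⟩
  obtain ⟨h₁, h₂⟩ := hanti hl
  have hG : 0 < expGap l := by linarith
  -- The limits 2 · 0.7425 and 2 · 0.7375 are 1.48 ± 0.005.
  have h₃ : lowThreshold l < 2 * 0.7425 := lowThreshold_lt <|
    (exp_neg_two_mul_lt (c := 0.47593)
      (exp_neg_lt (by norm_num) (by norm_num) (by norm_num))).trans (lt_trans (by norm_num) h₁)
  have h₄ : 2 * 0.7375 < lowThreshold l := lt_lowThreshold_of_lt hG <|
    (lt_trans h₂ (by norm_num)).trans (lt_exp_neg_two_mul (c := 0.4783) (by norm_num)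
      (lt_exp_neg (by norm_num) (by norm_num) (by norm_num)))
  refine ⟨l, by linarith [hl.1], hG, h₀, abs_lt.2 ⟨?_, ?_⟩, abs_lt.2 ⟨?_, ?_⟩⟩ <;>
    linarith [hl.1, hl.2]

/-- Negative parameters have positive value and those with `expGap l' ≤ 0` have value -∞; for the
remaining ones the closed form applies, and the comparison of two zeros works in both directions. -/
lemma eq_of_p₂_eq_zero {Ω : Type*} [MeasurableSpace Ω] {P : Measure Ω} {τ : ℕ → Ω → ℝ}
    (hτ : MeasurePreserving (fun ω i => τ i ω) P seqLaw) {l l' : ℝ} (hl : 0 ≤ l)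
    (hG : 0 < expGap l) (h : p₂Formula l = 0) (h' : p₂ P τ l' = 0) : l' = l := by
  rcases lt_or_ge l' 0 with hl' | hl'
  · exact absurd h' (p₂_pos_of_neg hτ hl').ne'
  rcases le_or_gt (expGap l') 0 with hG' | hG'
  · rw [p₂_eq_bot hτ hl' hG'] at h'
    exact absurd h' (by simp)
  rw [p₂_eq_p₂Formula hτ hl' hG', EReal.coe_eq_zero] at h'
  exact le_antisymm (le_of_p₂Formula_eq_zero hτ hl hl' hG hG' h h')
    (le_of_p₂Formula_eq_zero hτ hl' hl hG' hG h' h)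

end AgeOfInformation

/-! ### The main theorem -/

open AgeOfInformation in
theorem mainTheorem3 {Ω : Type*} [MeasurableSpace Ω] (P : Measure Ω) [IsProbabilityMeasure P]
    (τ : ℕ → Ω → ℝ) (hmeas : ∀ i, Measurable (τ i))
    (hlaw : ∀ i, P.map (τ i) = expMeasure 1) (hindep : iIndepFun τ P) :
    (∀ π : RenewalPolicy, π.UniformlyBounded P τ →
      π.meanArea P τ ≠ ⊤ ∧ π.meanLength P τ ≠ ⊤ ∧ π.meanLength P τ ≠ 0 ∧
      π.averageAge P τ = π.meanArea P τ / π.meanLength P τ) ∧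
    (∀ l : ℝ, 0 ≤ l → 0 < expGap l →
      (0 < l → l < lowThreshold l) ∧
      p₂ P τ l = ((p₂Formula l : ℝ) : EReal) ∧
      (∃ hx : 0 ≤ lowThreshold l,
        (RenewalPolicy.threshold l (lowThreshold l) hx).UniformlyBounded P τ ∧
        (RenewalPolicy.threshold l (lowThreshold l) hx).objective P τ l = p₂Formula l) ∧
      (0 < l → ∀ π : RenewalPolicy, π.UniformlyBounded P τ →
        π.objective P τ l = p₂Formula l → π.IsThreshold l (lowThreshold l))) ∧
    (∀ l : ℝ, 0 ≤ l → expGap l ≤ 0 → p₂ P τ l = ⊥) ∧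
    (∃ l : ℝ, 0 < l ∧ 0 < expGap l ∧ p₂ P τ l = 0 ∧ p₂Formula l = 0 ∧
      (∀ l' : ℝ, p₂ P τ l' = 0 → l' = l) ∧
      |l - 0.72| < 0.005 ∧ |lowThreshold l - 1.48| < 0.005 ∧
      (∀ π : RenewalPolicy, π.UniformlyBounded P τ → ENNReal.ofReal l ≤ π.averageAge P τ) ∧
      (∃ hx : 0 ≤ lowThreshold l,
        (RenewalPolicy.threshold l (lowThreshold l) hx).UniformlyBounded P τ ∧
        (RenewalPolicy.threshold l (lowThreshold l) hx).averageAge P τ = ENNReal.ofReal l) ∧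
      (∀ π : RenewalPolicy, π.UniformlyBounded P τ → π.averageAge P τ = ENNReal.ofReal l →
        π.IsThreshold l (lowThreshold l))) := by
  have hτ := RenewalPolicy.measurePreserving_seqLaw hmeas hlaw hindep
  refine ⟨fun π h => ?_, fun l hl hG => ?_, fun l hl hG => p₂_eq_bot hτ hl hG, ?_⟩
  · have h' := (RenewalPolicy.uniformlyBounded_iff_coord π hτ).1 h
    refine ⟨?_, ?_, ?_, π.averageAge_eq hτ h⟩
    · rw [π.meanArea_eq_epochMean hτ]
      exact π.epochMean_delayArea_ne_top h'
    · rw [π.meanLength_eq_epochMean hτ]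
      exact π.epochMean_ofReal_ne_top h'
    · rw [π.meanLength_eq_epochMean hτ]
      exact π.epochMean_ofReal_ne_zero
  · have hx := hl.trans (le_lowThreshold hG)
    exact ⟨fun hl' => lt_lowThreshold hl' hG, p₂_eq_p₂Formula hτ hl hG,
      ⟨hx, (RenewalPolicy.uniformlyBounded_iff_coord _ hτ).2
        (RenewalPolicy.uniformlyBounded_threshold hl hx),
        RenewalPolicy.objective_threshold hτ hl hG hx⟩,
      fun hl' π h he => π.isThreshold_of_objective_eq hτ
        ((RenewalPolicy.uniformlyBounded_iff_coord _ hτ).1 h) hl' hG he⟩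
  · obtain ⟨l, hl, hG, h₀, hl₁, hx₁⟩ := exists_p₂Formula_eq_zero
    have hx := hl.le.trans (le_lowThreshold hG)
    have hub := (RenewalPolicy.uniformlyBounded_iff_coord _ hτ).2
      (RenewalPolicy.uniformlyBounded_threshold hl.le hx)
    refine ⟨l, hl, hG, ?_, h₀, fun l' h' => eq_of_p₂_eq_zero hτ hl.le hG h₀ h', hl₁, hx₁,
      fun π h => ?_, ⟨hx, hub, ?_⟩, fun π h he => ?_⟩
    · rw [p₂_eq_p₂Formula hτ hl.le hG, h₀, EReal.coe_zero]
    · rw [π.le_averageAge_iff hτ h, ← h₀]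
      exact π.p₂Formula_le_objective hτ
        ((RenewalPolicy.uniformlyBounded_iff_coord _ hτ).1 h) hl.le hG
    · rw [RenewalPolicy.averageAge_eq_iff _ hτ hub hl.le,
        RenewalPolicy.objective_threshold hτ hl.le hG hx, h₀]
    · rw [π.averageAge_eq_iff hτ h hl.le, ← h₀] at he
      exact π.isThreshold_of_objective_eq hτ
        ((RenewalPolicy.uniformlyBounded_iff_coord _ hτ).1 h) hl hG he
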